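/- Let $S$ be a finite partially ordered set of $k$ steps, $U$ a finite non-empty set of $n$ users, $A\subseteq S\times U$ an authorization relation, and let $\sim_1,\dots,\sim_\ell$ be equivalence relations on $U$ that form a canonical organizational hierarchy: the partition of $U$ given by $\sim_i$ is a refinement of the one given by $\sim_{i+1}$ and differs from it, $\sim_1$ has only singleton classes, and $\sim_\ell$ has the single class $U$. A constraint $(\sim_i,S_1,S_2)$ (respectively $(\not\sim_i,S_1,S_2)$), with $S_1,S_2\subseteq S$, is satisfied by a plan $\pi:S\to U$ if $\pi(s_1)\sim_i\pi(s_2)$ (respectively $\pi(s_1)\not\sim_i\pi(s_2)$) for some $s_1\in S_1$, $s_2\in S_2$. It is of Type 2 if $S_1$ or $S_2$ is a singleton, and of Type 3 in general. The workflow satisfiability problem $\mathrm{WSP}_3(\sim_1,\not\sim_1,\dots,\sim_\ell,\not\sim_\ell)$ asks, given $S$, $U$, $A$, the hierarchy and a finite set of such constraints, for a valid plan, i.e. a plan $\pi$ with $(s,\pi(s))\in A$ for all $s\in S$ that satisfies all constraints, or for the answer that there is none. Write the set of constraints as $C\cup C_\sim\cup C_{\not\sim}$, where $C$ consists of the constraints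 of Type 2, and $C_\sim$ and $C_{\not\sim}$ consist of the remaining constraints of the form $(\sim_i,S_1,S_2)$ and $(\not\sim_i,S_1,S_2)$, respectively. Let $c=|C|+|C_{\not\sim}|$ and $c'=|C_\sim|$. (1) There is an algorithm (a random access machine, with logarithmic cost of operations) that solves the problem on all such inputs in time $$\widetilde O\bigl((c+2c')\,n\,2^{k+c'}+n^2\,3^{k+c'}\bigr),$$ where $\widetilde O(T)$ means $O(T\log^d T)$ for some constant $d$ (with $\log(T+2)$ in place of $\log T$, so that small $T$ is included). (2) There is a subset of the constraints that has the same valid plans and for which $C_\sim$ is reduced, that is, $S_1\cap S_2=\emptyset$ for each $(\sim_i,S_1,S_2)\in C_\sim$, and $C_\sim$ contains at most one constraint $(\sim_i,S_1,S_2)$ for any given $S_1$ and $S_2$. Whenever $C_\sim$ is reduced, $c'\le 3^k$. (3) The problem is fixed-parameter tractable with parameter $k$: there are an algorithm that solves it, a computable function $f$ and a constant $d$ such that the running time on inputs of size $N$ is at most $f(k)\,N^d$. -/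

import Mathlib

/-! ### Random access machines with logarithmic cost

A machine has registers (named by the program) and a memory that is addressed indirectly; both hold
natural numbers. Programs are written in structured form. Every operation is charged the bit
lengths of its operands and of the addresses it uses (products and quotients: the product of the
bit lengths). -/

namespace RAM

/-- A configuration: the contents of the registers and of the memory cells. -/
structure State where
  reg : ℕ → ℕ
  mem : ℕ → ℕ

/-- Expressions. -/
inductive Expr where
  | lit (v : ℕ)
  | reg (r : ℕ)
  | load (addr : Expr)
  | add (a b : Expr)
  | sub (a b : Expr)
  | mul (a b : Expr)
  | div (a b : Expr)

namespace Expr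

/-- Value of an expression (`sub` is truncated subtraction, `div` rounds down). -/
def eval (σ : State) : Expr → ℕ
  | lit v => v
  | reg r => σ.reg r
  | load a => σ.mem (a.eval σ)
  | add a b => a.eval σ + b.eval σ
  | sub a b => a.eval σ - b.eval σ
  | mul a b => a.eval σ * b.eval σ
  | div a b => a.eval σ / b.eval σ

/-- Logarithmic cost of evaluating an expression; `Nat.size` is the number of binary digits. -/
def cost (σ : State) : Expr → ℕ
  | lit v => v.size + 1
  | reg r => (σ.reg r).size + 1
  | load a => a.cost σ + (a.eval σ).size + (σ.mem (a.eval σ)).size + 1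
  | add a b => a.cost σ + b.cost σ + (a.eval σ).size + (b.eval σ).size + 1
  | sub a b => a.cost σ + b.cost σ + (a.eval σ).size + (b.eval σ).size + 1
  | mul a b => a.cost σ + b.cost σ + ((a.eval σ).size + 1) * ((b.eval σ).size + 1)
  | div a b => a.cost σ + b.cost σ + ((a.eval σ).size + 1) * ((b.eval σ).size + 1)

end Expr

/-- Programs. Tests succeed when the value of the expression is nonzero. -/
inductive Prog where
  | skip
  | set (r : ℕ) (e : Expr)
  | store (addr e : Expr)
  | seq (p q : Prog)
  | ite (e : Expr) (p q : Prog)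
  | loop (e : Expr) (p : Prog)

/-- `Exec p σ τ t`: started in `σ`, the program `p` halts in `τ`, and the run costs `t`. -/
inductive Exec : Prog → State → State → ℕ → Prop
  | skip (σ : State) : Exec .skip σ σ 1
  | set (σ : State) (r : ℕ) (e : Expr) :
      Exec (.set r e) σ ⟨Function.update σ.reg r (e.eval σ), σ.mem⟩
        (e.cost σ + (e.eval σ).size + 1)
  | store (σ : State) (a e : Expr) :
      Exec (.store a e) σ ⟨σ.reg, Function.update σ.mem (a.eval σ) (e.eval σ)⟩
        (a.cost σ + e.cost σ + (a.eval σ).size + (e.eval σ).size + 1)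
  | seq {p q : Prog} {σ τ υ : State} {t u : ℕ} :
      Exec p σ τ t → Exec q τ υ u → Exec (.seq p q) σ υ (t + u)
  | ite_true {e : Expr} {p q : Prog} {σ τ : State} {t : ℕ} :
      e.eval σ ≠ 0 → Exec p σ τ t → Exec (.ite e p q) σ τ (e.cost σ + (e.eval σ).size + 1 + t)
  | ite_false {e : Expr} {p q : Prog} {σ τ : State} {t : ℕ} :
      e.eval σ = 0 → Exec q σ τ t → Exec (.ite e p q) σ τ (e.cost σ + (e.eval σ).size + 1 + t)
  | loop_true {e : Expr} {p : Prog} {σ τ υ : State} {t u : ℕ} :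
      e.eval σ ≠ 0 → Exec p σ τ t → Exec (.loop e p) τ υ u →
      Exec (.loop e p) σ υ (e.cost σ + (e.eval σ).size + 1 + t + u)
  | loop_false {e : Expr} {p : Prog} {σ : State} :
      e.eval σ = 0 → Exec (.loop e p) σ σ (e.cost σ + (e.eval σ).size + 1)

/-- Initial configuration on the input word list `w`: `w` stands in the memory cells
`0, 1, …, w.length - 1`; all other cells and all registers are zero. -/
def init (w : List ℕ) : State := ⟨fun _ => 0, fun a => w.getD a 0⟩

/-- Number of bits of an input (one extra bit per word as a separator). -/
def bitSize (w : List ℕ) : ℕ := (w.map fun x => x.size + 1).sum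

/-- A search problem: its instances, their encodings as inputs, and the final configurations that
answer an instance correctly. -/
structure Problem where
  Inst : Type
  IsEncoding : Inst → List ℕ → Prop
  IsAnswer : Inst → State → Prop

/-- On every encoding `w` of every instance `x`, the program halts with a correct answer, at total
cost at most `B x w`. -/
def Problem.SolvedBy (Q : Problem) (p : Prog) (B : Q.Inst → List ℕ → ℕ) : Prop :=
  ∀ (x : Q.Inst) (w : List ℕ), Q.IsEncoding x w →
    ∃ (τ : State) (t : ℕ), Exec p (init w) τ t ∧ Q.IsAnswer x τ ∧ t ≤ B x w

/-- `Q` can be solved in time `Õ(T)`, that is, `O(T log^d T)` for some constant `d`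
(the summand `2` only keeps the logarithm positive). -/
def Problem.SolvableInSoftO (Q : Problem) (T : Q.Inst → ℕ) : Prop :=
  ∃ (p : Prog) (K d : ℕ), Q.SolvedBy p fun x _ => K * (T x * Nat.log 2 (T x + 2) ^ d)

/-- `Q` is fixed-parameter tractable: solvable in time `f(κ) N ^ d`, where `κ` is the parameter,
`N` the input size, `f` a computable function and `d` a constant. -/
def Problem.FPT (Q : Problem) (κ : Q.Inst → ℕ) : Prop :=
  ∃ (p : Prog) (f : ℕ → ℕ) (d : ℕ), Computable f ∧
    Q.SolvedBy p fun x w => f (κ x) * bitSize w ^ d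

end RAM

/-! ### The workflow satisfiability problem over an organizational hierarchy -/

namespace WSP

/-- An entailment constraint over `k` steps and `ℓ` levels: `(∼_i, S₁, S₂)` if `same` is `true`,
`(≁_i, S₁, S₂)` if `same` is `false`, where `i` is `level`. -/
structure Constraint (k ℓ : ℕ) where
  same : Bool
  level : Fin ℓ
  S₁ : Finset (Fin k)
  S₂ : Finset (Fin k)

namespace Constraint

variable {k ℓ n : ℕ}

/-- Satisfaction by a plan `π`, where `H i` is the equivalence relation `∼_i`. -/
def Sat (γ : Constraint k ℓ) (H : Fin ℓ → Setoid (Fin n)) (π : Fin k → Fin n) : Prop :=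
  match γ.same with
  | true => ∃ s₁ ∈ γ.S₁, ∃ s₂ ∈ γ.S₂, H γ.level (π s₁) (π s₂)
  | false => ∃ s₁ ∈ γ.S₁, ∃ s₂ ∈ γ.S₂, ¬ H γ.level (π s₁) (π s₂)

/-- Type 2: at least one of the two sets of steps is a singleton. -/
abbrev IsType2 (γ : Constraint k ℓ) : Prop := γ.S₁.card = 1 ∨ γ.S₂.card = 1

/-- Member of `C_∼`: a constraint `(∼_i, S₁, S₂)` that is not of Type 2. -/
abbrev IsSim3 (γ : Constraint k ℓ) : Prop := γ.same = true ∧ ¬ γ.IsType2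

end Constraint

/-- A constrained workflow authorization schema with steps `Fin k` and users `Fin n`, over an
organizational hierarchy with levels `0, …, ℓ - 1`. All constraints have the form
`(∼_i, S₁, S₂)` or `(≁_i, S₁, S₂)`. -/
structure Workflow where
  k : ℕ
  n : ℕ
  ℓ : ℕ
  n_pos : 0 < n
  stepOrder : PartialOrder (Fin k)
  auth : Fin k → Fin n → Prop
  hier : Fin ℓ → Setoid (Fin n)
  /-- Each level is a refinement of the next. -/
  hier_refines : ∀ i j : Fin ℓ, (i : ℕ) + 1 = j → hier i ≤ hier j
  constraints : Finset (Constraint k ℓ)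

namespace Workflow

/-- The hierarchy is canonical: consecutive levels differ, the last level has the single block
`U`, and the first level consists of the singletons. -/
structure IsCanonical (W : Workflow) : Prop where
  ℓ_pos : 0 < W.ℓ
  ne_succ : ∀ i j : Fin W.ℓ, (i : ℕ) + 1 = j → W.hier i ≠ W.hier j
  last : ∀ i : Fin W.ℓ, (i : ℕ) + 1 = W.ℓ → W.hier i = ⊤
  first : ∀ i : Fin W.ℓ, (i : ℕ) = 0 → W.hier i = ⊥

/-- A plan is valid if it is authorized and satisfies all constraints. -/
def IsValid (W : Workflow) (π : Fin W.k → Fin W.n) : Prop :=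
  (∀ s, W.auth s (π s)) ∧ ∀ γ ∈ W.constraints, γ.Sat W.hier π

/-- `c' = |C_∼|`. -/
def numSim3 (W : Workflow) : ℕ := (W.constraints.filter fun γ => γ.IsSim3).card

/-- `c`, the number of all other constraints: those of Type 2, and the Type 3 constraints
`(≁_i, S₁, S₂)`. -/
def numOther (W : Workflow) : ℕ := (W.constraints.filter fun γ => ¬ γ.IsSim3).card

/-- `(c + 2c') n 2^{k+c'} + n² 3^{k+c'}`. -/
def timeBound (W : Workflow) : ℕ :=
  (W.numOther + 2 * W.numSim3) * W.n * 2 ^ (W.k + W.numSim3)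
    + W.n ^ 2 * 3 ^ (W.k + W.numSim3)

/-- `C_∼` has no redundant constraints: `S₁ ∩ S₂ = ∅` for each `(∼_i, S₁, S₂)` in it, and it
contains at most one constraint `(∼_i, S₁, S₂)` for given `S₁`, `S₂`. -/
def IsReduced (W : Workflow) : Prop :=
  (∀ γ ∈ W.constraints, γ.IsSim3 → Disjoint γ.S₁ γ.S₂) ∧
  ∀ γ ∈ W.constraints, ∀ γ' ∈ W.constraints, γ.IsSim3 → γ'.IsSim3 →
    γ.S₁ = γ'.S₁ → γ.S₂ = γ'.S₂ → γ = γ'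

/-- The same workflow with another set of constraints. -/
abbrev withConstraints (W : Workflow) (D : Finset (Constraint W.k W.ℓ)) : Workflow :=
  { W with constraints := D }

end Workflow

open Classical in
/-- Truth value as a word. -/
noncomputable def bit (p : Prop) : ℕ := if p then 1 else 0

/-- A constraint as `2 + 2k` words: `0` for `∼` and `1` for `≁`, the level, and the
characteristic vectors of `S₁` and `S₂`. -/
noncomputable def Constraint.encode {k ℓ : ℕ} (γ : Constraint k ℓ) : List ℕ :=
  [bit (γ.same = false), (γ.level : ℕ)]
    ++ (List.finRange k).map (fun s => bit (s ∈ γ.S₁))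
    ++ (List.finRange k).map (fun s => bit (s ∈ γ.S₂))

/-- `w` encodes `W`: it consists of `k`, `n`, `ℓ` and the number of constraints, the matrix of the
order on the steps, the matrix of the authorization relation, a block number for each level and
user (any numbering of the blocks of a level), and the constraints in any order. -/
def Workflow.IsEncoding (W : Workflow) (w : List ℕ) : Prop :=
  ∃ (block : Fin W.ℓ → Fin W.n → Fin W.n) (L : List (Constraint W.k W.ℓ)),
    (∀ i u v, block i u = block i v ↔ W.hier i u v) ∧
    L.Nodup ∧ (∀ γ, γ ∈ L ↔ γ ∈ W.constraints) ∧
    w = [W.k, W.n, W.ℓ, L.length]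
      ++ (List.finRange W.k).flatMap (fun s =>
          (List.finRange W.k).map fun s' => bit (W.stepOrder.le s s'))
      ++ (List.finRange W.k).flatMap (fun s =>
          (List.finRange W.n).map fun u => bit (W.auth s u))
      ++ (List.finRange W.ℓ).flatMap (fun i =>
          (List.finRange W.n).map fun u => (block i u : ℕ))
      ++ L.flatMap Constraint.encode

/-- A correct output: `0` in memory cell `0` if there is no valid plan; otherwise `1` in cell `0`
and the users of a valid plan in the cells `1, …, k`. -/
def Workflow.IsAnswer (W : Workflow) (τ : RAM.State) : Prop :=
  (τ.mem 0 = 0 ∧ ∀ π, ¬ W.IsValid π) ∨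
  (τ.mem 0 = 1 ∧ ∃ π, W.IsValid π ∧ ∀ s : Fin W.k, τ.mem ((s : ℕ) + 1) = (π s : ℕ))

/-- The problem `WSP₃(∼_1, ≁_1, …, ∼_ℓ, ≁_ℓ)` for canonical organizational hierarchies; the
hierarchy and its number of levels are part of the input. -/
def wsp3 : RAM.Problem where
  Inst := {W : Workflow // W.IsCanonical}
  IsEncoding W w := W.1.IsEncoding w
  IsAnswer W τ := W.1.IsAnswer τ

end WSP

/-! ### Size and cost of single instructions -/

namespace RAM

/-! The algorithm is a dynamic program over the blocks of the hierarchy, and it works because every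
constraint can be turned into a condition on single blocks: on the set of steps that are assigned to
the users of one block of the constraint's own level. A constraint with `≁` holds iff its two sets
are nonempty and no block receives both of them entirely. A constraint with `∼` one of whose sets is
a singleton holds iff the block that receives this step also receives a step from each of the two
sets. For the remaining constraints with `∼` a dummy step is added, which every user may perform; it
marks a block in which the constraint is witnessed, and the block that receives it must receive a
step from each set. The singleton or the dummy step is the anchor of the constraint.

Constraints with the same pair of sets share a dummy step: it is given to a user of a block that
witnesses the constraint of lowest level, and the witnesses stay together at all higher levels
(`ValidPlan.exists_user`). Hence there are at most `min c' (4 ^ k)` dummy steps. That good plans for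
the extended set of steps correspond to valid plans is the content of `validPlan_of_good` and
`ValidPlan.exists_good`.

Let `K` be the number of steps including dummies. For each block there is a row with `2 ^ K`
entries, one for each set `X` of steps; an entry is `0` if `X` cannot be assigned within the block,
and otherwise one more than the code in base `n` of such an assignment. Rows of single users are
immediate (`represents_singleton`). The row of a block comes from the rows of its subblocks by
merging, which runs through the `3 ^ K` ordered pairs of disjoint sets (`Represents.merge`), and
then by erasing the sets that violate a constraint of this level (`Represents.check`). There are `n`
merges per level, and a canonical hierarchy has at most `n` levels since the number of blocks drops
strictly (`IsCanonical.ℓ_le`); this gives `n² 3 ^ K`. Each constraint is checked only at its own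
level, on `n 2 ^ K` entries.

To obtain an actual machine, the algorithm is written in a small language with arrays and bounded
loops, whose programs are compiled. If all stored values have at most `b` bits, then each step of a
command costs at most a fixed power of `b + 2` (`Run.compile_spec`), so that only steps and bit
lengths have to be counted. Here `b` is quadratic in the logarithm of the time bound, which gives
the polylogarithmic factor (`solvableInSoftO`).

Fixed-parameter tractability (`fpt`) uses the other bound `4 ^ k` for the number of dummy steps;
since the program shares dummy steps, no preliminary reduction of the constraints is needed. The
statements on reduced sets are independent of the machine: a constraint `∼` at a lower level implies
those with the same sets at higher levels, a step common to both sets makes the constraint trivial,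
and disjoint pairs of subsets of the steps correspond to functions into a set with three elements.
-/

theorem size_add_le (a b : ℕ) : (a + b).size ≤ a.size + b.size + 1 := by
  rw [Nat.size_le]
  have ha := Nat.lt_size_self a
  have hb := Nat.lt_size_self b
  have h1 : 2 ^ a.size ≤ 2 ^ (a.size + b.size) := Nat.pow_le_pow_right (by norm_num) (by omega)
  have h2 : 2 ^ b.size ≤ 2 ^ (a.size + b.size) := Nat.pow_le_pow_right (by norm_num) (by omega)
  rw [pow_succ]
  omega

theorem size_mul_le (a b : ℕ) : (a * b).size ≤ a.size + b.size := by
  rcases Nat.eq_zero_or_pos b with rfl | hb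
  · simp
  rw [Nat.size_le, pow_add]
  exact lt_of_lt_of_le (Nat.mul_lt_mul_of_pos_right (Nat.lt_size_self a) hb)
    (Nat.mul_le_mul_left _ (Nat.lt_size_self b).le)

theorem size_le_self (a : ℕ) : a.size ≤ a := by
  rw [Nat.size_le]
  exact Nat.lt_two_pow_self

theorem size_sub_le (a b : ℕ) : (a - b).size ≤ a.size := Nat.size_le_size (Nat.sub_le a b)

theorem size_div_le (a b : ℕ) : (a / b).size ≤ a.size := Nat.size_le_size (Nat.div_le_self a b)

/-- Every number is at most the power of a base at least two with that exponent. -/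
theorem le_pow_self {X : ℕ} (hX : 2 ≤ X) (c : ℕ) : c ≤ X ^ c :=
  (Nat.lt_pow_self (by omega)).le

theorem le_pow_of_le_of_le {X a v w : ℕ} (hX : 2 ≤ X) (h : a ≤ X ^ v) (hvw : v ≤ w) :
    a ≤ X ^ w :=
  h.trans (Nat.pow_le_pow_right (by omega) hvw)

/-- A quadratic polynomial in a power of `X`. -/
theorem quadratic_le_pow {X Y c w v : ℕ} (hX : 2 ≤ X) (hY : Y ≤ X ^ v)
    (hc : c ≤ 2 ^ w * Y ^ 2) : c ≤ X ^ (2 * v + w) := by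
  calc c ≤ 2 ^ w * Y ^ 2 := hc
    _ ≤ X ^ w * (X ^ v) ^ 2 := by gcongr
    _ = X ^ (2 * v + w) := by ring

/-- A cubic polynomial in a power of `X`. -/
theorem cubic_le_pow {X Y c w v : ℕ} (hX : 2 ≤ X) (hY : Y ≤ X ^ v)
    (hc : c ≤ 2 ^ w * Y ^ 3) : c ≤ X ^ (3 * v + w) := by
  calc c ≤ 2 ^ w * Y ^ 3 := hc
    _ ≤ X ^ w * (X ^ v) ^ 3 := by gcongr
    _ = X ^ (3 * v + w) := by ring

/-! ### A structured language with arrays and immutable variables -/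

/-- Binary operations; `eq` has value `1` if its operands are equal, and `0` otherwise. -/
inductive Op where
  | add
  | sub
  | mul
  | div
  | mod
  | eq

namespace Op

def eval : Op → ℕ → ℕ → ℕ
  | add, a, b => a + b
  | sub, a, b => a - b
  | mul, a, b => a * b
  | div, a, b => a / b
  | mod, a, b => a % b
  | eq, a, b => if a = b then 1 else 0

def expr : Op → Expr → Expr → Expr
  | add, a, b => .add a b
  | sub, a, b => .sub a b
  | mul, a, b => .mul a b
  | div, a, b => .div a b
  | mod, a, b => .sub a (.mul (.div a b) b)
  | eq, a, b => .sub (.lit 1) (.add (.sub a b) (.sub b a))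

/-- The machine has neither remainders nor comparisons. The former are `a - (a / b) * b`, also for
`b = 0`; for the latter, the two truncated differences add up to the distance of the operands, which
is truncated to a truth value by subtracting it from `1`. -/
theorem eval_expr (o : Op) (a b : Expr) (σ : State) :
    (o.expr a b).eval σ = o.eval (a.eval σ) (b.eval σ) := by
  cases o <;> simp [expr, eval, Expr.eval]
  · rw [Nat.mod_eq_sub_div_mul]
  · split_ifs with h
    · omega
    · omega

theorem size_eval_le (o : Op) (a b : ℕ) : (o.eval a b).size ≤ a.size + b.size + 1 := by
  cases o <;> simp only [eval]
  · exact size_add_le a b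
  · have := size_sub_le a b; omega
  · have := size_mul_le a b; omega
  · have := size_div_le a b; omega
  · have := Nat.size_le_size (Nat.mod_le a b); omega
  · split_ifs <;> simp

/-- Products and quotients are the only source of the square. In a remainder, the product is at most
the first operand, so that it does not lengthen the numbers. -/
theorem cost_expr_le (o : Op) (σ : State) (r s : ℕ) :
    (o.expr (.reg r) (.reg s)).cost σ ≤ 16 * ((σ.reg r).size + (σ.reg s).size + 2) ^ 2 := by
  cases o <;> simp only [expr, Expr.cost, Expr.eval]
  · nlinarith
  · nlinarith
  · nlinarith
  · nlinarith
  · have h1 := size_div_le (σ.reg r) (σ.reg s)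
    have h2 : (σ.reg r / σ.reg s * σ.reg s).size ≤ (σ.reg r).size :=
      Nat.size_le_size (Nat.div_mul_le_self _ _)
    have h3 : ((σ.reg r / σ.reg s).size + 1) * ((σ.reg s).size + 1) ≤
      ((σ.reg r).size + 1) * ((σ.reg s).size + 1) := by gcongr
    nlinarith
  · have h1 := size_sub_le (σ.reg r) (σ.reg s)
    have h2 := size_sub_le (σ.reg s) (σ.reg r)
    have h3 := size_add_le (σ.reg r - σ.reg s) (σ.reg s - σ.reg r)
    have h4 : (1 : ℕ).size = 1 := by simp
    rw [h4]
    nlinarith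

end Op

/-- Expressions over variables and arrays. `sum x N e` is the sum of `e` over `x < N`. -/
inductive Exp where
  | lit (v : ℕ)
  | var (x : ℕ)
  | arr (a : ℕ) (e : Exp)
  | op (o : Op) (a b : Exp)
  | pow (a e : Exp)
  | sum (x : ℕ) (N e : Exp)

namespace Exp

def eval (A : ℕ → ℕ → ℕ) : Exp → (ℕ → ℕ) → ℕ
  | lit v, _ => v
  | var x, ρ => ρ x
  | arr a e, ρ => A a (e.eval A ρ)
  | op o a b, ρ => o.eval (a.eval A ρ) (b.eval A ρ)
  | pow a e, ρ => a.eval A ρ ^ e.eval A ρ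
  | sum x N e, ρ => ∑ i ∈ Finset.range (N.eval A ρ), e.eval A (Function.update ρ x i)

/-- Well-formed at binding depth `d`: the variables in scope are those below `d`, and a binder
introduces the next one. There are sixteen arrays. -/
def wf : ℕ → Exp → Bool
  | _, lit _ => true
  | d, var x => decide (x < d)
  | d, arr a e => decide (a < 16) && e.wf d
  | d, op _ a b => a.wf d && b.wf d
  | d, pow a e => a.wf d && e.wf d
  | d, sum x N e => decide (x = d) && N.wf d && e.wf (d + 1)

/-- Results of powers and sums are less than `2 ^ b`, and there are at most `b` iterations. -/
def Safe (b : ℕ) (A : ℕ → ℕ → ℕ) : Exp → (ℕ → ℕ) → Prop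
  | lit _, _ => True
  | var _, _ => True
  | arr _ e, ρ => e.Safe b A ρ
  | op _ a b', ρ => a.Safe b A ρ ∧ b'.Safe b A ρ
  | pow a e, ρ => a.Safe b A ρ ∧ e.Safe b A ρ ∧ e.eval A ρ ≤ b ∧ a.eval A ρ ^ e.eval A ρ < 2 ^ b
  | sum x N e, ρ => N.Safe b A ρ ∧ N.eval A ρ ≤ b ∧
      (∀ i < N.eval A ρ, e.Safe b A (Function.update ρ x i)) ∧
      ∑ i ∈ Finset.range (N.eval A ρ), e.eval A (Function.update ρ x i) < 2 ^ b

/-- Exponent of the cost. -/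
def weight : Exp → ℕ
  | lit v => 2 * v + 4
  | var _ => 8
  | arr _ e => 2 * e.weight + 20
  | op _ a b => 2 * (a.weight + b.weight) + 20
  | pow a e => 3 * (a.weight + e.weight) + 30
  | sum _ N e => 2 * (N.weight + e.weight) + 30

/-- Compilation at temporary level `t`; the value ends up in register `2 * t + 2`. Register `0`
holds the base address of the arrays. -/
def compile : Exp → ℕ → Prog
  | lit v, t => .set (2 * t + 2) (.lit v)
  | var x, t => .set (2 * t + 2) (.reg (2 * x + 1))
  | arr a e, t => .seq (e.compile t)
      (.set (2 * t + 2)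
        (.load (.add (.reg 0) (.add (.mul (.lit 16) (.reg (2 * t + 2))) (.lit a)))))
  | op o a b, t => .seq (a.compile t) (.seq (b.compile (t + 1))
      (.set (2 * t + 2) (o.expr (.reg (2 * t + 2)) (.reg (2 * (t + 1) + 2)))))
  | pow a e, t => .seq (a.compile t) (.seq (e.compile (t + 1))
      (.seq (.set (2 * (t + 2) + 2) (.lit 1))
      (.seq (.loop (.reg (2 * (t + 1) + 2))
        (.seq (.set (2 * (t + 2) + 2) (.mul (.reg (2 * (t + 2) + 2)) (.reg (2 * t + 2))))
          (.set (2 * (t + 1) + 2) (.sub (.reg (2 * (t + 1) + 2)) (.lit 1)))))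
      (.set (2 * t + 2) (.reg (2 * (t + 2) + 2))))))
  | sum x N e, t => .seq (N.compile t) (.seq (.set (2 * (t + 1) + 2) (.lit 0))
      (.seq (.set (2 * x + 1) (.lit 0))
      (.seq (.loop (.sub (.reg (2 * t + 2)) (.reg (2 * x + 1)))
        (.seq (e.compile (t + 2))
          (.seq (.set (2 * (t + 1) + 2) (.add (.reg (2 * (t + 1) + 2)) (.reg (2 * (t + 2) + 2))))
            (.set (2 * x + 1) (.add (.reg (2 * x + 1)) (.lit 1))))))
      (.set (2 * t + 2) (.reg (2 * (t + 1) + 2))))))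

/-- Variables, array cells, powers and sums have at most `b` bits by hypothesis, and a binary
operation at most adds the lengths of its operands, up to one bit. Thus the exponent depends on the
expression only, never on the input. -/
theorem size_eval_le {b : ℕ} {A : ℕ → ℕ → ℕ} (hA : ∀ a i, A a i < 2 ^ b) :
    ∀ (e : Exp) (d : ℕ) (ρ : ℕ → ℕ), e.wf d = true → (∀ x < d, ρ x < 2 ^ b) → e.Safe b A ρ →
      (e.eval A ρ).size ≤ (b + 2) ^ e.weight
  | lit v, _, _, _, _, _ => by
      exact (size_le_self v).trans
        (le_pow_of_le_of_le (by omega) (le_pow_self (by omega) v) (by simp only [weight]; omega))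
  | var x, d, ρ, hw, hρ, _ => by
      simp only [wf, decide_eq_true_eq] at hw
      have := Nat.size_le.2 (hρ x hw)
      simp only [eval]
      exact le_pow_of_le_of_le (v := 1) (by omega) (by rw [pow_one]; omega) (by simp only [weight]; omega)
  | arr a e, d, ρ, _, _, _ => by
      have := Nat.size_le.2 (hA a (e.eval A ρ))
      simp only [eval]
      exact le_pow_of_le_of_le (v := 1) (by omega) (by rw [pow_one]; omega) (by simp only [weight]; omega)
  | op o a c, d, ρ, hw, hρ, hs => by
      simp only [wf, Bool.and_eq_true] at hw
      have h1 := size_eval_le hA a d ρ hw.1 hρ hs.1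
      have h2 := size_eval_le hA c d ρ hw.2 hρ hs.2
      have h1' := le_pow_of_le_of_le (w := a.weight + c.weight) (by omega) h1 (by omega)
      have h2' := le_pow_of_le_of_le (w := a.weight + c.weight) (by omega) h2 (by omega)
      have h3 := o.size_eval_le (a.eval A ρ) (c.eval A ρ)
      have h4 : 1 ≤ (b + 2) ^ (a.weight + c.weight) := Nat.one_le_pow _ _ (by omega)
      simp only [eval, weight]
      refine quadratic_le_pow (by omega) le_rfl ?_
      nlinarith
  | pow a e, d, ρ, _, _, hs => by
      have := Nat.size_le.2 hs.2.2.2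
      simp only [eval]
      exact le_pow_of_le_of_le (v := 1) (by omega) (by rw [pow_one]; omega) (by simp only [weight]; omega)
  | sum x N e, d, ρ, _, _, hs => by
      have := Nat.size_le.2 hs.2.2.2
      simp only [eval]
      exact le_pow_of_le_of_le (v := 1) (by omega) (by rw [pow_one]; omega) (by simp only [weight]; omega)

end Exp

/-! ### Machine states that represent variables and arrays. -/

/-- The machine state `σ` represents the variables below `d` and the arrays. -/
structure Rel (L d : ℕ) (ρ : ℕ → ℕ) (A : ℕ → ℕ → ℕ) (σ : State) : Prop where
  base : σ.reg 0 = L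
  var : ∀ x < d, σ.reg (2 * x + 1) = ρ x
  arr : ∀ a < 16, ∀ i, σ.mem (L + (16 * i + a)) = A a i

/-- The states agree except for variables from `d` on, temporaries from `t` on, and memory. -/
structure Keeps (d t : ℕ) (σ τ : State) : Prop where
  base : τ.reg 0 = σ.reg 0
  var : ∀ x < d, τ.reg (2 * x + 1) = σ.reg (2 * x + 1)
  temp : ∀ s < t, τ.reg (2 * s + 2) = σ.reg (2 * s + 2)

theorem Keeps.refl (d t : ℕ) (σ : State) : Keeps d t σ σ :=
  ⟨rfl, fun _ _ => rfl, fun _ _ => rfl⟩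

theorem Keeps.trans {d t : ℕ} {σ τ υ : State} (h : Keeps d t σ τ) (h' : Keeps d t τ υ) :
    Keeps d t σ υ :=
  ⟨h'.base.trans h.base, fun x hx => (h'.var x hx).trans (h.var x hx),
    fun s hs => (h'.temp s hs).trans (h.temp s hs)⟩

theorem Keeps.mono {d t d' t' : ℕ} {σ τ : State} (h : Keeps d t σ τ) (hd : d' ≤ d)
    (ht : t' ≤ t) : Keeps d' t' σ τ :=
  ⟨h.base, fun x hx => h.var x (by omega), fun s hs => h.temp s (by omega)⟩

theorem Keeps.update_temp {d t s v : ℕ} (σ : State) (hs : t ≤ s) :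
    Keeps d t σ ⟨Function.update σ.reg (2 * s + 2) v, σ.mem⟩ :=
  ⟨by simp only; rw [Function.update_of_ne (by omega)],
    fun x _ => by simp only; rw [Function.update_of_ne (by omega)],
    fun r hr => by simp only; rw [Function.update_of_ne (by omega)]⟩

theorem Keeps.update_var {d t x v : ℕ} (σ : State) (hx : d ≤ x) :
    Keeps d t σ ⟨Function.update σ.reg (2 * x + 1) v, σ.mem⟩ :=
  ⟨by simp only; rw [Function.update_of_ne (by omega)],
    fun y hy => by simp only; rw [Function.update_of_ne (by omega)],
    fun r _ => by simp only; rw [Function.update_of_ne (by omega)]⟩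

theorem Rel.keeps {L d t : ℕ} {ρ : ℕ → ℕ} {A : ℕ → ℕ → ℕ} {σ τ : State} (h : Rel L d ρ A σ)
    (h' : Keeps d t σ τ) (hm : τ.mem = σ.mem) : Rel L d ρ A τ :=
  ⟨h'.base.trans h.base, fun x hx => (h'.var x hx).trans (h.var x hx), fun a ha i => by
    rw [hm]; exact h.arr a ha i⟩

theorem Exec.set' {σ : State} {r : ℕ} {e : Expr} {v c : ℕ} (hv : e.eval σ = v)
    (hc : e.cost σ + v.size + 1 = c) :
    Exec (.set r e) σ ⟨Function.update σ.reg r v, σ.mem⟩ c := by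
  subst hv hc
  exact Exec.set σ r e

/-- A loop with an invariant indexed by the number of iterations finish. -/
theorem Exec.loop_of_invariant {e : Expr} {p : Prog} (S : ℕ → State → Prop) (N c₁ : ℕ)
    (c₂ : ℕ → ℕ)
    (step : ∀ i < N, ∀ σ, S i σ → e.eval σ ≠ 0 ∧ e.cost σ + (e.eval σ).size + 1 ≤ c₁ ∧
      ∃ τ t, Exec p σ τ t ∧ t ≤ c₂ i ∧ S (i + 1) τ)
    (finish : ∀ σ, S N σ → e.eval σ = 0 ∧ e.cost σ + (e.eval σ).size + 1 ≤ c₁) :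
    ∀ σ, S 0 σ → ∃ τ t, Exec (.loop e p) σ τ t ∧ S N τ ∧
      t ≤ ∑ i ∈ Finset.range N, (c₁ + c₂ i) + c₁ := by
  -- The induction is on the number `r` of iterations that remain, because `Exec.loop_true` splits
  -- off the first of them.
  suffices h : ∀ r i σ, i + r = N → S i σ → ∃ τ t, Exec (.loop e p) σ τ t ∧ S N τ ∧
      t ≤ ∑ j ∈ Finset.range r, (c₁ + c₂ (i + j)) + c₁ by
    intro σ hσ
    simpa using h N 0 σ (by omega) hσ
  intro r
  induction r with
  | zero =>
    intro i σ hi hσ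
    obtain rfl : i = N := by omega
    exact ⟨σ, _, Exec.loop_false (finish σ hσ).1, hσ, by simpa using (finish σ hσ).2⟩
  | succ r ih =>
    intro i σ hi hσ
    obtain ⟨h0, hc, τ, t, hτ, ht, hS⟩ := step i (by omega) σ hσ
    obtain ⟨υ, u, hυ, hSN, hu⟩ := ih (i + 1) τ (by omega) hS
    refine ⟨υ, _, Exec.loop_true h0 hτ hυ, hSN, ?_⟩
    rw [Finset.sum_range_succ']
    have : ∑ j ∈ Finset.range r, (c₁ + c₂ (i + (j + 1))) =
        ∑ j ∈ Finset.range r, (c₁ + c₂ (i + 1 + j)) :=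
      Finset.sum_congr rfl fun j _ => by rw [show i + (j + 1) = i + 1 + j by omega]
    rw [this]
    simp only [Nat.add_zero]
    omega

end RAM

/-! ### Correctness and cost of compiled expressions -/

namespace RAM

/-- The sixteen arrays are interleaved: cell `i` of array `a` has the address `L + 16 i + a`, so no
array needs a length. One factor in the address computation is constant, whence every contribution
is linear in `Y`. -/
theorem cost_load_le {σ : State} {b t a Y : ℕ} (hL : σ.reg 0 < 2 ^ b) (ha : a < 16)
    (hm : σ.mem (σ.reg 0 + (16 * σ.reg t + a)) < 2 ^ b)
    (hb : b + 2 ≤ Y) (hi : (σ.reg t).size ≤ Y) :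
    (Expr.load (.add (.reg 0) (.add (.mul (.lit 16) (.reg t)) (.lit a)))).cost σ
      + (σ.mem (σ.reg 0 + (16 * σ.reg t + a))).size + 1 ≤ 2 ^ 9 * Y ^ 2 := by
  simp only [Expr.cost, Expr.eval]
  have h1 := Nat.size_le.2 hL
  have h2 := Nat.size_le.2 hm
  have h3 : a.size ≤ 4 := Nat.size_le.2 ha
  have h4 : (16 : ℕ).size ≤ 5 := Nat.size_le.2 (by norm_num)
  have h5 := size_mul_le 16 (σ.reg t)
  have h6 := size_add_le (16 * σ.reg t) a
  have h7 := size_add_le (σ.reg 0) (16 * σ.reg t + a)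
  have h8 : ((16 : ℕ).size + 1) * ((σ.reg t).size + 1) ≤ 6 * (Y + 1) :=
    Nat.mul_le_mul (by omega) (by omega)
  have h9 : 2 ≤ Y := by omega
  nlinarith

namespace Exp

/-- Outcome of running the compiled expression `e` in `σ`. -/
def CompileSpec (b : ℕ) (A : ℕ → ℕ → ℕ) (d t : ℕ) (ρ : ℕ → ℕ) (e : Exp) (σ : State) : Prop :=
  ∃ σ' c, Exec (e.compile t) σ σ' c ∧ c ≤ (b + 2) ^ e.weight ∧ σ'.mem = σ.mem ∧
    Keeps d t σ σ' ∧ σ'.reg (2 * t + 2) = e.eval A ρ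

theorem compile_lit (b : ℕ) (A : ℕ → ℕ → ℕ) (v d t : ℕ) (ρ : ℕ → ℕ) (σ : State) :
    CompileSpec b A d t ρ (lit v) σ := by
  refine ⟨_, _, Exec.set _ _ _, ?_, rfl, Keeps.update_temp σ le_rfl, by simp [eval, Expr.eval]⟩
  simp only [Expr.cost, Expr.eval, weight]
  have := size_le_self v
  refine le_trans ?_ ((le_pow_self (X := b + 2) (by omega) _))
  omega

theorem compile_var {b L d : ℕ} {A : ℕ → ℕ → ℕ} {ρ : ℕ → ℕ} {σ : State} (x t : ℕ) (hx : x < d)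
    (hρ : ∀ x < d, ρ x < 2 ^ b) (hσ : Rel L d ρ A σ) : CompileSpec b A d t ρ (var x) σ := by
  refine ⟨_, _, Exec.set _ _ _, ?_, rfl, Keeps.update_temp σ le_rfl, by
    simp [eval, Expr.eval, hσ.var x hx]⟩
  simp only [Expr.cost, Expr.eval, weight, hσ.var x hx]
  have := Nat.size_le.2 (hρ x hx)
  refine quadratic_le_pow (v := 1) (w := 6) (by omega) le_rfl ?_
  rw [pow_one]
  nlinarith

theorem compile_arr {b L d : ℕ} {A : ℕ → ℕ → ℕ} (hA : ∀ a i, A a i < 2 ^ b) (hL : L < 2 ^ b)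
    {ρ : ℕ → ℕ} {σ : State} (a t : ℕ) (e : Exp) (ha : a < 16)
    (hσ : Rel L d ρ A σ) (hi : (e.eval A ρ).size ≤ (b + 2) ^ e.weight)
    (he : CompileSpec b A d t ρ e σ) : CompileSpec b A d t ρ (arr a e) σ := by
  obtain ⟨σ', c, h1, h2, h3, h4, h5⟩ := he
  have hσ' := hσ.keeps h4 h3
  have hv : σ'.mem (σ'.reg 0 + (16 * σ'.reg (2 * t + 2) + a)) = A a (e.eval A ρ) := by
    rw [h5, hσ'.base, hσ'.arr a ha]
  refine ⟨_, _, h1.seq (Exec.set _ _ _), ?_, h3, h4.trans (Keeps.update_temp σ' le_rfl), by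
    simp [eval, Expr.eval, hv]⟩
  have hY : b + 2 ≤ (b + 2) ^ (e.weight + 1) := Nat.le_self_pow (by omega) _
  have := cost_load_le (σ := σ') (b := b) (t := 2 * t + 2) (a := a) (Y := (b + 2) ^ (e.weight + 1))
    (by rwa [hσ'.base]) ha (by rw [hv]; exact hA _ _) hY
    (by rw [h5]; exact le_pow_of_le_of_le (by omega) hi (by omega))
  have h6 := le_pow_of_le_of_le (w := e.weight + 1) (by omega) h2 (by omega)
  rw [show (arr a e).weight = 2 * (e.weight + 1) + 18 by simp only [weight]; omega]
  refine quadratic_le_pow (by omega) le_rfl ?_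
  simp only [Expr.eval] at this ⊢
  nlinarith

theorem compile_op {b L d : ℕ} {A : ℕ → ℕ → ℕ} {ρ : ℕ → ℕ} {σ : State} (o : Op) (t : ℕ)
    (e f : Exp) (hσ : Rel L d ρ A σ) (hi : (e.eval A ρ).size ≤ (b + 2) ^ e.weight)
    (hj : (f.eval A ρ).size ≤ (b + 2) ^ f.weight)
    (he : CompileSpec b A d t ρ e σ)
    (hf : ∀ τ, Rel L d ρ A τ → CompileSpec b A d (t + 1) ρ f τ) :
    CompileSpec b A d t ρ (op o e f) σ := by
  obtain ⟨σ', c, h1, h2, h3, h4, h5⟩ := he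
  obtain ⟨τ, c', k1, k2, k3, k4, k5⟩ := hf σ' (hσ.keeps h4 h3)
  have hr : τ.reg (2 * t + 2) = e.eval A ρ := (k4.temp t (by omega)).trans h5
  refine ⟨_, _, h1.seq (k1.seq (Exec.set _ _ _)), ?_, k3.trans h3,
    (h4.trans (k4.mono le_rfl (by omega))).trans (Keeps.update_temp τ le_rfl), by
    simp [eval, Op.eval_expr, Expr.eval, hr, k5]⟩
  have hc := o.cost_expr_le τ (2 * t + 2) (2 * (t + 1) + 2)
  rw [Op.eval_expr]
  simp only [Expr.eval]
  rw [hr, k5] at hc ⊢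
  have hsz := o.size_eval_le (e.eval A ρ) (f.eval A ρ)
  have hX : 2 ≤ b + 2 := by omega
  have e1 := le_pow_of_le_of_le (w := e.weight + f.weight) hX hi (by omega)
  have e2 := le_pow_of_le_of_le (w := e.weight + f.weight) hX hj (by omega)
  have e3 := le_pow_of_le_of_le (w := e.weight + f.weight) hX h2 (by omega)
  have e4 := le_pow_of_le_of_le (w := e.weight + f.weight) hX k2 (by omega)
  have e5 : 1 ≤ (b + 2) ^ (e.weight + f.weight) := Nat.one_le_pow _ _ (by omega)
  simp only [weight]
  refine quadratic_le_pow hX le_rfl ?_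
  have : ((e.eval A ρ).size + (f.eval A ρ).size + 2) ^ 2 ≤ (4 * (b + 2) ^ (e.weight + f.weight)) ^ 2 :=
    Nat.pow_le_pow_left (by omega) 2
  nlinarith

/-- Powers are computed by repeated multiplication, with at most `b` iterations of quadratic cost;
this explains the cubic bound. The exponent serves as the loop counter. -/
theorem compile_pow {b L d : ℕ} {A : ℕ → ℕ → ℕ} {ρ : ℕ → ℕ} {σ : State} (t : ℕ)
    (e f : Exp) (hσ : Rel L d ρ A σ) (hi : (e.eval A ρ).size ≤ (b + 2) ^ e.weight)
    (hb : f.eval A ρ ≤ b) (hp : e.eval A ρ ^ f.eval A ρ < 2 ^ b)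
    (he : CompileSpec b A d t ρ e σ)
    (hf : ∀ τ, Rel L d ρ A τ → CompileSpec b A d (t + 1) ρ f τ) :
    CompileSpec b A d t ρ (pow e f) σ := by
  obtain ⟨σ', c, h1, h2, h3, h4, h5⟩ := he
  obtain ⟨τ, c', k1, k2, k3, k4, k5⟩ := hf σ' (hσ.keeps h4 h3)
  have hr : τ.reg (2 * t + 2) = e.eval A ρ := (k4.temp t (by omega)).trans h5
  set v := e.eval A ρ with hv
  set N := f.eval A ρ with hN
  have hX : 2 ≤ b + 2 := by omega
  set Y := (b + 2) ^ (e.weight + f.weight + 1) with hY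
  have e1 : v.size ≤ Y := le_pow_of_le_of_le hX hi (by omega)
  have e2 : c ≤ Y := le_pow_of_le_of_le hX h2 (by omega)
  have e3 : c' ≤ Y := le_pow_of_le_of_le hX k2 (by omega)
  have e4 : b + 2 ≤ Y := Nat.le_self_pow (by omega) _
  -- The powers increase up to `v ^ N` unless `v = 0`, where the initial value `1` can be larger
  -- than the final one; `b + 1` bits cover both cases.
  have hpow : ∀ i ≤ N, (v ^ i).size ≤ b + 1 := by
    intro i hi
    rw [Nat.size_le]
    rcases Nat.eq_zero_or_pos v with h0 | h0
    · rcases Nat.eq_zero_or_pos i with rfl | hi0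
      · simp
      · rw [h0, Nat.zero_pow hi0]; positivity
    · have := Nat.pow_le_pow_right h0 hi
      rw [pow_succ]; omega
  let S : ℕ → State → Prop := fun i υ => υ.mem = τ.mem ∧ Keeps d (t + 1) τ υ ∧
    υ.reg (2 * (t + 1) + 2) = N - i ∧ υ.reg (2 * (t + 2) + 2) = v ^ i
  let τ₁ : State := ⟨Function.update τ.reg (2 * (t + 2) + 2) 1, τ.mem⟩
  have hS0 : S 0 τ₁ := by
    refine ⟨rfl, Keeps.update_temp τ (by omega), ?_, ?_⟩
    · simp only [τ₁]
      rw [Function.update_of_ne (by omega), k5, Nat.sub_zero]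
    · simp [τ₁]
  obtain ⟨υ, u, hu, ⟨m1, m2, m3, m4⟩, hcost⟩ := Exec.loop_of_invariant
    (e := .reg (2 * (t + 1) + 2))
    (p := .seq (.set (2 * (t + 2) + 2) (.mul (.reg (2 * (t + 2) + 2)) (.reg (2 * t + 2))))
          (.set (2 * (t + 1) + 2) (.sub (.reg (2 * (t + 1) + 2)) (.lit 1))))
    S N (2 * b + 2) (fun _ => (b + 2) * (Y + 1) + Y + 7 * b + 20)
    (by
      rintro i hi υ ⟨m1, m2, m3, m4⟩
      have hr' : υ.reg (2 * t + 2) = v := (m2.temp t (by omega)).trans hr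
      have hsz : (N - i).size ≤ b := (size_le_self _).trans (by omega)
      refine ⟨by simp only [Expr.eval]; omega, by simp only [Expr.cost, Expr.eval, m3]; omega,
        _, _, (Exec.set' (v := v ^ (i + 1)) ?_ rfl).seq (Exec.set' (v := N - (i + 1)) ?_ rfl),
        ?_, m1, ?_, ?_, ?_⟩
      · simp only [Expr.eval, hr', m4, pow_succ]
      · simp only [Expr.eval]
        rw [Function.update_of_ne (by omega), m3]
        omega
      · simp only [Expr.cost, Expr.eval]
        rw [Function.update_of_ne (by omega), m3, hr', m4]
        have h6 := hpow i (by omega)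
        have h7 := hpow (i + 1) (by omega)
        have h8 : (N - (i + 1)).size ≤ b := (size_le_self _).trans (by omega)
        have h9 : ((v ^ i).size + 1) * (v.size + 1) ≤ (b + 2) * (Y + 1) :=
          Nat.mul_le_mul (by omega) (by omega)
        have h10 : (1 : ℕ).size = 1 := by simp
        rw [h10]
        linarith only [h6, h7, h8, h9, hsz, e1]
      · exact (m2.trans (Keeps.update_temp υ (by omega))).trans (Keeps.update_temp _ (by omega))
      · simp
      · simp only
        rw [Function.update_of_ne (by omega), Function.update_self])
    (by
      rintro υ ⟨-, -, m3, -⟩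
      simp only [Expr.cost, Expr.eval, m3]
      simp)
    τ₁ hS0
  refine ⟨_, _, h1.seq (k1.seq ((Exec.set' (v := 1) rfl rfl).seq (hu.seq
    (Exec.set' (v := v ^ N) ?_ rfl)))), ?_, m1.trans (k3.trans h3), ?_, ?_⟩
  · simpa only [Expr.eval] using m4
  · have h7 := hpow N le_rfl
    have h10 : (1 : ℕ).size = 1 := by simp
    simp only [Expr.cost, m4, h10]
    rw [Finset.sum_const, Finset.card_range, smul_eq_mul] at hcost
    have h11 : N * (2 * b + 2 + ((b + 2) * (Y + 1) + Y + 7 * b + 20)) ≤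
      Y * (2 * Y + 2 + (Y * (Y + 1) + Y + 7 * Y + 20)) := by gcongr <;> omega
    rw [show (pow e f).weight = 3 * (e.weight + f.weight + 1) + 27 by simp only [weight]; omega]
    refine cubic_le_pow hX le_rfl ?_
    rw [← hY]
    have e6 : Y ≤ Y ^ 3 := Nat.le_self_pow (by omega) _
    have e7 : Y ^ 2 ≤ Y ^ 3 := Nat.pow_le_pow_right (by omega) (by omega)
    have h12 : Y * (2 * Y + 2 + (Y * (Y + 1) + Y + 7 * Y + 20)) = Y ^ 3 + 11 * Y ^ 2 + 22 * Y := by ring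
    clear_value Y
    clear hpow hS0
    norm_num at h7 ⊢
    linarith
  · exact ((h4.trans (k4.mono le_rfl (by omega))).trans (m2.mono le_rfl (by omega))).trans
      (Keeps.update_temp υ le_rfl)
  · simp [eval, hv, hN]

end Exp

theorem Rel.bind {L d : ℕ} {ρ : ℕ → ℕ} {A : ℕ → ℕ → ℕ} {σ : State} (h : Rel L d ρ A σ) {v : ℕ}
    (hv : σ.reg (2 * d + 1) = v) : Rel L (d + 1) (Function.update ρ d v) A σ := by
  refine ⟨h.base, fun x hx => ?_, h.arr⟩
  rcases Nat.lt_succ_iff_lt_or_eq.1 hx with h' | rfl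
  · rw [Function.update_of_ne (by omega), h.var x h']
  · rw [Function.update_self, hv]

namespace Exp

/-- The register of the bound variable is itself the loop counter. The number of iterations stays at
temporary level `t` and the partial sum at `t + 1`, so the summand is evaluated from level `t + 2`
on. All terms are nonnegative, hence a bound for the total bounds the terms and the partial sums. -/
theorem compile_sum {b L d : ℕ} {A : ℕ → ℕ → ℕ} {ρ : ℕ → ℕ} {σ : State} (t : ℕ)
    (e f : Exp) (hσ : Rel L d ρ A σ) (hb : e.eval A ρ ≤ b)
    (hp : ∑ i ∈ Finset.range (e.eval A ρ), f.eval A (Function.update ρ d i) < 2 ^ b)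
    (he : CompileSpec b A d t ρ e σ)
    (hf : ∀ i < e.eval A ρ, ∀ τ, Rel L (d + 1) (Function.update ρ d i) A τ →
      CompileSpec b A (d + 1) (t + 2) (Function.update ρ d i) f τ) :
    CompileSpec b A d t ρ (sum d e f) σ := by
  obtain ⟨τ, c, k1, k2, k3, k4, hr⟩ := he
  have hτ := hσ.keeps k4 k3
  set N := e.eval A ρ with hN
  set g : ℕ → ℕ := fun i => f.eval A (Function.update ρ d i) with hg
  have hX : 2 ≤ b + 2 := by omega
  set Y := (b + 2) ^ (e.weight + f.weight + 1) with hY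
  have e2 : c ≤ Y := le_pow_of_le_of_le hX k2 (by omega)
  have e4 : b + 2 ≤ Y := Nat.le_self_pow (by omega) _
  have hpart : ∀ i ≤ N, (∑ j ∈ Finset.range i, g j).size ≤ b := by
    intro i hi
    rw [Nat.size_le]
    exact lt_of_le_of_lt (Finset.sum_le_sum_of_subset (Finset.range_mono hi)) hp
  have hone : ∀ i < N, (g i).size ≤ b := by
    intro i hi
    rw [Nat.size_le]
    exact lt_of_le_of_lt (Finset.single_le_sum (f := g) (fun _ _ => Nat.zero_le _)
      (Finset.mem_range.2 hi)) hp
  let S : ℕ → State → Prop := fun i υ => υ.mem = τ.mem ∧ Keeps d (t + 1) τ υ ∧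
    υ.reg (2 * d + 1) = i ∧ υ.reg (2 * (t + 1) + 2) = ∑ j ∈ Finset.range i, g j
  let τ₀ : State := ⟨Function.update τ.reg (2 * (t + 1) + 2) 0, τ.mem⟩
  let τ₁ : State := ⟨Function.update τ₀.reg (2 * d + 1) 0, τ.mem⟩
  have hS0 : S 0 τ₁ := by
    refine ⟨rfl, (Keeps.update_temp τ (by omega)).trans (Keeps.update_var τ₀ le_rfl), ?_, ?_⟩
    · simp [τ₁]
    · simp only [τ₁, τ₀]
      rw [Function.update_of_ne (by omega)]
      simp
  obtain ⟨υ, u, hu, ⟨m1, m2, m3, m4⟩, hcost⟩ := Exec.loop_of_invariant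
    (e := .sub (.reg (2 * t + 2)) (.reg (2 * d + 1)))
    (p := .seq (f.compile (t + 2))
          (.seq (.set (2 * (t + 1) + 2) (.add (.reg (2 * (t + 1) + 2)) (.reg (2 * (t + 2) + 2))))
            (.set (2 * d + 1) (.add (.reg (2 * d + 1)) (.lit 1)))))
    S N (5 * b + 5) (fun _ => Y + 9 * b + 20)
    (by
      rintro i hi υ ⟨m1, m2, m3, m4⟩
      have hr' : υ.reg (2 * t + 2) = N := (m2.temp t (by omega)).trans hr
      have hsz : (N - i).size ≤ b := (size_le_self _).trans (by omega)
      have hsN : N.size ≤ b := (size_le_self _).trans (by omega)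
      have hsi : i.size ≤ b := (size_le_self _).trans (by omega)
      obtain ⟨υ', c', n1, n2, n3, n4, n5⟩ := hf i hi υ
        (Rel.bind (hτ.keeps m2 m1) m3)
      have r1 : υ'.reg (2 * d + 1) = i := (n4.var d (by omega)).trans m3
      have r2 : υ'.reg (2 * (t + 1) + 2) = ∑ j ∈ Finset.range i, g j :=
        (n4.temp (t + 1) (by omega)).trans m4
      refine ⟨by simp only [Expr.eval]; omega, by simp only [Expr.cost, Expr.eval, m3, hr']; omega,
        _, _, n1.seq ((Exec.set' (v := ∑ j ∈ Finset.range (i + 1), g j) ?_ rfl).seq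
          (Exec.set' (v := i + 1) ?_ rfl)),
        ?_, n3.trans m1, ?_, ?_, ?_⟩
      · simp only [Expr.eval, r2, n5, Finset.sum_range_succ, hg]
      · simp only [Expr.eval]
        rw [Function.update_of_ne (by omega), r1]
      · simp only [Expr.cost, Expr.eval]
        rw [Function.update_of_ne (by omega), r1, r2, n5]
        have h6 := hpart i (by omega)
        have h7 := hpart (i + 1) (by omega)
        have h8 : (i + 1).size ≤ b := (size_le_self _).trans (by omega)
        have h9 := hone i hi
        have h10 : (1 : ℕ).size = 1 := by simp
        have e3 : c' ≤ Y := le_pow_of_le_of_le hX n2 (by omega)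
        rw [h10]
        simp only [hg] at h9
        omega
      · exact (m2.trans (n4.mono (by omega) (by omega))).trans
          ((Keeps.update_temp υ' (by omega)).trans (Keeps.update_var _ le_rfl))
      · simp
      · simp only
        rw [Function.update_of_ne (by omega), Function.update_self])
    (by
      rintro υ ⟨-, m2, m3, -⟩
      have hr' : υ.reg (2 * t + 2) = N := (m2.temp t (by omega)).trans hr
      have hsN : N.size ≤ b := (size_le_self _).trans (by omega)
      simp only [Expr.cost, Expr.eval, m3, hr']
      have h0 : (N - N).size = 0 := by simp
      refine ⟨Nat.sub_self N, ?_⟩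
      rw [h0]
      omega)
    τ₁ hS0
  refine ⟨_, _, k1.seq ((Exec.set' (v := 0) rfl rfl).seq ((Exec.set' (v := 0) rfl rfl).seq (hu.seq
    (Exec.set' (v := ∑ j ∈ Finset.range N, g j) ?_ rfl)))), ?_, m1.trans k3, ?_, ?_⟩
  · simpa only [Expr.eval] using m4
  · have h7 := hpart N le_rfl
    simp only [Expr.cost, m4, Nat.size_zero]
    rw [Finset.sum_const, Finset.card_range, smul_eq_mul] at hcost
    have h11 : N * (5 * b + 5 + (Y + 9 * b + 20)) ≤
      Y * (5 * Y + 5 + (Y + 9 * Y + 20)) := by gcongr <;> omega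
    rw [show (sum d e f).weight = 2 * (e.weight + f.weight + 1) + 28 by simp only [weight]; omega]
    refine quadratic_le_pow hX le_rfl ?_
    rw [← hY]
    have e6 : Y ≤ Y ^ 2 := Nat.le_self_pow (by omega) _
    have h12 : Y * (5 * Y + 5 + (Y + 9 * Y + 20)) = 15 * Y ^ 2 + 25 * Y := by ring
    clear_value Y
    clear hpart hone hS0
    norm_num at h7 ⊢
    linarith
  · exact (k4.trans (m2.mono le_rfl (by omega))).trans (Keeps.update_temp υ le_rfl)
  · simp [eval, hN, hg]

theorem compile_spec {b L : ℕ} {A : ℕ → ℕ → ℕ} (hA : ∀ a i, A a i < 2 ^ b) (hL : L < 2 ^ b) :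
    ∀ (e : Exp) (d t : ℕ) (ρ : ℕ → ℕ) (σ : State), e.wf d = true → (∀ x < d, ρ x < 2 ^ b) →
      e.Safe b A ρ → Rel L d ρ A σ → CompileSpec b A d t ρ e σ
  | lit v, d, t, ρ, σ, _, _, _, _ => compile_lit b A v d t ρ σ
  | var x, d, t, ρ, σ, hw, hρ, _, hσ => compile_var x t (by simpa [wf] using hw) hρ hσ
  | arr a e, d, t, ρ, σ, hw, hρ, hs, hσ => by
      simp only [wf, Bool.and_eq_true, decide_eq_true_eq] at hw
      exact compile_arr hA hL a t e hw.1 hσ (size_eval_le hA e d ρ hw.2 hρ hs)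
        (compile_spec hA hL e d t ρ σ hw.2 hρ hs hσ)
  | op o e f, d, t, ρ, σ, hw, hρ, hs, hσ => by
      simp only [wf, Bool.and_eq_true] at hw
      exact compile_op o t e f hσ (size_eval_le hA e d ρ hw.1 hρ hs.1)
        (size_eval_le hA f d ρ hw.2 hρ hs.2) (compile_spec hA hL e d t ρ σ hw.1 hρ hs.1 hσ)
        fun τ hτ => compile_spec hA hL f d (t + 1) ρ τ hw.2 hρ hs.2 hτ
  | pow e f, d, t, ρ, σ, hw, hρ, hs, hσ => by
      simp only [wf, Bool.and_eq_true] at hw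
      exact compile_pow t e f hσ (size_eval_le hA e d ρ hw.1 hρ hs.1) hs.2.2.1 hs.2.2.2
        (compile_spec hA hL e d t ρ σ hw.1 hρ hs.1 hσ)
        fun τ hτ => compile_spec hA hL f d (t + 1) ρ τ hw.2 hρ hs.2.1 hτ
  | sum x e f, d, t, ρ, σ, hw, hρ, hs, hσ => by
      simp only [wf, Bool.and_eq_true, decide_eq_true_eq] at hw
      obtain ⟨⟨rfl, hwe⟩, hwf⟩ := hw
      obtain ⟨hs1, hs2, hs3, hs4⟩ := hs
      refine compile_sum t e f hσ hs2 hs4 (compile_spec hA hL e x t ρ σ hwe hρ hs1 hσ)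
        fun i hi τ hτ => compile_spec hA hL f (x + 1) (t + 2) _ τ hwf ?_ (hs3 i hi) hτ
      -- The new variable is less than the number of iterations, hence less than `b`, and so it has
      -- few enough bits.
      intro y hy
      rcases Nat.lt_succ_iff_lt_or_eq.1 hy with h' | rfl
      · rw [Function.update_of_ne (by omega)]; exact hρ y h'
      · rw [Function.update_self]
        exact (hi.le.trans hs2).trans_lt Nat.lt_two_pow_self

end Exp
end RAM

/-! ### Commands -/

namespace RAM

/-- Commands: assignments to array cells, bindings of variables, and loops `x < N`. -/
inductive Cmd where
  | skip
  | put (a : ℕ) (i e : Exp)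
  | seq (p q : Cmd)
  | ite (e : Exp) (p q : Cmd)
  | letc (x : ℕ) (e : Exp) (p : Cmd)
  | loop (x : ℕ) (N : Exp) (p : Cmd)

/-- `Run b p ρ A A' n`: with variables `ρ` and arrays `A`, the command `p` ends with the arrays `A'`
after `n` steps, and the values stored or bound in between are less than `2 ^ b`. -/
inductive Run (b : ℕ) : Cmd → (ℕ → ℕ) → (ℕ → ℕ → ℕ) → (ℕ → ℕ → ℕ) → ℕ → Prop
  | skip (ρ : ℕ → ℕ) (A : ℕ → ℕ → ℕ) : Run b .skip ρ A A 1
  | put {ρ : ℕ → ℕ} {A : ℕ → ℕ → ℕ} (a : ℕ) {i e : Exp} : i.Safe b A ρ → e.Safe b A ρ →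
      e.eval A ρ < 2 ^ b →
      Run b (.put a i e) ρ A
        (Function.update A a (Function.update (A a) (i.eval A ρ) (e.eval A ρ))) 1
  | seq {p q : Cmd} {ρ : ℕ → ℕ} {A A' A'' : ℕ → ℕ → ℕ} {m n : ℕ} :
      Run b p ρ A A' m → Run b q ρ A' A'' n → Run b (.seq p q) ρ A A'' (m + n)
  | ite_true {e : Exp} {p q : Cmd} {ρ : ℕ → ℕ} {A A' : ℕ → ℕ → ℕ} {n : ℕ} : e.Safe b A ρ →
      e.eval A ρ ≠ 0 → Run b p ρ A A' n → Run b (.ite e p q) ρ A A' (n + 1)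
  | ite_false {e : Exp} {p q : Cmd} {ρ : ℕ → ℕ} {A A' : ℕ → ℕ → ℕ} {n : ℕ} : e.Safe b A ρ →
      e.eval A ρ = 0 → Run b q ρ A A' n → Run b (.ite e p q) ρ A A' (n + 1)
  | letc {x : ℕ} {e : Exp} {p : Cmd} {ρ : ℕ → ℕ} {A A' : ℕ → ℕ → ℕ} {n : ℕ} : e.Safe b A ρ →
      e.eval A ρ < 2 ^ b → Run b p (Function.update ρ x (e.eval A ρ)) A A' n →
      Run b (.letc x e p) ρ A A' (n + 1)
  | loop {x : ℕ} {N : Exp} {p : Cmd} {ρ : ℕ → ℕ} (M : ℕ) (f : ℕ → ℕ → ℕ → ℕ) (g : ℕ → ℕ) :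
      N.Safe b (f 0) ρ → N.eval (f 0) ρ = M → M < 2 ^ b →
      (∀ i < M, Run b p (Function.update ρ x i) (f i) (f (i + 1)) (g i)) →
      Run b (.loop x N p) ρ (f 0) (f M) (∑ i ∈ Finset.range M, (g i + 1) + 1)

namespace Cmd

def wf : ℕ → Cmd → Bool
  | _, skip => true
  | d, put a i e => decide (a < 16) && i.wf d && e.wf d
  | d, seq p q => p.wf d && q.wf d
  | d, ite e p q => e.wf d && p.wf d && q.wf d
  | d, letc x e p => decide (x = d) && e.wf d && p.wf (d + 1)
  | d, loop x N p => decide (x = d) && N.wf d && p.wf (d + 1)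

/-- Exponent of the cost of a single step. -/
def weight : Cmd → ℕ
  | skip => 1
  | put _ i e => 2 * (i.weight + e.weight) + 20
  | seq p q => p.weight + q.weight
  | ite e p q => 2 * (e.weight + p.weight + q.weight) + 10
  | letc _ e p => 2 * (e.weight + p.weight) + 10
  | loop _ N p => 2 * (N.weight + p.weight) + 10

def compile : Cmd → ℕ → Prog
  | skip, _ => .skip
  | put a i e, t => .seq (i.compile t) (.seq (e.compile (t + 1))
      (.store (.add (.reg 0) (.add (.mul (.lit 16) (.reg (2 * t + 2))) (.lit a)))
        (.reg (2 * (t + 1) + 2))))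
  | seq p q, t => .seq (p.compile t) (q.compile t)
  | ite e p q, t => .seq (e.compile t) (.ite (.reg (2 * t + 2)) (p.compile t) (q.compile t))
  | letc x e p, t => .seq (e.compile t) (.seq (.set (2 * x + 1) (.reg (2 * t + 2))) (p.compile t))
  | loop x N p, t => .seq (N.compile t) (.seq (.set (2 * x + 1) (.lit 0))
      (.loop (.sub (.reg (2 * t + 2)) (.reg (2 * x + 1)))
        (.seq (p.compile (t + 1)) (.set (2 * x + 1) (.add (.reg (2 * x + 1)) (.lit 1))))))

/-- The arrays that the command may change. -/
def writes : Cmd → List ℕ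
  | skip => []
  | put a _ _ => [a]
  | seq p q => p.writes ++ q.writes
  | ite _ p q => p.writes ++ q.writes
  | letc _ _ p => p.writes
  | loop _ _ p => p.writes

end Cmd

/-- Thanks to this syntactic criterion, loop invariants need not mention the arrays that a loop does
not touch. -/
theorem Run.frame {b : ℕ} {p : Cmd} {ρ : ℕ → ℕ} {A A' : ℕ → ℕ → ℕ} {n : ℕ}
    (h : Run b p ρ A A' n) : ∀ a ∉ p.writes, A' a = A a := by
  induction h with
  | skip => intro a _; rfl
  | put a =>
    intro c hc
    rw [Function.update_of_ne (by simpa [Cmd.writes] using hc)]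
  | seq _ _ ih1 ih2 =>
    intro a ha
    simp only [Cmd.writes, List.mem_append, not_or] at ha
    rw [ih2 a ha.2, ih1 a ha.1]
  | ite_true _ _ _ ih =>
    intro a ha
    simp only [Cmd.writes, List.mem_append, not_or] at ha
    exact ih a ha.1
  | ite_false _ _ _ ih =>
    intro a ha
    simp only [Cmd.writes, List.mem_append, not_or] at ha
    exact ih a ha.2
  | letc _ _ _ ih => exact ih
  | loop M f g _ _ _ _ ih =>
    intro a ha
    suffices h : ∀ i ≤ M, f i a = f 0 a from h M le_rfl
    intro i
    induction i with
    | zero => intro _; rfl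
    | succ i IH => intro hi; rw [ih i (by omega) a ha, IH (by omega)]

/-- Only `put` changes an array, and `Run.put` bounds the value that it stores. This carries the
size hypothesis for array cells from one command to the next. -/
theorem Run.lt_two_pow {b : ℕ} {p : Cmd} {ρ : ℕ → ℕ} {A A' : ℕ → ℕ → ℕ} {n : ℕ}
    (h : Run b p ρ A A' n) : (∀ a i, A a i < 2 ^ b) → ∀ a i, A' a i < 2 ^ b := by
  induction h with
  | skip => exact id
  | put a _ _ hv =>
    intro hA c j
    rcases eq_or_ne c a with rfl | hc
    · rw [Function.update_self, Function.update_apply]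
      split_ifs
      · exact hv
      · exact hA _ _
    · rw [Function.update_of_ne hc]; exact hA _ _
  | seq _ _ ih1 ih2 => exact fun h => ih2 (ih1 h)
  | ite_true _ _ _ ih => exact ih
  | ite_false _ _ _ ih => exact ih
  | letc _ _ _ ih => exact ih
  | loop M f g _ _ _ _ ih =>
    intro hA
    suffices h : ∀ i ≤ M, ∀ a j, f i a j < 2 ^ b from h M le_rfl
    intro i
    induction i with
    | zero => intro _; exact hA
    | succ i IH => intro hi; exact ih i (by omega) (IH (by omega))

/-- Since `a < 16`, the address `L + 16 i + a` determines both `i` and `a`, so a store affects one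
cell of one array only. -/
theorem Rel.put {L d : ℕ} {ρ : ℕ → ℕ} {A : ℕ → ℕ → ℕ} {σ : State} (h : Rel L d ρ A σ) {a i v : ℕ}
    (ha : a < 16) : Rel L d ρ (Function.update A a (Function.update (A a) i v))
      ⟨σ.reg, Function.update σ.mem (L + (16 * i + a)) v⟩ := by
  refine ⟨h.base, h.var, fun c hc j => ?_⟩
  simp only
  rcases eq_or_ne c a with rfl | hca
  · rcases eq_or_ne j i with rfl | hji
    · simp
    · rw [Function.update_of_ne (by omega), Function.update_self, Function.update_of_ne hji,
        h.arr c ha]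
  · rw [Function.update_of_ne (by omega), Function.update_of_ne hca, h.arr c hc]

theorem lt_two_pow_update {b d v : ℕ} {ρ : ℕ → ℕ} (h : ∀ x < d, ρ x < 2 ^ b) (hv : v < 2 ^ b) :
    ∀ x < d + 1, Function.update ρ d v x < 2 ^ b := by
  intro y hy
  rcases Nat.lt_succ_iff_lt_or_eq.1 hy with h' | rfl
  · rw [Function.update_of_ne (by omega)]; exact h y h'
  · rwa [Function.update_self]

theorem Rel.of_bind {L d v : ℕ} {ρ : ℕ → ℕ} {A : ℕ → ℕ → ℕ} {σ : State}
    (h : Rel L (d + 1) (Function.update ρ d v) A σ) : Rel L d ρ A σ :=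
  ⟨h.base, fun x hx => by rw [h.var x (by omega), Function.update_of_ne (by omega)], h.arr⟩

/-- Compiled commands simulate `Run`, at a cost that is a power of `b + 2` for each step. -/
theorem Run.compile_spec {b L : ℕ} (hL : L < 2 ^ b) {p : Cmd} {ρ : ℕ → ℕ} {A A' : ℕ → ℕ → ℕ}
    {n : ℕ} (h : Run b p ρ A A' n) :
    ∀ (d t : ℕ) (σ : State), p.wf d = true → (∀ x < d, ρ x < 2 ^ b) → (∀ a i, A a i < 2 ^ b) →
      Rel L d ρ A σ → ∃ σ' c, Exec (p.compile t) σ σ' c ∧ c ≤ n * (b + 2) ^ p.weight ∧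
        Keeps d t σ σ' ∧ Rel L d ρ A' σ' := by
  have hX : 2 ≤ b + 2 := by omega
  induction h with
  | skip ρ A =>
    intro d t σ _ _ _ hσ
    exact ⟨σ, 1, Exec.skip σ, by simp [Cmd.weight], Keeps.refl _ _ _, hσ⟩
  | @put ρ A a i e hsi hse hv =>
    intro d t σ hw hρ hA hσ
    simp only [Cmd.wf, Bool.and_eq_true, decide_eq_true_eq] at hw
    obtain ⟨τ, c, k1, k2, k3, k4, k5⟩ := i.compile_spec hA hL d t ρ σ hw.1.2 hρ hsi hσ
    have hτ := hσ.keeps k4 k3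
    obtain ⟨υ, c', l1, l2, l3, l4, l5⟩ := e.compile_spec hA hL d (t + 1) ρ τ hw.2 hρ hse hτ
    have hυ := hτ.keeps l4 l3
    have hr := (l4.temp t (by omega)).trans k5
    have hst := Exec.store υ (.add (.reg 0) (.add (.mul (.lit 16) (.reg (2 * t + 2))) (.lit a)))
      (.reg (2 * (t + 1) + 2))
    simp only [Expr.eval, hυ.base, hr, l5] at hst
    refine ⟨_, _, k1.seq (l1.seq hst), ?_, ?_, hυ.put hw.1.1⟩
    · have h1 := Nat.size_le.2 hL
      have h2 := Nat.size_le.2 hv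
      have h3 : a.size ≤ 4 := Nat.size_le.2 hw.1.1
      have h4 : (16 : ℕ).size ≤ 5 := Nat.size_le.2 (by norm_num)
      have h5 := size_mul_le 16 (i.eval A ρ)
      have h6 := size_add_le (16 * i.eval A ρ) a
      have h7 := size_add_le L (16 * i.eval A ρ + a)
      simp only [Expr.cost, Expr.eval, hυ.base, hr, l5, one_mul]
      rw [show (Cmd.put a i e).weight = 2 * (i.weight + e.weight + 1) + 18 by
        simp only [Cmd.weight]; omega]
      refine quadratic_le_pow hX le_rfl ?_
      set Y := (b + 2) ^ (i.weight + e.weight + 1) with hY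
      have e1 : (i.eval A ρ).size ≤ Y :=
        le_pow_of_le_of_le hX (i.size_eval_le hA d ρ hw.1.2 hρ hsi) (by omega)
      have e2 : c ≤ Y := le_pow_of_le_of_le hX k2 (by omega)
      have e3 : c' ≤ Y := le_pow_of_le_of_le hX l2 (by omega)
      have e4 : b + 2 ≤ Y := Nat.le_self_pow (by omega) _
      have h8 : ((16 : ℕ).size + 1) * ((i.eval A ρ).size + 1) ≤ 6 * (Y + 1) :=
        Nat.mul_le_mul (by omega) (by omega)
      have h9 : Y ≤ Y ^ 2 := Nat.le_self_pow (by omega) _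
      clear_value Y
      norm_num at *
      linarith
    · exact (k4.trans (l4.mono le_rfl (by omega))).trans ⟨rfl, fun _ _ => rfl, fun _ _ => rfl⟩
  | @seq p q ρ A A' A'' m n h1 _ ih1 ih2 =>
    intro d t σ hw hρ hA hσ
    simp only [Cmd.wf, Bool.and_eq_true] at hw
    obtain ⟨τ, c, k1, k2, k3, k4⟩ := ih1 d t σ hw.1 hρ hA hσ
    obtain ⟨υ, c', l1, l2, l3, l4⟩ := ih2 d t τ hw.2 hρ (h1.lt_two_pow hA) k4
    refine ⟨υ, _, k1.seq l1, ?_, k3.trans l3, l4⟩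
    have e1 : (b + 2) ^ p.weight ≤ (b + 2) ^ (Cmd.seq p q).weight :=
      Nat.pow_le_pow_right (by omega) (by simp only [Cmd.weight]; omega)
    have e2 : (b + 2) ^ q.weight ≤ (b + 2) ^ (Cmd.seq p q).weight :=
      Nat.pow_le_pow_right (by omega) (by simp only [Cmd.weight]; omega)
    rw [add_mul]
    exact add_le_add (k2.trans (Nat.mul_le_mul_left _ e1)) (l2.trans (Nat.mul_le_mul_left _ e2))
  | @ite_true e p q ρ A A' n hs he h1 ih =>
    intro d t σ hw hρ hA hσ
    simp only [Cmd.wf, Bool.and_eq_true] at hw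
    obtain ⟨τ, c, k1, k2, k3, k4, k5⟩ := e.compile_spec hA hL d t ρ σ hw.1.1 hρ hs hσ
    have hτ := hσ.keeps k4 k3
    obtain ⟨υ, c', l1, l2, l3, l4⟩ := ih d t τ hw.1.2 hρ hA hτ
    refine ⟨υ, _, k1.seq (Exec.ite_true (by simpa only [Expr.eval, k5] using he) l1), ?_,
      k4.trans l3, l4⟩
    have e0 := e.size_eval_le hA d ρ hw.1.1 hρ hs
    simp only [Expr.cost, Expr.eval, k5]
    have e1 : (b + 2) ^ p.weight ≤ (b + 2) ^ (Cmd.ite e p q).weight :=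
      Nat.pow_le_pow_right (by omega) (by simp only [Cmd.weight]; omega)
    have e2 : c + ((e.eval A ρ).size + 1 + (e.eval A ρ).size + 1) ≤
        (b + 2) ^ (Cmd.ite e p q).weight := by
      rw [show (Cmd.ite e p q).weight = 2 * (e.weight + p.weight + q.weight) + 10 from rfl]
      refine quadratic_le_pow hX (v := e.weight + p.weight + q.weight)
        (Y := (b + 2) ^ e.weight) (Nat.pow_le_pow_right (by omega) (by omega)) ?_
      have e3 : 1 ≤ (b + 2) ^ e.weight := Nat.one_le_pow _ _ (by omega)
      nlinarith
    have e4 := l2.trans (Nat.mul_le_mul_left _ e1)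
    rw [add_mul, one_mul]
    omega
  | @ite_false e p q ρ A A' n hs he h1 ih =>
    intro d t σ hw hρ hA hσ
    simp only [Cmd.wf, Bool.and_eq_true] at hw
    obtain ⟨τ, c, k1, k2, k3, k4, k5⟩ := e.compile_spec hA hL d t ρ σ hw.1.1 hρ hs hσ
    have hτ := hσ.keeps k4 k3
    obtain ⟨υ, c', l1, l2, l3, l4⟩ := ih d t τ hw.2 hρ hA hτ
    refine ⟨υ, _, k1.seq (Exec.ite_false (by simpa only [Expr.eval, k5] using he) l1), ?_,
      k4.trans l3, l4⟩
    have e0 := e.size_eval_le hA d ρ hw.1.1 hρ hs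
    simp only [Expr.cost, Expr.eval, k5]
    have e1 : (b + 2) ^ q.weight ≤ (b + 2) ^ (Cmd.ite e p q).weight :=
      Nat.pow_le_pow_right (by omega) (by simp only [Cmd.weight]; omega)
    have e2 : c + ((e.eval A ρ).size + 1 + (e.eval A ρ).size + 1) ≤
        (b + 2) ^ (Cmd.ite e p q).weight := by
      rw [show (Cmd.ite e p q).weight = 2 * (e.weight + p.weight + q.weight) + 10 from rfl]
      refine quadratic_le_pow hX (v := e.weight + p.weight + q.weight)
        (Y := (b + 2) ^ e.weight) (Nat.pow_le_pow_right (by omega) (by omega)) ?_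
      have e3 : 1 ≤ (b + 2) ^ e.weight := Nat.one_le_pow _ _ (by omega)
      nlinarith
    have e4 := l2.trans (Nat.mul_le_mul_left _ e1)
    rw [add_mul, one_mul]
    omega
  | @letc x e p ρ A A' n hs hv h1 ih =>
    intro d t σ hw hρ hA hσ
    simp only [Cmd.wf, Bool.and_eq_true, decide_eq_true_eq] at hw
    obtain ⟨⟨rfl, hwe⟩, hwp⟩ := hw
    obtain ⟨τ, c, k1, k2, k3, k4, k5⟩ := e.compile_spec hA hL x t ρ σ hwe hρ hs hσ
    have hτ := hσ.keeps k4 k3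
    have hk := Keeps.update_var (t := t) (v := e.eval A ρ) τ (le_refl x)
    have hτ' := Rel.bind (hτ.keeps hk rfl) (v := e.eval A ρ) (by simp)
    obtain ⟨υ, c', l1, l2, l3, l4⟩ := ih (x + 1) t _ hwp (lt_two_pow_update hρ hv) hA hτ'
    refine ⟨υ, _, k1.seq ((Exec.set' (by simp only [Expr.eval, k5]) rfl).seq l1), ?_,
      (k4.trans hk).trans (l3.mono (by omega) le_rfl), l4.of_bind⟩
    have e0 := e.size_eval_le hA x ρ hwe hρ hs
    simp only [Expr.cost, k5]
    have e1 : (b + 2) ^ p.weight ≤ (b + 2) ^ (Cmd.letc x e p).weight :=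
      Nat.pow_le_pow_right (by omega) (by simp only [Cmd.weight]; omega)
    have e2 : c + ((e.eval A ρ).size + 1 + (e.eval A ρ).size + 1) ≤
        (b + 2) ^ (Cmd.letc x e p).weight := by
      rw [show (Cmd.letc x e p).weight = 2 * (e.weight + p.weight) + 10 from rfl]
      refine quadratic_le_pow hX (v := e.weight + p.weight)
        (Y := (b + 2) ^ e.weight) (Nat.pow_le_pow_right (by omega) (by omega)) ?_
      have e3 : 1 ≤ (b + 2) ^ e.weight := Nat.one_le_pow _ _ (by omega)
      nlinarith
    have e4 := l2.trans (Nat.mul_le_mul_left _ e1)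
    rw [add_mul, one_mul]
    omega
  | @loop x N p ρ M f g hs hN hM hrun ih =>
    intro d t σ hw hρ hA hσ
    simp only [Cmd.wf, Bool.and_eq_true, decide_eq_true_eq] at hw
    obtain ⟨⟨rfl, hwe⟩, hwp⟩ := hw
    obtain ⟨τ, c, k1, k2, k3, k4, k5⟩ := N.compile_spec hA hL x t ρ σ hwe hρ hs hσ
    rw [hN] at k5
    have hτ := hσ.keeps k4 k3
    have hAi : ∀ i ≤ M, ∀ a j, f i a j < 2 ^ b := by
      intro i
      induction i with
      | zero => intro _; exact hA
      | succ i IH => intro hi; exact (hrun i (by omega)).lt_two_pow (IH (by omega))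
    let S : ℕ → State → Prop := fun i υ => Keeps x (t + 1) τ υ ∧
      Rel L (x + 1) (Function.update ρ x i) (f i) υ
    have hk := Keeps.update_var (t := t + 1) (v := 0) τ (le_refl x)
    have hS0 : S 0 ⟨Function.update τ.reg (2 * x + 1) 0, τ.mem⟩ :=
      ⟨hk, Rel.bind (hτ.keeps hk rfl) (by simp)⟩
    have hsM : M.size ≤ b := Nat.size_le.2 hM
    obtain ⟨υ, u, hu, ⟨m1, m2⟩, hcost⟩ := Exec.loop_of_invariant
      (e := .sub (.reg (2 * t + 2)) (.reg (2 * x + 1)))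
      (p := .seq (p.compile (t + 1)) (.set (2 * x + 1) (.add (.reg (2 * x + 1)) (.lit 1))))
      S M (5 * b + 5) (fun i => g i * (b + 2) ^ p.weight + (4 * b + 15))
      (by
        rintro i hi υ ⟨m1, m2⟩
        have hr : υ.reg (2 * t + 2) = M := (m1.temp t (by omega)).trans k5
        have hx : υ.reg (2 * x + 1) = i := by
          rw [m2.var x (by omega), Function.update_self]
        have hsi : i.size ≤ b := Nat.size_le.2 (hi.trans hM)
        have hsi1 : (i + 1).size ≤ b := Nat.size_le.2 (lt_of_le_of_lt hi hM)
        have hsz := size_sub_le M i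
        obtain ⟨υ', c', n1, n2, n3, n4⟩ := ih i hi (x + 1) (t + 1) υ hwp
          (lt_two_pow_update hρ (hi.trans hM)) (hAi i hi.le) m2
        have hx' : υ'.reg (2 * x + 1) = i := (n3.var x (by omega)).trans hx
        have hk' := Keeps.update_var (t := t + 1) (v := i + 1) υ' (le_refl x)
        refine ⟨by simp only [Expr.eval]; omega,
          by simp only [Expr.cost, Expr.eval, hr, hx]; omega,
          _, _, n1.seq (Exec.set' (v := i + 1) (by simp only [Expr.eval, hx']) rfl), ?_,
          (m1.trans (n3.mono (by omega) le_rfl)).trans hk',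
          Rel.bind (n4.of_bind.keeps hk' rfl) (by simp)⟩
        have h10 : (1 : ℕ).size = 1 := by simp
        simp only [Expr.cost, Expr.eval, hx', h10]
        omega)
      (by
        rintro υ ⟨m1, m2⟩
        have hr : υ.reg (2 * t + 2) = M := (m1.temp t (by omega)).trans k5
        have hx : υ.reg (2 * x + 1) = M := by
          rw [m2.var x (by omega), Function.update_self]
        simp only [Expr.cost, Expr.eval, hr, hx]
        have h0 : (M - M).size = 0 := by simp
        refine ⟨Nat.sub_self M, ?_⟩
        rw [h0]
        omega)
      _ hS0
    refine ⟨υ, _, k1.seq ((Exec.set' (v := 0) rfl rfl).seq hu), ?_,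
      k4.trans (m1.mono le_rfl (Nat.le_succ t)), m2.of_bind⟩
    set Z := (b + 2) ^ (Cmd.loop x N p).weight with hZ
    have e1 : (b + 2) ^ p.weight + (9 * b + 20) ≤ Z := by
      rw [hZ, show (Cmd.loop x N p).weight = 2 * (N.weight + p.weight) + 10 from rfl]
      refine le_trans (b := (b + 2) ^ (p.weight + 6)) ?_
        (Nat.pow_le_pow_right (by omega) (by omega))
      have h1 : 1 ≤ (b + 2) ^ p.weight := Nat.one_le_pow _ _ (by omega)
      have h2 : 2 ^ 5 * (b + 2) ≤ (b + 2) ^ 6 := by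
        rw [pow_succ]
        exact Nat.mul_le_mul_right _ (Nat.pow_le_pow_left hX 5)
      rw [pow_add]
      nlinarith
    have e2 : c + (7 + 5 * b) ≤ Z := by
      rw [hZ, show (Cmd.loop x N p).weight = 2 * (N.weight + p.weight) + 10 from rfl]
      refine le_trans (b := (b + 2) ^ (N.weight + 6)) ?_
        (Nat.pow_le_pow_right (by omega) (by omega))
      have h1 : 1 ≤ (b + 2) ^ N.weight := Nat.one_le_pow _ _ (by omega)
      have h2 : 2 ^ 5 * (b + 2) ≤ (b + 2) ^ 6 := by
        rw [pow_succ]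
        exact Nat.mul_le_mul_right _ (Nat.pow_le_pow_left hX 5)
      rw [pow_add]
      nlinarith
    -- The extra step that `Run.loop` counts for each iteration pays for the test and the increment
    -- of the counter.
    have e3 : ∑ i ∈ Finset.range M, (5 * b + 5 + (g i * (b + 2) ^ p.weight + (4 * b + 15))) ≤
        (∑ i ∈ Finset.range M, (g i + 1)) * Z := by
      rw [Finset.sum_mul]
      refine Finset.sum_le_sum fun i _ => ?_
      have e4 : g i * (b + 2) ^ p.weight ≤ g i * Z := Nat.mul_le_mul_left _ (by omega)
      rw [add_mul, one_mul]
      omega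
    simp only [Expr.cost, Nat.size_zero]
    rw [add_mul, one_mul]
    omega

end RAM

/-! ### Rules for commands, and complete programs -/

namespace RAM

/-- With variables `ρ` and arrays `A`, the command `p` ends after at most `n` steps with arrays that
satisfy `Q`. -/
def Triple (b : ℕ) (p : Cmd) (ρ : ℕ → ℕ) (A : ℕ → ℕ → ℕ) (n : ℕ) (Q : (ℕ → ℕ → ℕ) → Prop) : Prop :=
  ∃ A' m, Run b p ρ A A' m ∧ m ≤ n ∧ Q A'

namespace Triple

variable {b n m : ℕ} {p q : Cmd} {ρ : ℕ → ℕ} {A : ℕ → ℕ → ℕ} {Q R : (ℕ → ℕ → ℕ) → Prop}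

theorem mono (h : Triple b p ρ A n Q) (hn : n ≤ m) (hQ : ∀ A', Q A' → R A') :
    Triple b p ρ A m R := by
  obtain ⟨A', k, h1, h2, h3⟩ := h
  exact ⟨A', k, h1, h2.trans hn, hQ A' h3⟩

theorem frame (h : Triple b p ρ A n Q) :
    Triple b p ρ A n fun A' => Q A' ∧ ∀ a ∉ p.writes, A' a = A a := by
  obtain ⟨A', k, h1, h2, h3⟩ := h
  exact ⟨A', k, h1, h2, h3, h1.frame⟩

theorem skip (hQ : Q A) : Triple b .skip ρ A 1 Q := ⟨A, 1, Run.skip ρ A, le_rfl, hQ⟩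

theorem put {a : ℕ} {i e : Exp} {j v : ℕ} (hi : i.Safe b A ρ) (he : e.Safe b A ρ)
    (hj : i.eval A ρ = j) (hv : e.eval A ρ = v) (hb : v < 2 ^ b)
    (hQ : Q (Function.update A a (Function.update (A a) j v))) :
    Triple b (.put a i e) ρ A 1 Q := by
  subst hj hv
  exact ⟨_, 1, Run.put a hi he hb, le_rfl, hQ⟩

theorem seq (h : Triple b p ρ A m fun A' => Triple b q ρ A' n Q) :
    Triple b (.seq p q) ρ A (m + n) Q := by
  obtain ⟨A', k, h1, h2, A'', k', h3, h4, h5⟩ := h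
  exact ⟨A'', _, h1.seq h3, by omega, h5⟩

theorem ite_true {e : Exp} (he : e.Safe b A ρ) (h0 : e.eval A ρ ≠ 0) (h : Triple b p ρ A n Q) :
    Triple b (.ite e p q) ρ A (n + 1) Q := by
  obtain ⟨A', k, h1, h2, h3⟩ := h
  exact ⟨A', _, Run.ite_true he h0 h1, by omega, h3⟩

theorem ite_false {e : Exp} (he : e.Safe b A ρ) (h0 : e.eval A ρ = 0) (h : Triple b q ρ A n Q) :
    Triple b (.ite e p q) ρ A (n + 1) Q := by
  obtain ⟨A', k, h1, h2, h3⟩ := h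
  exact ⟨A', _, Run.ite_false he h0 h1, by omega, h3⟩

theorem letc {x v : ℕ} {e : Exp} (he : e.Safe b A ρ) (hv : e.eval A ρ = v) (hb : v < 2 ^ b)
    (h : Triple b p (Function.update ρ x v) A n Q) : Triple b (.letc x e p) ρ A (n + 1) Q := by
  subst hv
  obtain ⟨A', k, h1, h2, h3⟩ := h
  exact ⟨A', _, Run.letc he hb h1, by omega, h3⟩

/-- `Run.loop` needs the whole sequence of intermediate arrays, while `step` only yields the next
arrays from the present ones. The sequence is therefore extended term by term, and the frame
condition is carried along with the invariant. -/
theorem loop {x M : ℕ} {N : Exp} (c : ℕ → ℕ) (I : ℕ → (ℕ → ℕ → ℕ) → Prop) (hs : N.Safe b A ρ)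
    (hN : N.eval A ρ = M) (hM : M < 2 ^ b) (h0 : I 0 A)
    (step : ∀ i < M, ∀ A', I i A' → (∀ a ∉ p.writes, A' a = A a) →
      Triple b p (Function.update ρ x i) A' (c i) (I (i + 1))) :
    Triple b (.loop x N p) ρ A (∑ i ∈ Finset.range M, (c i + 1) + 1)
      fun A' => I M A' ∧ ∀ a ∉ p.writes, A' a = A a := by
  have key : ∀ K ≤ M, ∃ (f : ℕ → ℕ → ℕ → ℕ) (g : ℕ → ℕ), f 0 = A ∧
      (∀ i < K, Run b p (Function.update ρ x i) (f i) (f (i + 1)) (g i) ∧ g i ≤ c i) ∧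
      I K (f K) ∧ ∀ a ∉ p.writes, f K a = A a := by
    intro K
    induction K with
    | zero => exact fun _ => ⟨fun _ => A, fun _ => 0, rfl, by simp, h0, fun _ _ => rfl⟩
    | succ K ih =>
      intro hK
      obtain ⟨f, g, hf0, hf, hI, hfr⟩ := ih (by omega)
      obtain ⟨A', k, h1, h2, h3⟩ := step K (by omega) (f K) hI hfr
      refine ⟨Function.update f (K + 1) A', Function.update g K k, ?_, ?_, ?_, ?_⟩
      · rw [Function.update_of_ne (by omega), hf0]
      · intro i hi
        rcases Nat.lt_succ_iff_lt_or_eq.1 hi with h | rfl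
        · rw [Function.update_of_ne (by omega), Function.update_of_ne (by omega),
            Function.update_of_ne (by omega)]
          exact hf i h
        · rw [Function.update_of_ne (by omega), Function.update_self, Function.update_self]
          exact ⟨h1, h2⟩
      · rwa [Function.update_self]
      · intro a ha
        rw [Function.update_self, h1.frame a ha, hfr a ha]
  obtain ⟨f, g, hf0, hf, hI, hfr⟩ := key M le_rfl
  subst hf0
  refine ⟨_, _, Run.loop M f g hs hN hM fun i hi => (hf i hi).1, ?_, hI, hfr⟩
  have : ∑ i ∈ Finset.range M, (g i + 1) ≤ ∑ i ∈ Finset.range M, (c i + 1) :=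
    Finset.sum_le_sum fun i hi => Nat.succ_le_succ (hf i (Finset.mem_range.1 hi)).2
  omega

end Triple

/-! ### Transfer of the input and the output; complete machines. -/

/-- Initial arrays: the input stands in array `0`. -/
def inputArrays (w : List ℕ) : ℕ → ℕ → ℕ := fun a i => if a = 0 then w.getD i 0 else 0

/-- Copies the input, of length `E`, to array `0`. -/
def copyInput (E : Expr) : Prog :=
  .seq (.set 0 E) (.loop (.sub (.reg 0) (.reg 1))
    (.seq (.store (.add (.reg 0) (.mul (.lit 16) (.reg 1))) (.load (.reg 1)))
      (.set 1 (.add (.reg 1) (.lit 1)))))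

/-- The base address of the arrays is the length of the input. Hence copying never overwrites a word
that is still to be read, and all the other arrays lie in cells that are zero initially. -/
theorem exec_copyInput {E : Expr} {w : List ℕ} {b c : ℕ} (hE : E.eval (init w) = w.length)
    (hc : E.cost (init w) ≤ c) (hL : w.length < 2 ^ b) (hw : ∀ i, w.getD i 0 < 2 ^ b)
    (ρ : ℕ → ℕ) :
    ∃ τ t, Exec (copyInput E) (init w) τ t ∧ t ≤ c + (w.length + 1) * (60 * (b + 2)) ∧
      Rel w.length 0 ρ (inputArrays w) τ := by
  have hLs := Nat.size_le.2 hL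
  let mem : ℕ → ℕ → ℕ := fun i c => if c < w.length then w.getD c 0 else
    if (c - w.length) % 16 = 0 ∧ (c - w.length) / 16 < i then w.getD ((c - w.length) / 16) 0 else 0
  let S : ℕ → State → Prop := fun i σ => σ.reg 0 = w.length ∧ σ.reg 1 = i ∧ σ.mem = mem i
  have h10 : (1 : ℕ).size = 1 := by simp
  have h16 : (16 : ℕ).size ≤ 5 := Nat.size_le.2 (by norm_num)
  obtain ⟨υ, u, hu, ⟨m1, m2, m3⟩, hcost⟩ := Exec.loop_of_invariant
    (e := .sub (.reg 0) (.reg 1))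
    (p := .seq (.store (.add (.reg 0) (.mul (.lit 16) (.reg 1))) (.load (.reg 1)))
      (.set 1 (.add (.reg 1) (.lit 1))))
    S w.length (5 * b + 5) (fun _ => 25 * (b + 2) + 25)
    (by
      rintro i hi υ ⟨m1, m2, m3⟩
      have hsi : i.size ≤ b := Nat.size_le.2 (hi.trans hL)
      have hsi1 : (i + 1).size ≤ b := Nat.size_le.2 (lt_of_le_of_lt hi hL)
      have hsz := size_sub_le w.length i
      have hm : mem i i = w.getD i 0 := if_pos hi
      refine ⟨by simp only [Expr.eval]; omega,
        by simp only [Expr.cost, Expr.eval, m1, m2]; omega, _, _,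
        (Exec.store _ _ _).seq (Exec.set' (v := i + 1) (by simp only [Expr.eval, m2]) rfl), ?_,
        ?_, ?_, ?_⟩
      · simp only [Expr.cost, Expr.eval, m1, m2, m3, hm, h10]
        have h1 := Nat.size_le.2 (hw i)
        have h2 := size_mul_le 16 i
        have h3 := size_add_le w.length (16 * i)
        have h4 : ((16 : ℕ).size + 1) * (i.size + 1) ≤ 6 * (b + 1) :=
          Nat.mul_le_mul (by omega) (by omega)
        omega
      · simp only
        rw [Function.update_of_ne (by omega), m1]
      · simp
      · funext c
        simp only [Expr.eval, m1, m2, m3, hm]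
        rcases eq_or_ne c (w.length + 16 * i) with rfl | hne
        · rw [Function.update_self]
          simp only [mem]
          rw [if_neg (by omega), if_pos (by omega)]
          congr 1
          omega
        · rw [Function.update_of_ne hne]
          simp only [mem]
          split_ifs <;> first | rfl | omega)
    (by
      rintro υ ⟨m1, m2, m3⟩
      have h0 : (w.length - w.length).size = 0 := by simp
      simp only [Expr.cost, Expr.eval, m1, m2]
      refine ⟨Nat.sub_self _, ?_⟩
      rw [h0]
      omega)
    ⟨Function.update (init w).reg 0 w.length, (init w).mem⟩
    (by
      refine ⟨by simp, by simp [init], ?_⟩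
      funext c
      simp only [init, mem]
      split_ifs with h1 h2
      · rfl
      · omega
      · rw [List.getD_eq_default _ _ (by omega)])
  refine ⟨υ, _, (Exec.set' hE rfl).seq hu, ?_, m1, by simp, ?_⟩
  · rw [Finset.sum_const, Finset.card_range, smul_eq_mul] at hcost
    nlinarith
  · intro a ha i
    rw [m3]
    simp only [mem, inputArrays]
    rw [if_neg (by omega)]
    by_cases h : a = 0
    · subst h
      rw [if_pos rfl]
      split_ifs with h1
      · congr 1; omega
      · rw [List.getD_eq_default _ _ (by omega)]
    · rw [if_neg h, if_neg (by omega)]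

/-- Copies the cells `0, …, k` of array `8` to the memory cells `0, …, k`, where `k` stands in
cell `0` of array `0`. -/
def copyOutput : Prog :=
  .seq (.set 1 (.lit 0)) (.seq (.set 3 (.add (.load (.reg 0)) (.lit 1)))
    (.loop (.sub (.reg 3) (.reg 1))
      (.seq (.store (.reg 1) (.load (.add (.reg 0) (.add (.mul (.lit 16) (.reg 1)) (.lit 8)))))
        (.set 1 (.add (.reg 1) (.lit 1))))))

/-- As `k + 1 ≤ L`, the output lies below the arrays: it overwrites part of the original input, but
no cell that is read later. For the same reason `k` is taken from the copy of the input. -/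
theorem exec_copyOutput {L k b : ℕ} {ρ : ℕ → ℕ} {A : ℕ → ℕ → ℕ} {σ : State}
    (hσ : Rel L 0 ρ A σ) (hk : A 0 0 = k) (hkL : k + 1 ≤ L) (hL : L < 2 ^ b)
    (hA : ∀ a i, A a i < 2 ^ b) :
    ∃ τ t, Exec copyOutput σ τ t ∧ t ≤ (L + 1) * (80 * (b + 2)) ∧ ∀ s ≤ k, τ.mem s = A 8 s := by
  have hLs := Nat.size_le.2 hL
  have hks1 : (k + 1).size ≤ b := Nat.size_le.2 (lt_of_le_of_lt hkL hL)
  have hks : k.size ≤ b := Nat.size_le.2 (lt_of_le_of_lt (by omega) hL)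
  have h10 : (1 : ℕ).size = 1 := by simp
  have h16 : (16 : ℕ).size ≤ 5 := Nat.size_le.2 (by norm_num)
  have h8 : (8 : ℕ).size ≤ 4 := Nat.size_le.2 (by norm_num)
  have hcell : σ.mem L = k := by rw [← hk, ← hσ.arr 0 (by omega) 0]; rfl
  let S : ℕ → State → Prop := fun i υ => υ.reg 0 = L ∧ υ.reg 3 = k + 1 ∧ υ.reg 1 = i ∧
    (∀ s < i, υ.mem s = A 8 s) ∧ ∀ c, L ≤ c → υ.mem c = σ.mem c
  obtain ⟨υ, u, hu, ⟨m1, m2, m3, m4, m5⟩, hcost⟩ := Exec.loop_of_invariant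
    (e := .sub (.reg 3) (.reg 1))
    (p := .seq (.store (.reg 1) (.load (.add (.reg 0) (.add (.mul (.lit 16) (.reg 1)) (.lit 8)))))
        (.set 1 (.add (.reg 1) (.lit 1))))
    S (k + 1) (5 * b + 5) (fun _ => 30 * (b + 2) + 25)
    (by
      rintro i hi υ ⟨m1, m2, m3, m4, m5⟩
      have hsi : i.size ≤ b := Nat.size_le.2 (by omega)
      have hsi1 : (i + 1).size ≤ b := Nat.size_le.2 (by omega)
      have hsz := size_sub_le (k + 1) i
      have hm : υ.mem (L + (16 * i + 8)) = A 8 i := by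
        rw [m5 _ (by omega), hσ.arr 8 (by omega)]
      refine ⟨by simp only [Expr.eval]; omega,
        by simp only [Expr.cost, Expr.eval, m2, m3]; omega, _, _,
        (Exec.store _ _ _).seq (Exec.set' (v := i + 1) (by simp only [Expr.eval, m3]) rfl), ?_,
        ?_, ?_, ?_, ?_, ?_⟩
      · simp only [Expr.cost, Expr.eval, m1, m3, hm, h10]
        have h1 := Nat.size_le.2 (hA 8 i)
        have h2 := size_mul_le 16 i
        have h3 := size_add_le (16 * i) 8
        have h5 := size_add_le L (16 * i + 8)
        have h4 : ((16 : ℕ).size + 1) * (i.size + 1) ≤ 6 * (b + 1) :=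
          Nat.mul_le_mul (by omega) (by omega)
        omega
      · simp only
        rw [Function.update_of_ne (by omega), m1]
      · simp only
        rw [Function.update_of_ne (by omega), m2]
      · simp
      · intro s hs
        simp only [Expr.eval, m1, m3, hm]
        rcases Nat.lt_succ_iff_lt_or_eq.1 hs with h | rfl
        · rw [Function.update_of_ne (by omega), m4 s h]
        · rw [Function.update_self]
      · intro c hc
        simp only [Expr.eval, m3]
        rw [Function.update_of_ne (by omega), m5 c hc])
    (by
      rintro υ ⟨m1, m2, m3, -⟩
      have h0 : (k + 1 - (k + 1)).size = 0 := by simp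
      simp only [Expr.cost, Expr.eval, m2, m3]
      refine ⟨Nat.sub_self _, ?_⟩
      rw [h0]
      omega)
    ⟨Function.update (Function.update σ.reg 1 0) 3 (k + 1), σ.mem⟩
    (by
      refine ⟨?_, by simp, by simp, by simp, fun _ _ => rfl⟩
      simp only
      rw [Function.update_of_ne (by omega), Function.update_of_ne (by omega), hσ.base])
  have hr0 : (Function.update σ.reg 1 0) 0 = L := by
    rw [Function.update_of_ne (by omega), hσ.base]
  refine ⟨υ, _, (Exec.set' (v := 0) rfl rfl).seq ((Exec.set' (v := k + 1) (by
    simp only [Expr.eval, hr0, hcell]) rfl).seq hu), ?_, fun s hs => m4 s (by omega)⟩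
  rw [Finset.sum_const, Finset.card_range, smul_eq_mul] at hcost
  simp only [Expr.cost, Expr.eval, hr0, hcell, h10, Nat.size_zero]
  have : (k + 1) * (5 * b + 5 + (30 * (b + 2) + 25)) ≤ L * (5 * b + 5 + (30 * (b + 2) + 25)) :=
    Nat.mul_le_mul_right _ hkL
  nlinarith

/-- The program that copies the input to array `0`, runs `p`, and copies the output from
array `8`. -/
def machine (E : Expr) (p : Cmd) : Prog := .seq (copyInput E) (.seq (p.compile 0) copyOutput)

/-- Array `0` must not be written by `p`, because the output loop finds `k` there at the end. -/
theorem exec_machine {E : Expr} {p : Cmd} {w : List ℕ} {b c k n : ℕ} {Q : (ℕ → ℕ → ℕ) → Prop}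
    (hp : p.wf 0 = true) (hp0 : 0 ∉ p.writes) (hE : E.eval (init w) = w.length)
    (hc : E.cost (init w) ≤ c) (hL : w.length < 2 ^ b) (hw : ∀ i, w.getD i 0 < 2 ^ b)
    (hk : w.getD 0 0 = k) (hkL : k + 1 ≤ w.length)
    (h : Triple b p (fun _ => 0) (inputArrays w) n Q) :
    ∃ τ t A, Exec (machine E p) (init w) τ t ∧
      t ≤ c + n * (b + 2) ^ p.weight + (w.length + 1) * (140 * (b + 2)) ∧
      Q A ∧ ∀ s ≤ k, τ.mem s = A 8 s := by
  obtain ⟨A, m, hrun, hm, hQ⟩ := h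
  obtain ⟨σ, t, h1, h2, h3⟩ := exec_copyInput hE hc hL hw (fun _ => 0)
  have hA : ∀ a i, inputArrays w a i < 2 ^ b := by
    intro a i
    simp only [inputArrays]
    split_ifs
    · exact hw i
    · positivity
  obtain ⟨τ, u, k1, k2, -, k3⟩ := hrun.compile_spec hL 0 0 σ hp (by simp) hA h3
  have hk' : A 0 0 = k := by rw [hrun.frame 0 hp0, ← hk]; simp [inputArrays]
  obtain ⟨υ, v, l1, l2, l3⟩ := exec_copyOutput k3 hk' hkL hL (hrun.lt_two_pow hA)
  refine ⟨υ, _, A, h1.seq (k1.seq l1), ?_, hQ, l3⟩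
  have := Nat.mul_le_mul_right ((b + 2) ^ p.weight) hm
  have e : (w.length + 1) * (140 * (b + 2)) =
    (w.length + 1) * (60 * (b + 2)) + (w.length + 1) * (80 * (b + 2)) := by ring
  omega

end RAM

/-! ### Digits, masks of sets and codes of plans -/

namespace WSP

open Finset

theorem sum_digits_lt {b K : ℕ} {f : ℕ → ℕ} (hf : ∀ i < K, f i < b) :
    ∑ i ∈ range K, b ^ i * f i < b ^ K := by
  induction K with
  | zero => simp
  | succ K ih =>
    have h1 := ih fun i hi => hf i (by omega)
    have h2 : b ^ K * (f K + 1) ≤ b ^ K * b := Nat.mul_le_mul_left _ (hf K (by omega))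
    rw [sum_range_succ, pow_succ]
    nlinarith

/-- The terms below position `s` add up to less than `b ^ s` and vanish in the quotient; those above
`s` are multiples of `b ^ (s + 1)` and vanish in the remainder. -/
theorem digit_sum {b K s : ℕ} {f : ℕ → ℕ} (hf : ∀ i < K, f i < b) (hs : s < K) :
    (∑ i ∈ range K, b ^ i * f i) / b ^ s % b = f s := by
  obtain ⟨r, rfl⟩ : ∃ r, K = s + (r + 1) := ⟨K - s - 1, by omega⟩
  have hlo := sum_digits_lt (b := b) (K := s) (f := f) fun i hi => hf i (by omega)
  have hsplit : ∑ i ∈ range (s + (r + 1)), b ^ i * f i = ∑ i ∈ range s, b ^ i * f i +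
      b ^ s * (f s + b * ∑ i ∈ range r, b ^ i * f (s + (i + 1))) := by
    rw [sum_range_add, sum_range_succ', mul_add, mul_sum, mul_sum]
    simp only [Nat.add_zero]
    rw [add_comm (b ^ s * f s)]
    congr 2
    refine sum_congr rfl fun i _ => ?_
    ring
  rw [hsplit, Nat.add_mul_div_left _ _ (by omega), Nat.div_eq_of_lt hlo, zero_add,
    Nat.add_mul_mod_self_left, Nat.mod_eq_of_lt (hf s (by omega))]

theorem sum_digits_eq {b K t : ℕ} (ht : t < b ^ K) :
    ∑ i ∈ range K, b ^ i * (t / b ^ i % b) = t := by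
  suffices h : ∀ K, ∑ i ∈ range K, b ^ i * (t / b ^ i % b) = t % b ^ K by
    rw [h, Nat.mod_eq_of_lt ht]
  intro K
  induction K with
  | zero => simp [Nat.mod_one]
  | succ K ih => rw [sum_range_succ, ih, Nat.mod_pow_succ]

/-- The number whose binary digits form the characteristic vector of `X`. -/
def mask (X : Finset ℕ) : ℕ := ∑ s ∈ X, 2 ^ s

theorem mask_eq_sum_range {X : Finset ℕ} {K : ℕ} (hX : X ⊆ range K) :
    mask X = ∑ s ∈ range K, 2 ^ s * (if s ∈ X then 1 else 0) := by
  simp only [mul_ite, mul_one, mul_zero]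
  rw [← sum_filter, filter_mem_eq_inter, inter_eq_right.2 hX, mask]

theorem mask_lt {X : Finset ℕ} {K : ℕ} (hX : X ⊆ range K) : mask X < 2 ^ K := by
  rw [mask_eq_sum_range hX]
  exact sum_digits_lt fun i _ => by split_ifs <;> omega

theorem bit_mask {X : Finset ℕ} (s : ℕ) : mask X / 2 ^ s % 2 = if s ∈ X then 1 else 0 := by
  obtain ⟨K, hK⟩ : ∃ K, insert s X ⊆ range K := ⟨(insert s X).sup id + 1, fun x hx =>
    mem_range.2 (Nat.lt_succ_of_le (le_sup (f := id) hx))⟩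
  rw [mask_eq_sum_range ((subset_insert s X).trans hK)]
  exact digit_sum (f := fun s => if s ∈ X then 1 else 0)
    (fun i _ => by split_ifs <;> omega) (mem_range.1 (hK (mem_insert_self s X)))

theorem mask_injective : Function.Injective mask := by
  intro X Y h
  ext s
  have h1 := bit_mask (X := X) s
  rw [h, bit_mask] at h1
  split_ifs at h1 <;> simp_all

theorem exists_mask_eq {F K : ℕ} (hF : F < 2 ^ K) : ∃ X ⊆ range K, mask X = F := by
  refine ⟨(range K).filter fun s => F / 2 ^ s % 2 = 1, filter_subset _ _, ?_⟩
  rw [mask, sum_filter]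
  refine Eq.trans (sum_congr rfl fun s _ => ?_) (sum_digits_eq hF)
  have := Nat.mod_lt (F / 2 ^ s) (by norm_num : 0 < 2)
  split_ifs with h
  · rw [h, mul_one]
  · rw [show F / 2 ^ s % 2 = 0 by omega, mul_zero]

theorem mask_union {X Y : Finset ℕ} (h : Disjoint X Y) : mask (X ∪ Y) = mask X + mask Y :=
  sum_union h

theorem mask_empty : mask ∅ = 0 := rfl

theorem mask_singleton (s : ℕ) : mask {s} = 2 ^ s := by simp [mask]

theorem mask_eq_zero {X : Finset ℕ} : mask X = 0 ↔ X = ∅ := by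
  rw [← mask_empty, mask_injective.eq_iff]

theorem mask_range (K : ℕ) : mask (range K) = 2 ^ K - 1 := by
  have h : mask (range K) + 1 = 2 ^ K := by
    induction K with
    | zero => rfl
    | succ K ih =>
      have : mask (range (K + 1)) = mask (range K) + 2 ^ K := sum_range_succ _ _
      rw [this, pow_succ]
      omega
  omega

theorem sum_bit_mul_bit {X Y : Finset ℕ} {K : ℕ} (hX : X ⊆ range K) :
    ∑ s ∈ range K, (mask X / 2 ^ s % 2) * (mask Y / 2 ^ s % 2) = (X ∩ Y).card := by
  simp only [bit_mask, mul_ite, mul_one, mul_zero]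
  have : ∀ s, (if s ∈ Y then (if s ∈ X then 1 else 0) else 0) = if s ∈ X ∩ Y then 1 else 0 := by
    intro s
    simp only [mem_inter]
    split_ifs <;> simp_all
  simp only [this]
  rw [← card_filter, filter_mem_eq_inter, inter_eq_right.2 (inter_subset_left.trans hX)]

/-- The plan `π` on `X`, in base `n`. -/
def code (n : ℕ) (X : Finset ℕ) (π : ℕ → ℕ) : ℕ := ∑ s ∈ X, n ^ s * π s

theorem code_lt {n K : ℕ} {X : Finset ℕ} {π : ℕ → ℕ} (hn : 0 < n) (hX : X ⊆ range K)
    (hπ : ∀ s ∈ X, π s < n) : code n X π < n ^ K := by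
  have : code n X π = ∑ s ∈ range K, n ^ s * (if s ∈ X then π s else 0) := by
    simp only [mul_ite, mul_zero]
    rw [← sum_filter, filter_mem_eq_inter, inter_eq_right.2 hX, code]
  rw [this]
  exact sum_digits_lt fun i _ => by split_ifs with h; exacts [hπ i h, hn]

/-! ### Partial plans, level by level -/

/-- Users `u < n` with block numbers `blk i u` at the levels `i`, steps `s < K` with authorizations
`au s u`, and conditions `j < m`: condition `j` concerns level `lv j`, where `ok j X` says that the
set of all steps assigned to the users of one block may be `X`. -/
structure Layered where
  n : ℕ
  K : ℕ
  m : ℕ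
  au : ℕ → ℕ → Prop
  blk : ℕ → ℕ → ℕ
  lv : ℕ → ℕ
  ok : ℕ → Finset ℕ → Prop

namespace Layered

variable (I : Layered)

/-- `π` assigns the steps in `X` to users in `Y`, and in each block of a level below `i` the
conditions of that level hold. -/
def Good (i : ℕ) (Y X : Finset ℕ) (π : ℕ → ℕ) : Prop :=
  (∀ s ∈ X, π s ∈ Y ∧ I.au s (π s)) ∧ ∀ j < I.m, I.lv j < i → ∀ u ∈ Y,
    I.ok j (X.filter fun s => I.blk (I.lv j) (π s) = I.blk (I.lv j) u)

/-- The row `R` of a table tells for each set of steps whether there is a good plan, and contains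
such a plan. -/
def Represents (i : ℕ) (Y : Finset ℕ) (R : ℕ → ℕ) : Prop :=
  ∀ X ⊆ range I.K,
    (R (mask X) ≠ 0 → ∃ π, I.Good i Y X π ∧ R (mask X) = code I.n X π + 1) ∧
    ((∃ π, I.Good i Y X π) → R (mask X) ≠ 0)

variable {I} {i : ℕ} {Y Y₁ Y₂ : Finset ℕ} {R R₁ R₂ : ℕ → ℕ}

theorem Represents.congr (h : I.Represents i Y R₁)
    (h' : ∀ X ⊆ range I.K, R₂ (mask X) = R₁ (mask X)) : I.Represents i Y R₂ := by
  intro X hX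
  rw [h' X hX]
  exact h X hX

theorem Represents.le (h : I.Represents i Y R) (hn : 0 < I.n) (hY : Y ⊆ range I.n)
    {X : Finset ℕ} (hX : X ⊆ range I.K) : R (mask X) ≤ I.n ^ I.K := by
  by_cases h0 : R (mask X) = 0
  · omega
  · obtain ⟨π, hπ, he⟩ := (h X hX).1 h0
    rw [he]
    exact code_lt hn hX fun s hs => mem_range.1 (hY (hπ.1 s hs).1)

/-- No condition belongs to a level below `0`, so that only authorizations matter, and on `X` the
plan has to be constant. -/
theorem represents_singleton {u : ℕ} (h₀ : ∀ X ⊆ range I.K, R (mask X) ≠ 0 → ∀ s ∈ X, I.au s u)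
    (h₁ : ∀ X ⊆ range I.K, (∀ s ∈ X, I.au s u) → R (mask X) = code I.n X (fun _ => u) + 1) :
    I.Represents 0 {u} R := by
  intro X hX
  refine ⟨fun h => ⟨fun _ => u, ⟨fun s hs => ⟨mem_singleton_self u, h₀ X hX h s hs⟩, ?_⟩,
    h₁ X hX (h₀ X hX h)⟩, ?_⟩
  · intro j _ hj
    omega
  · rintro ⟨π, hπ, -⟩
    rw [h₁ X hX fun s hs => by
      have := hπ s hs
      rw [mem_singleton] at this
      rw [← this.1]
      exact this.2]
    omega

/-- Without users only the empty set can be assigned. Its code is `0`, hence the entry `1`. This row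
is neutral for merging. -/
theorem represents_empty (h : ∀ X ⊆ range I.K, R (mask X) = if X = ∅ then 1 else 0) :
    I.Represents i ∅ R := by
  intro X hX
  rw [h X hX]
  refine ⟨fun h0 => ?_, ?_⟩
  · have hX0 : X = ∅ := by by_contra hne; simp [hne] at h0
    subst hX0
    exact ⟨fun _ => 0, ⟨by simp, by simp⟩, by simp [code]⟩
  · rintro ⟨π, hπ, -⟩
    have hX0 : X = ∅ := eq_empty_of_forall_notMem fun s hs => by simpa using (hπ s hs).1
    simp [hX0]

/-- A block below level `i` that meets `Y₁` does not meet `Y₂`. The restriction therefore does not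
change the set of steps assigned to such a block, and the conditions are inherited. -/
theorem Good.inter {X : Finset ℕ} {π : ℕ → ℕ} (h : I.Good i (Y₁ ∪ Y₂) X π)
    (sep : ∀ u ∈ Y₁, ∀ v ∈ Y₂, ∀ i' < i, I.blk i' u ≠ I.blk i' v) :
    I.Good i Y₁ (X.filter fun s => π s ∈ Y₁) π := by
  refine ⟨fun s hs => ⟨(mem_filter.1 hs).2, (h.1 s (mem_filter.1 hs).1).2⟩, ?_⟩
  intro j hj hji u hu
  have h1 := h.2 j hj hji u (mem_union_left _ hu)
  convert h1 using 1
  ext s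
  simp only [mem_filter]
  refine ⟨fun hs => ⟨hs.1.1, hs.2⟩, fun hs => ⟨⟨hs.1, ?_⟩, hs.2⟩⟩
  rcases mem_union.1 (h.1 s hs.1).1 with h' | h'
  · exact h'
  · exact absurd hs.2.symm (sep u hu _ h' _ hji)

/-- Rows for sets of users that share no blocks are merged by combining disjoint sets of steps. -/
theorem Represents.merge (h₁ : I.Represents i Y₁ R₁) (h₂ : I.Represents i Y₂ R₂)
    (disj : Disjoint Y₁ Y₂) (sep : ∀ u ∈ Y₁, ∀ v ∈ Y₂, ∀ i' < i, I.blk i' u ≠ I.blk i' v)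
    (hR : ∀ X ⊆ range I.K, R (mask X) ≠ 0 → ∃ X₁ X₂, Disjoint X₁ X₂ ∧ X₁ ∪ X₂ = X ∧
      R₁ (mask X₁) ≠ 0 ∧ R₂ (mask X₂) ≠ 0 ∧ R (mask X) = R₁ (mask X₁) + R₂ (mask X₂) - 1)
    (hR' : ∀ X₁ ⊆ range I.K, ∀ X₂ ⊆ range I.K, Disjoint X₁ X₂ → R₁ (mask X₁) ≠ 0 →
      R₂ (mask X₂) ≠ 0 → R (mask (X₁ ∪ X₂)) ≠ 0) :
    I.Represents i (Y₁ ∪ Y₂) R := by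
  intro X hX
  constructor
  · intro h0
    obtain ⟨X₁, X₂, hd, rfl, n1, n2, he⟩ := hR X hX h0
    obtain ⟨π₁, g₁, e₁⟩ := (h₁ X₁ (subset_union_left.trans hX)).1 n1
    obtain ⟨π₂, g₂, e₂⟩ := (h₂ X₂ (subset_union_right.trans hX)).1 n2
    have p1 : ∀ s ∈ X₁, (if s ∈ X₁ then π₁ s else π₂ s) = π₁ s := fun s hs => if_pos hs
    have p2 : ∀ s ∈ X₂, (if s ∈ X₁ then π₁ s else π₂ s) = π₂ s := fun s hs =>
      if_neg (disjoint_right.1 hd hs)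
    refine ⟨fun s => if s ∈ X₁ then π₁ s else π₂ s, ⟨?_, ?_⟩, ?_⟩
    · intro s hs
      rcases mem_union.1 hs with h | h
      · simp only [p1 s h]
        exact ⟨mem_union_left _ (g₁.1 s h).1, (g₁.1 s h).2⟩
      · simp only [p2 s h]
        exact ⟨mem_union_right _ (g₂.1 s h).1, (g₂.1 s h).2⟩
    · intro j hj hji u hu
      rcases mem_union.1 hu with h | h
      · convert g₁.2 j hj hji u h using 1
        ext s
        simp only [mem_filter, mem_union]
        constructor
        · rintro ⟨hs | hs, hb⟩
          · rw [p1 s hs] at hb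
            exact ⟨hs, hb⟩
          · rw [p2 s hs] at hb
            exact absurd hb.symm (sep u h _ (g₂.1 s hs).1 _ hji)
        · rintro ⟨hs, hb⟩
          exact ⟨Or.inl hs, by rw [p1 s hs]; exact hb⟩
      · convert g₂.2 j hj hji u h using 1
        ext s
        simp only [mem_filter, mem_union]
        constructor
        · rintro ⟨hs | hs, hb⟩
          · rw [p1 s hs] at hb
            exact absurd hb (sep _ (g₁.1 s hs).1 u h _ hji)
          · rw [p2 s hs] at hb
            exact ⟨hs, hb⟩
        · rintro ⟨hs, hb⟩
          exact ⟨Or.inr hs, by rw [p2 s hs]; exact hb⟩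
    -- Codes are additive over disjoint sets. Each of the two entries exceeds its code by one, and
    -- `- 1` leaves the one that is wanted.
    · rw [he, e₁, e₂]
      have : code I.n (X₁ ∪ X₂) (fun s => if s ∈ X₁ then π₁ s else π₂ s) =
          code I.n X₁ π₁ + code I.n X₂ π₂ := by
        rw [code, sum_union hd]
        congr 1
        · exact sum_congr rfl fun s hs => by rw [p1 s hs]
        · exact sum_congr rfl fun s hs => by rw [p2 s hs]
      omega
  · rintro ⟨π, hπ⟩
    -- A plan on the union determines the splitting: the steps are sorted according to the part in
    -- which their users lie.
    have hX' : X.filter (fun s => π s ∈ Y₁) ∪ X.filter (fun s => π s ∈ Y₂) = X := by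
      rw [← filter_or, filter_eq_self]
      exact fun s hs => mem_union.1 (hπ.1 s hs).1
    have hd : Disjoint (X.filter fun s => π s ∈ Y₁) (X.filter fun s => π s ∈ Y₂) :=
      disjoint_filter.2 fun s _ h => disjoint_left.1 disj h
    have s1 := (filter_subset (fun s => π s ∈ Y₁) X).trans hX
    have s2 := (filter_subset (fun s => π s ∈ Y₂) X).trans hX
    rw [← hX']
    refine hR' _ s1 _ s2 hd ((h₁ _ s1).2 ⟨π, hπ.inter sep⟩) ((h₂ _ s2).2 ⟨π, ?_⟩)
    rw [union_comm] at hπ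
    exact hπ.inter fun u hu v hv i' hi' h => sep v hv u hu i' hi' h.symm

/-- The conditions of a level are checked on the rows for the blocks of that level. -/
theorem Represents.check (h : I.Represents i Y R₁) (hY : Y.Nonempty)
    (hb : ∀ u ∈ Y, ∀ v ∈ Y, I.blk i u = I.blk i v)
    (hR : ∀ X ⊆ range I.K, (∀ j < I.m, I.lv j = i → I.ok j X) → R (mask X) = R₁ (mask X))
    (hR' : ∀ X ⊆ range I.K, ∀ j < I.m, I.lv j = i → ¬ I.ok j X → R (mask X) = 0) :
    I.Represents (i + 1) Y R := by
  -- All users in `Y` belong to one block of level `i`, so a condition of this level sees the whole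
  -- set `X`, whatever the plan is.
  have key : ∀ (X : Finset ℕ) (π : ℕ → ℕ), (∀ s ∈ X, π s ∈ Y ∧ I.au s (π s)) → ∀ j, I.lv j = i → ∀ u ∈ Y,
      (X.filter fun s => I.blk (I.lv j) (π s) = I.blk (I.lv j) u) = X := by
    intro X π hπ j hj u hu
    rw [filter_eq_self, hj]
    exact fun s hs => hb _ (hπ s hs).1 u hu
  intro X hX
  constructor
  · intro h0
    have hall : ∀ j < I.m, I.lv j = i → I.ok j X := by
      intro j hj hji
      by_contra hne
      exact h0 (hR' X hX j hj hji hne)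
    rw [hR X hX hall] at h0 ⊢
    obtain ⟨π, hπ, he⟩ := (h X hX).1 h0
    refine ⟨π, ⟨hπ.1, fun j hj hji u hu => ?_⟩, he⟩
    rcases Nat.lt_succ_iff_lt_or_eq.1 hji with h' | h'
    · exact hπ.2 j hj h' u hu
    · rw [key X π hπ.1 j h' u hu]
      exact hall j hj h'
  · rintro ⟨π, hπ⟩
    obtain ⟨u, hu⟩ := hY
    rw [hR X hX fun j hj hji => by
      have := hπ.2 j hj (by omega) u hu
      rwa [key X π hπ.1 j hji u hu] at this]
    exact (h X hX).2 ⟨π, hπ.1, fun j hj hji => hπ.2 j hj (by omega)⟩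

end Layered

end WSP

/-! ### Notation for expressions -/

namespace RAM.Exp

instance : Add Exp := ⟨op .add⟩
instance : Sub Exp := ⟨op .sub⟩
instance : Mul Exp := ⟨op .mul⟩
instance : Div Exp := ⟨op .div⟩
instance : Mod Exp := ⟨op .mod⟩
instance : HPow Exp Exp Exp := ⟨pow⟩
instance (v : ℕ) : OfNat Exp v := ⟨lit v⟩

/-- Equality test. -/
def test (a c : Exp) : Exp := op .eq a c

/-- The binary digit of `F` at position `s`. -/
def digit (F s : Exp) : Exp := F / (2 : Exp) ^ s % 2

/-- The number of common binary digits `1` of `F` and `G` at the positions below `K`. -/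
def inter (d : ℕ) (K F G : Exp) : Exp := sum d K (digit F (var d) * digit G (var d))

variable {b : ℕ} {A : ℕ → ℕ → ℕ} {ρ : ℕ → ℕ}

@[simp] theorem eval_lit (v : ℕ) : (lit v).eval A ρ = v := rfl
@[simp] theorem eval_ofNat (v : ℕ) : (no_index (OfNat.ofNat v) : Exp).eval A ρ = v := rfl
@[simp] theorem eval_var (x : ℕ) : (var x).eval A ρ = ρ x := rfl
@[simp] theorem eval_arr (a : ℕ) (e : Exp) : (arr a e).eval A ρ = A a (e.eval A ρ) := rfl
@[simp] theorem eval_add (e f : Exp) : (e + f).eval A ρ = e.eval A ρ + f.eval A ρ := rfl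
@[simp] theorem eval_sub (e f : Exp) : (e - f).eval A ρ = e.eval A ρ - f.eval A ρ := rfl
@[simp] theorem eval_mul (e f : Exp) : (e * f).eval A ρ = e.eval A ρ * f.eval A ρ := rfl
@[simp] theorem eval_div (e f : Exp) : (e / f).eval A ρ = e.eval A ρ / f.eval A ρ := rfl
@[simp] theorem eval_mod (e f : Exp) : (e % f).eval A ρ = e.eval A ρ % f.eval A ρ := rfl
@[simp] theorem eval_pow (e f : Exp) : (e ^ f).eval A ρ = e.eval A ρ ^ f.eval A ρ := rfl
@[simp] theorem eval_test (e f : Exp) :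
    (test e f).eval A ρ = if e.eval A ρ = f.eval A ρ then 1 else 0 := rfl
@[simp] theorem eval_sum (x : ℕ) (e f : Exp) : (sum x e f).eval A ρ =
    ∑ i ∈ Finset.range (e.eval A ρ), f.eval A (Function.update ρ x i) := rfl
@[simp] theorem eval_digit (e f : Exp) :
    (digit e f).eval A ρ = e.eval A ρ / 2 ^ f.eval A ρ % 2 := rfl

@[simp] theorem safe_lit (v : ℕ) : (lit v).Safe b A ρ := trivial
@[simp] theorem safe_ofNat (v : ℕ) : (no_index (OfNat.ofNat v) : Exp).Safe b A ρ := trivial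
@[simp] theorem safe_var (x : ℕ) : (var x).Safe b A ρ := trivial
@[simp] theorem safe_arr (a : ℕ) (e : Exp) : (arr a e).Safe b A ρ ↔ e.Safe b A ρ := Iff.rfl
@[simp] theorem safe_add (e f : Exp) :
    (e + f).Safe b A ρ ↔ e.Safe b A ρ ∧ f.Safe b A ρ := Iff.rfl
@[simp] theorem safe_sub (e f : Exp) :
    (e - f).Safe b A ρ ↔ e.Safe b A ρ ∧ f.Safe b A ρ := Iff.rfl
@[simp] theorem safe_mul (e f : Exp) :
    (e * f).Safe b A ρ ↔ e.Safe b A ρ ∧ f.Safe b A ρ := Iff.rfl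
@[simp] theorem safe_div (e f : Exp) :
    (e / f).Safe b A ρ ↔ e.Safe b A ρ ∧ f.Safe b A ρ := Iff.rfl
@[simp] theorem safe_mod (e f : Exp) :
    (e % f).Safe b A ρ ↔ e.Safe b A ρ ∧ f.Safe b A ρ := Iff.rfl
@[simp] theorem safe_test (e f : Exp) :
    (test e f).Safe b A ρ ↔ e.Safe b A ρ ∧ f.Safe b A ρ := Iff.rfl
theorem safe_pow (e f : Exp) : (e ^ f).Safe b A ρ ↔ e.Safe b A ρ ∧ f.Safe b A ρ ∧
    f.eval A ρ ≤ b ∧ e.eval A ρ ^ f.eval A ρ < 2 ^ b := Iff.rfl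
theorem safe_sum (x : ℕ) (e f : Exp) : (sum x e f).Safe b A ρ ↔ e.Safe b A ρ ∧ e.eval A ρ ≤ b ∧
    (∀ i < e.eval A ρ, f.Safe b A (Function.update ρ x i)) ∧
    ∑ i ∈ Finset.range (e.eval A ρ), f.eval A (Function.update ρ x i) < 2 ^ b := Iff.rfl
theorem safe_digit (e f : Exp) : (digit e f).Safe b A ρ ↔ e.Safe b A ρ ∧ f.Safe b A ρ ∧
    f.eval A ρ < b := by
  simp only [digit, safe_mod, safe_div, safe_pow, safe_ofNat, eval_ofNat, true_and, and_true]
  rw [Nat.pow_lt_pow_iff_right (by norm_num)]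
  constructor <;> rintro ⟨h1, h2, h3⟩
  · exact ⟨h1, h2, h3.2⟩
  · exact ⟨h1, h2, h3.le, h3⟩

theorem eval_congr : ∀ (e : Exp) (d : ℕ) (ρ ρ' : ℕ → ℕ), e.wf d = true →
    (∀ x < d, ρ x = ρ' x) → e.eval A ρ = e.eval A ρ'
  | lit _, _, _, _, _, _ => rfl
  | var x, d, ρ, ρ', hw, h => h x (by simpa [wf] using hw)
  | arr a e, d, ρ, ρ', hw, h => by
      simp only [wf, Bool.and_eq_true] at hw
      simp only [eval, eval_congr e d ρ ρ' hw.2 h]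
  | op o e f, d, ρ, ρ', hw, h => by
      simp only [wf, Bool.and_eq_true] at hw
      simp only [eval, eval_congr e d ρ ρ' hw.1 h, eval_congr f d ρ ρ' hw.2 h]
  | pow e f, d, ρ, ρ', hw, h => by
      simp only [wf, Bool.and_eq_true] at hw
      simp only [eval, eval_congr e d ρ ρ' hw.1 h, eval_congr f d ρ ρ' hw.2 h]
  | sum x e f, d, ρ, ρ', hw, h => by
      simp only [wf, Bool.and_eq_true, decide_eq_true_eq] at hw
      obtain ⟨⟨rfl, hwe⟩, hwf⟩ := hw
      simp only [eval, eval_congr e x ρ ρ' hwe h]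
      refine Finset.sum_congr rfl fun i _ => eval_congr f (x + 1) _ _ hwf fun y hy => ?_
      simp only [Function.update_apply]
      split_ifs with hxy
      · rfl
      · exact h y (by omega)

/-- The value of an expression does not depend on variables out of scope. -/
theorem eval_update {e : Exp} {d : ℕ} (hw : e.wf d = true) (v : ℕ) :
    e.eval A (Function.update ρ d v) = e.eval A ρ :=
  eval_congr e d _ _ hw fun x hx => Function.update_of_ne (by omega) _ _

end RAM.Exp

/-! ### Cardinalities of intersections as expressions. -/

namespace WSP

open Finset RAM RAM.Exp

variable {b : ℕ} {A : ℕ → ℕ → ℕ} {ρ : ℕ → ℕ}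

theorem eval_inter {d κ : ℕ} {K F G : Exp} {X Y : Finset ℕ} (hF : F.wf d = true)
    (hG : G.wf d = true) (hK : K.eval A ρ = κ) (hX : F.eval A ρ = mask X)
    (hY : G.eval A ρ = mask Y) (hXκ : X ⊆ range κ) :
    (inter d K F G).eval A ρ = (X ∩ Y).card := by
  rw [← sum_bit_mul_bit hXκ]
  simp only [Exp.inter, eval_sum, hK, eval_mul, eval_digit, eval_var, Function.update_self,
    eval_update hF, eval_update hG, hX, hY]

theorem safe_inter {d κ : ℕ} {K F G : Exp} (hK : K.eval A ρ = κ) (hκ : κ ≤ b)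
    (hsF : ∀ v, F.Safe b A (Function.update ρ d v)) (hsG : ∀ v, G.Safe b A (Function.update ρ d v))
    (hsK : K.Safe b A ρ) : (inter d K F G).Safe b A ρ := by
  refine ⟨hsK, by omega, fun i hi => ?_, ?_⟩
  · simp only [safe_mul, safe_digit, hsF, hsG, safe_var, eval_var, Function.update_self, true_and]
    omega
  · rw [hK]
    calc ∑ i ∈ range κ, (digit F (var d) * digit G (var d)).eval A (Function.update ρ d i)
        ≤ ∑ i ∈ range κ, 1 := sum_le_sum fun i _ => by
          have h1 := Nat.mod_lt (F.eval A (Function.update ρ d i) / 2 ^ i) (by norm_num : 0 < 2)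
          have h2 := Nat.mod_lt (G.eval A (Function.update ρ d i) / 2 ^ i) (by norm_num : 0 < 2)
          simp only [eval_mul, eval_digit, eval_var, Function.update_self]
          exact Nat.mul_le_mul (Nat.le_of_lt_succ h1) (Nat.le_of_lt_succ h2)
      _ = κ := by simp
      _ < 2 ^ b := lt_of_le_of_lt hκ Nat.lt_two_pow_self

/-! ### The program -/

/-- Address of the record of constraint `j`. -/
def recordE (j : Exp) : Exp := var 6 + j * (2 + 2 * var 0)

/-- The pair of sets of constraint `j` as a single number. -/
def keyE (j : Exp) : Exp := arr 1 j + (2 : Exp) ^ (var 0) * arr 2 j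

/-- Position of the key of constraint `j` in array `4`, or else the first free position. -/
def findE (j : Exp) : Exp :=
  sum 8 (arr 5 0) (test (arr 4 (var 8)) (keyE j) * var 8) +
    (1 - sum 8 (arr 5 0) (test (arr 4 (var 8)) (keyE j))) * arr 5 0

/-- Computes for constraint `7` the masks of its sets (arrays `1` and `2`) and the mask of its
anchor (array `3`): its singleton, or a dummy step that belongs to the pair of sets. The pairs are
listed in array `4`, and their number is cell `0` of array `5`. -/
def anchorCmd : Cmd :=
  .seq (.put 1 (var 7) (sum 8 (var 0) (arr 0 (recordE (var 7) + 2 + var 8) * (2 : Exp) ^ var 8)))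
  (.seq (.put 2 (var 7)
    (sum 8 (var 0) (arr 0 (recordE (var 7) + 2 + var 0 + var 8) * (2 : Exp) ^ var 8)))
  (.ite (arr 0 (recordE (var 7))) .skip
  (.ite (test (inter 8 (var 0) (arr 1 (var 7)) (arr 1 (var 7))) 1) (.put 3 (var 7) (arr 1 (var 7)))
  (.ite (test (inter 8 (var 0) (arr 2 (var 7)) (arr 2 (var 7))) 1) (.put 3 (var 7) (arr 2 (var 7)))
  (.letc 8 (findE (var 7))
  (.seq (.put 4 (var 8) (keyE (var 7)))
  (.seq (.put 3 (var 7) ((2 : Exp) ^ (var 0 + var 8)))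
    (.put 5 0 (arr 5 0 + test (var 8) (arr 5 0))))))))))

/-- Rows for single users. Row `r` of the table (array `6`) begins at cell `r * var 8`. -/
def usersCmd : Cmd :=
  .loop 10 (var 1) (.loop 11 (var 8)
    (.ite (sum 12 (var 0) (digit (var 11) (var 12) * (1 - arr 0 (var 4 + var 12 * var 1 + var 10))))
      .skip
      (.put 6 (var 10 * var 8 + var 11)
        (1 + sum 12 (var 7) ((var 1) ^ (var 12) * (digit (var 11) (var 12) * var 10))))))

/-- The mask of the ternary digits `c` of variable `14`. -/
def ternaryE (d c : ℕ) : Exp :=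
  sum d (var 7) ((2 : Exp) ^ (var d) * test (var 14 / (3 : Exp) ^ (var d) % 3) (lit c))

/-- Merges row `12` into row `13`, and replaces row `12` by the row for no users. -/
def mergeCmd : Cmd :=
  .seq (.loop 14 (var 8) (.put 7 (var 14) 0))
  (.seq (.loop 14 (var 9) (.letc 15 (ternaryE 15 1) (.letc 16 (ternaryE 16 2)
    (.ite (arr 6 (var 13 * var 8 + var 15) * arr 6 (var 12 * var 8 + var 16))
      (.put 7 (var 15 + var 16)
        (arr 6 (var 13 * var 8 + var 15) + arr 6 (var 12 * var 8 + var 16) - 1))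
      .skip))))
  (.seq (.loop 14 (var 8) (.put 6 (var 13 * var 8 + var 14) (arr 7 (var 14))))
    (.loop 14 (var 8) (.put 6 (var 12 * var 8 + var 14) (test (var 14) 0)))))

/-- Block number of user `11` at the level below level `10`; below the first level, the users. -/
def previousE : Exp :=
  test (var 10) 0 * var 11 + (1 - test (var 10) 0) * arr 0 (var 5 + (var 10 - 1) * var 1 + var 11)

/-- Condition of constraint `11` for the set of steps with mask `13`. -/
def okE : Exp :=
  test (arr 0 (recordE (var 11))) 0 *
    (test (inter 14 (var 7) (var 13) (arr 3 (var 11))) 0 +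
      inter 14 (var 7) (var 13) (arr 1 (var 11)) * inter 14 (var 7) (var 13) (arr 2 (var 11))) +
  arr 0 (recordE (var 11)) * (arr 1 (var 11) * arr 2 (var 11) *
    (1 - test (inter 14 (var 7) (arr 1 (var 11)) (var 13))
        (inter 14 (var 7) (arr 1 (var 11)) (arr 1 (var 11))) *
      test (inter 14 (var 7) (arr 2 (var 11)) (var 13))
        (inter 14 (var 7) (arr 2 (var 11)) (arr 2 (var 11)))))

/-- Removes the sets of steps that violate constraint `11` from the rows of level `10`. -/
def checkCmd : Cmd :=
  .ite (test (arr 0 (recordE (var 11) + 1)) (var 10))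
    (.loop 12 (var 1) (.loop 13 (var 8) (.ite okE .skip
      (.put 6 (((var 10 + 1) * var 1 + var 12) * var 8 + var 13) 0))))
    .skip

/-- Computes the rows for the blocks of level `10`. -/
def levelCmd : Cmd :=
  .seq (.loop 11 (var 1) (.put 6 (((var 10 + 1) * var 1 + var 11) * var 8) 1))
  (.seq (.loop 11 (var 1) (.letc 12 (var 10 * var 1 + previousE)
      (.letc 13 ((var 10 + 1) * var 1 + arr 0 (var 5 + var 10 * var 1 + var 11)) mergeCmd)))
    (.loop 11 (var 3) checkCmd))

/-- Decodes the answer. -/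
def answerCmd : Cmd :=
  .letc 10 (arr 6 ((var 2 * var 1 + arr 0 (var 5 + (var 2 - 1) * var 1)) * var 8 + (var 8 - 1)))
  (.seq (.put 8 0 (1 - test (var 10) 0))
    (.loop 11 (var 0) (.put 8 (var 11 + 1) ((var 10 - 1) / (var 1) ^ (var 11) % var 1))))

/-- Dynamic programming over the blocks of the hierarchy, from the bottom to the top. -/
def solveCmd : Cmd :=
  .letc 0 (arr 0 0) (.letc 1 (arr 0 1) (.letc 2 (arr 0 2) (.letc 3 (arr 0 3)
  (.letc 4 (4 + var 0 * var 0) (.letc 5 (var 4 + var 0 * var 1) (.letc 6 (var 5 + var 2 * var 1)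
  (.seq (.loop 7 (var 3) anchorCmd)
  (.letc 7 (var 0 + arr 5 0) (.letc 8 ((2 : Exp) ^ (var 7)) (.letc 9 ((3 : Exp) ^ (var 7))
  (.seq usersCmd (.seq (.loop 10 (var 2) levelCmd) answerCmd))))))))))))

theorem wf_solveCmd : solveCmd.wf 0 = true := by decide

theorem zero_notMem_writes_solveCmd : 0 ∉ solveCmd.writes := by decide

/-! ### Input data -/

/-- Words of an input, and where the parts of the input stand. -/
structure Layout where
  inp : ℕ → ℕ
  k : ℕ
  n : ℕ
  l : ℕ
  m : ℕ

namespace Layout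

variable (D : Layout)

def authAddr : ℕ := 4 + D.k * D.k
def blockAddr : ℕ := D.authAddr + D.k * D.n
def recordsAddr : ℕ := D.blockAddr + D.l * D.n
def record (j : ℕ) : ℕ := D.recordsAddr + j * (2 + 2 * D.k)
def auth (s u : ℕ) : ℕ := D.inp (D.authAddr + s * D.n + u)
def block (i u : ℕ) : ℕ := D.inp (D.blockAddr + i * D.n + u)
def kind (j : ℕ) : ℕ := D.inp (D.record j)
def level (j : ℕ) : ℕ := D.inp (D.record j + 1)
def S₁ (j : ℕ) : Finset ℕ := (range D.k).filter fun s => D.inp (D.record j + 2 + s) = 1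
def S₂ (j : ℕ) : Finset ℕ := (range D.k).filter fun s => D.inp (D.record j + 2 + D.k + s) = 1

/-- Constraints of the form `(∼_i, S₁, S₂)` that are not of Type 2. -/
def sim3 : Finset ℕ :=
  (range D.m).filter fun j => D.kind j = 0 ∧ (D.S₁ j).card ≠ 1 ∧ (D.S₂ j).card ≠ 1

/-- Bound for the number of dummy steps. -/
def dummies : ℕ := min D.sim3.card (4 ^ D.k)

structure Valid : Prop where
  k_eq : D.inp 0 = D.k
  n_eq : D.inp 1 = D.n
  l_eq : D.inp 2 = D.l
  m_eq : D.inp 3 = D.m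
  n_pos : 0 < D.n
  l_pos : 0 < D.l
  auth_le : ∀ s < D.k, ∀ u < D.n, D.auth s u ≤ 1
  block_lt : ∀ i < D.l, ∀ u < D.n, D.block i u < D.n
  kind_le : ∀ j < D.m, D.kind j ≤ 1
  level_lt : ∀ j < D.m, D.level j < D.l
  mem₁_le : ∀ j < D.m, ∀ s < D.k, D.inp (D.record j + 2 + s) ≤ 1
  mem₂_le : ∀ j < D.m, ∀ s < D.k, D.inp (D.record j + 2 + D.k + s) ≤ 1
  refines : ∀ i, i + 1 < D.l → ∀ u < D.n, ∀ v < D.n, D.block i u = D.block i v →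
    D.block (i + 1) u = D.block (i + 1) v
  last : ∀ u < D.n, ∀ v < D.n, D.block (D.l - 1) u = D.block (D.l - 1) v

/-- `b` bits suffice for all values. -/
structure Fits (b : ℕ) : Prop where
  steps : D.k + D.dummies + 1 ≤ b
  users : D.n < 2 ^ b
  plans : D.n ^ (D.k + D.dummies) < 2 ^ b
  count : D.m < 2 ^ b
  masks : 4 ^ (D.k + D.dummies) < 2 ^ b
  rows : (D.l + 1) * D.n < 2 ^ b
  addr : D.recordsAddr < 2 ^ b

/-- Values of the variables `0, …, 6`. -/
structure Env (ρ : ℕ → ℕ) : Prop where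
  k : ρ 0 = D.k
  n : ρ 1 = D.n
  l : ρ 2 = D.l
  m : ρ 3 = D.m
  auth : ρ 4 = D.authAddr
  block : ρ 5 = D.blockAddr
  records : ρ 6 = D.recordsAddr

/-- Values of the variables `0, …, 9`. -/
structure EnvK (K : ℕ) (ρ : ℕ → ℕ) : Prop extends D.Env ρ where
  steps : ρ 7 = K
  two : ρ 8 = 2 ^ K
  three : ρ 9 = 3 ^ K

variable {D}

theorem Env.update (h : D.Env ρ) {x : ℕ} (hx : 7 ≤ x) (v : ℕ) : D.Env (Function.update ρ x v) := by
  constructor <;> rw [Function.update_of_ne (by omega)]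
  exacts [h.k, h.n, h.l, h.m, h.auth, h.block, h.records]

theorem EnvK.update {K : ℕ} (h : D.EnvK K ρ) {x : ℕ} (hx : 10 ≤ x) (v : ℕ) :
    D.EnvK K (Function.update ρ x v) := by
  refine ⟨h.toEnv.update (by omega) v, ?_, ?_, ?_⟩ <;> rw [Function.update_of_ne (by omega)]
  exacts [h.steps, h.two, h.three]

theorem S₁_subset (j : ℕ) : D.S₁ j ⊆ range D.k := filter_subset _ _
theorem S₂_subset (j : ℕ) : D.S₂ j ⊆ range D.k := filter_subset _ _

end Layout

end WSP

/-! ### Masks and anchors of the constraints -/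

namespace WSP

open Finset RAM RAM.Exp

namespace Layout

variable {D : Layout} {b : ℕ} {A : ℕ → ℕ → ℕ} {ρ : ℕ → ℕ}

/-- The pair of sets of a constraint as a single number. -/
def key (D : Layout) (j : ℕ) : ℕ := mask (D.S₁ j) + 2 ^ D.k * mask (D.S₂ j)

theorem key_lt (j : ℕ) : D.key j < 4 ^ D.k := by
  have h1 := mask_lt (S₁_subset (D := D) j)
  have h2 := mask_lt (S₂_subset (D := D) j)
  have h3 : 2 ^ D.k * (mask (D.S₂ j) + 1) ≤ 2 ^ D.k * 2 ^ D.k := Nat.mul_le_mul_left _ h2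
  rw [show (4 : ℕ) = 2 * 2 by norm_num, mul_pow, key]
  nlinarith

/-- The two masks are the remainder and the quotient of the key modulo `2 ^ k`, since the first mask
is smaller than this modulus. -/
theorem key_inj {i j : ℕ} (h : D.key i = D.key j) : D.S₁ i = D.S₁ j ∧ D.S₂ i = D.S₂ j := by
  have h1 := mask_lt (S₁_subset (D := D) i)
  have h2 := mask_lt (S₁_subset (D := D) j)
  have e1 : D.key i % 2 ^ D.k = mask (D.S₁ i) := by
    rw [key, Nat.add_mul_mod_self_left, Nat.mod_eq_of_lt h1]
  have e2 : D.key j % 2 ^ D.k = mask (D.S₁ j) := by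
    rw [key, Nat.add_mul_mod_self_left, Nat.mod_eq_of_lt h2]
  have f1 : D.key i / 2 ^ D.k = mask (D.S₂ i) := by
    rw [key, Nat.add_mul_div_left _ _ (by positivity), Nat.div_eq_of_lt h1, zero_add]
  have f2 : D.key j / 2 ^ D.k = mask (D.S₂ j) := by
    rw [key, Nat.add_mul_div_left _ _ (by positivity), Nat.div_eq_of_lt h2, zero_add]
  exact ⟨mask_injective (by rw [← e1, ← e2, h]), mask_injective (by rw [← f1, ← f2, h])⟩

/-- The constraints before the `j`-th one have been treated. -/
structure AnchorInv (D : Layout) (j : ℕ) (A : ℕ → ℕ → ℕ) : Prop where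
  inp : A 0 = D.inp
  mask₁ : ∀ i < j, A 1 i = mask (D.S₁ i)
  mask₂ : ∀ i < j, A 2 i = mask (D.S₂ i)
  single₁ : ∀ i < j, D.kind i = 0 → (D.S₁ i).card = 1 → A 3 i = mask (D.S₁ i)
  single₂ : ∀ i < j, D.kind i = 0 → (D.S₁ i).card ≠ 1 → (D.S₂ i).card = 1 →
    A 3 i = mask (D.S₂ i)
  dummy : ∀ i < j, i ∈ D.sim3 → ∃ d < A 5 0, A 4 d = D.key i ∧ A 3 i = 2 ^ (D.k + d)
  used : ∀ d < A 5 0, ∃ i < j, i ∈ D.sim3 ∧ A 4 d = D.key i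
  inj : ∀ d < A 5 0, ∀ d' < A 5 0, A 4 d = A 4 d' → d = d'
  count : A 5 0 ≤ (D.sim3.filter (· < j)).card

/-- There are two ways to count the listed keys: the invariant bounds their number by that of the
constraints treated so far, and they are distinct numbers below `4 ^ k`. The first bound serves the
running time, the second one fixed-parameter tractability. -/
theorem AnchorInv.le_dummies {j : ℕ} (h : D.AnchorInv j A) : A 5 0 ≤ D.dummies := by
  refine le_min (h.count.trans (card_le_card (filter_subset _ _))) ?_
  calc A 5 0 = (range (A 5 0)).card := (card_range _).symm
    _ ≤ (range (4 ^ D.k)).card := card_le_card_of_injOn (A 4) (fun d hd => by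
        obtain ⟨i, -, -, hi⟩ := h.used d (mem_range.1 hd)
        simp only [coe_range, Set.mem_Iio, hi]
        exact key_lt i) fun d hd d' hd' => h.inj d (mem_range.1 hd) d' (mem_range.1 hd')
    _ = 4 ^ D.k := card_range _

/-- Keys are searched by sums instead of a loop with an exit. As the list has no repetitions, at
most one term of each sum survives: the second sum tells whether the key occurs, and the first one
where. -/
theorem find_spec {q : ℕ} {f : ℕ → ℕ} {c : ℕ} (inj : ∀ d < q, ∀ d' < q, f d = f d' → d = d') :
    ((∃ d₀ < q, f d₀ = c ∧ ∑ d ∈ range q, (if f d = c then 1 else 0) * d = d₀ ∧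
      ∑ d ∈ range q, (if f d = c then 1 else 0) = 1) ∨
    ((∀ d < q, f d ≠ c) ∧ ∑ d ∈ range q, (if f d = c then 1 else 0) * d = 0 ∧
      ∑ d ∈ range q, (if f d = c then 1 else 0) = 0)) := by
  by_cases h : ∃ d₀ < q, f d₀ = c
  · obtain ⟨d₀, h0, hc⟩ := h
    refine Or.inl ⟨d₀, h0, hc, ?_, ?_⟩
    · rw [sum_eq_single d₀ (fun d hd hne => ?_) fun hn => absurd (mem_range.2 h0) hn, if_pos hc,
        one_mul]
      rw [if_neg fun hd' => hne (inj d (mem_range.1 hd) d₀ h0 (hd'.trans hc.symm)), zero_mul]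
    · rw [sum_eq_single d₀ (fun d hd hne => ?_) fun hn => absurd (mem_range.2 h0) hn, if_pos hc]
      rw [if_neg fun hd' => hne (inj d (mem_range.1 hd) d₀ h0 (hd'.trans hc.symm))]
  · push Not at h
    refine Or.inr ⟨h, ?_, ?_⟩
    · exact sum_eq_zero fun d hd => by rw [if_neg (h d (mem_range.1 hd)), zero_mul]
    · exact sum_eq_zero fun d hd => by rw [if_neg (h d (mem_range.1 hd))]

theorem sum_bits_eq_mask {k : ℕ} {f : ℕ → ℕ} (hf : ∀ s < k, f s ≤ 1) :
    ∑ s ∈ range k, f s * 2 ^ s = mask ((range k).filter fun s => f s = 1) := by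
  rw [mask, sum_filter]
  refine sum_congr rfl fun s hs => ?_
  have := hf s (mem_range.1 hs)
  split_ifs with h
  · rw [h, one_mul]
  · rw [show f s = 0 by omega, zero_mul]

theorem AnchorInv.succ_of_notMem {j : ℕ} {A' : ℕ → ℕ → ℕ} (h : D.AnchorInv j A)
    (h0 : A' 0 = A 0) (h1 : A' 1 = Function.update (A 1) j (mask (D.S₁ j)))
    (h2 : A' 2 = Function.update (A 2) j (mask (D.S₂ j))) (h3 : ∀ i < j, A' 3 i = A 3 i)
    (h4 : A' 4 = A 4) (h5 : A' 5 = A 5) (hj : j ∉ D.sim3)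
    (hs₁ : D.kind j = 0 → (D.S₁ j).card = 1 → A' 3 j = mask (D.S₁ j))
    (hs₂ : D.kind j = 0 → (D.S₁ j).card ≠ 1 → (D.S₂ j).card = 1 → A' 3 j = mask (D.S₂ j)) :
    D.AnchorInv (j + 1) A' := by
  refine ⟨h0.trans h.inp, ?_, ?_, ?_, ?_, ?_, ?_, ?_, ?_⟩
  · intro i hi
    rw [h1]
    rcases Nat.lt_succ_iff_lt_or_eq.1 hi with h' | rfl
    · rw [Function.update_of_ne (by omega), h.mask₁ i h']
    · simp
  · intro i hi
    rw [h2]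
    rcases Nat.lt_succ_iff_lt_or_eq.1 hi with h' | rfl
    · rw [Function.update_of_ne (by omega), h.mask₂ i h']
    · simp
  · intro i hi
    rcases Nat.lt_succ_iff_lt_or_eq.1 hi with h' | rfl
    · rw [h3 i h']; exact h.single₁ i h'
    · exact hs₁
  · intro i hi
    rcases Nat.lt_succ_iff_lt_or_eq.1 hi with h' | rfl
    · rw [h3 i h']; exact h.single₂ i h'
    · exact hs₂
  · intro i hi him
    rcases Nat.lt_succ_iff_lt_or_eq.1 hi with h' | rfl
    · rw [h3 i h', h4, h5]; exact h.dummy i h' him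
    · exact absurd him hj
  · rw [h4, h5]
    intro d hd
    obtain ⟨i, hi, h'⟩ := h.used d hd
    exact ⟨i, by omega, h'⟩
  · rw [h4, h5]; exact h.inj
  · rw [h5]
    exact h.count.trans (card_le_card fun i hi => by
      simp only [mem_filter] at hi ⊢
      exact ⟨hi.1, by omega⟩)

/-- The alternative `hv` covers a pair of sets that is listed already, whose dummy step is reused,
and a new one, which gets the first free position. In both cases the program performs the same
assignments; only the growth of the counter differs. -/
theorem AnchorInv.succ_of_mem {j v : ℕ} {A' : ℕ → ℕ → ℕ} (h : D.AnchorInv j A)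
    (h0 : A' 0 = A 0) (h1 : A' 1 = Function.update (A 1) j (mask (D.S₁ j)))
    (h2 : A' 2 = Function.update (A 2) j (mask (D.S₂ j)))
    (h3 : A' 3 = Function.update (A 3) j (2 ^ (D.k + v)))
    (h4 : A' 4 = Function.update (A 4) v (D.key j))
    (h5 : A' 5 0 = A 5 0 + if v = A 5 0 then 1 else 0) (hj : j ∈ D.sim3)
    (hv : v < A 5 0 ∧ A 4 v = D.key j ∨ v = A 5 0 ∧ ∀ d < A 5 0, A 4 d ≠ D.key j) :
    D.AnchorInv (j + 1) A' := by
  have hj' := (mem_filter.1 hj).2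
  have hv' : v < A' 5 0 := by
    rw [h5]
    split_ifs with hvq
    · omega
    · rcases hv with h' | h' <;> omega
  -- Writing a key at the position where it already stands changes nothing.
  have hold : ∀ d, d < A 5 0 → A' 4 d = A 4 d := by
    intro d hd
    rw [h4, Function.update_apply]
    split_ifs with hdv
    · rcases hv with h' | h'
      · rw [hdv, h'.2]
      · omega
    · rfl
  have hnew : ∀ d, d < A' 5 0 → d < A 5 0 ∨ (d = v ∧ v = A 5 0) := by
    intro d hd
    rw [h5] at hd
    split_ifs at hd with hvq
    · omega
    · omega
  have hle : A 5 0 ≤ A' 5 0 := by rw [h5]; omega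
  have hA'v : A' 4 v = D.key j := by rw [h4, Function.update_self]
  refine ⟨h0.trans h.inp, ?_, ?_, ?_, ?_, ?_, ?_, ?_, ?_⟩
  · intro i hi
    rw [h1]
    rcases Nat.lt_succ_iff_lt_or_eq.1 hi with h' | rfl
    · rw [Function.update_of_ne (by omega), h.mask₁ i h']
    · simp
  · intro i hi
    rw [h2]
    rcases Nat.lt_succ_iff_lt_or_eq.1 hi with h' | rfl
    · rw [Function.update_of_ne (by omega), h.mask₂ i h']
    · simp
  · intro i hi hk hc
    rcases Nat.lt_succ_iff_lt_or_eq.1 hi with h' | rfl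
    · rw [h3, Function.update_of_ne (by omega)]; exact h.single₁ i h' hk hc
    · exact absurd hc hj'.2.1
  · intro i hi hk hc hc'
    rcases Nat.lt_succ_iff_lt_or_eq.1 hi with h' | rfl
    · rw [h3, Function.update_of_ne (by omega)]; exact h.single₂ i h' hk hc hc'
    · exact absurd hc' hj'.2.2
  · intro i hi him
    rcases Nat.lt_succ_iff_lt_or_eq.1 hi with h' | rfl
    · obtain ⟨d, hd, e1, e2⟩ := h.dummy i h' him
      exact ⟨d, by omega, by rw [hold d hd, e1], by rw [h3, Function.update_of_ne (by omega), e2]⟩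
    · exact ⟨v, hv', hA'v, by rw [h3, Function.update_self]⟩
  · intro d hd
    rcases hnew d hd with h' | ⟨rfl, -⟩
    · obtain ⟨i, hi, h''⟩ := h.used d h'
      exact ⟨i, by omega, by rwa [hold d h']⟩
    · exact ⟨j, by omega, hj, hA'v⟩
  · have hne : v = A 5 0 → ∀ d < A 5 0, A 4 d ≠ D.key j := by
      intro hvq
      rcases hv with h' | h'
      · omega
      · exact h'.2
    intro d hd d' hd' he
    rcases hnew d hd with e1 | ⟨rfl, e1⟩ <;> rcases hnew d' hd' with e2 | ⟨rfl, e2⟩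
    · rw [hold d e1, hold d' e2] at he
      exact h.inj d e1 d' e2 he
    · rw [hold d e1, hA'v] at he
      exact absurd he (hne e2 d e1)
    · rw [hold d' e2, hA'v] at he
      exact absurd he.symm (hne e1 d' e2)
    · rfl
  · have : (D.sim3.filter (· < j)).card + 1 = (D.sim3.filter (· < j + 1)).card := by
      rw [← card_insert_of_notMem (a := j) (by simp)]
      congr 1
      ext i
      simp only [mem_insert, mem_filter]
      constructor
      · rintro (rfl | ⟨h1, h2⟩)
        · exact ⟨hj, by omega⟩
        · exact ⟨h1, by omega⟩
      · rintro ⟨h1, h2⟩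
        by_cases hij : i = j
        · exact Or.inl hij
        · exact Or.inr ⟨h1, by omega⟩
    have := h.count
    rw [h5]
    split_ifs <;> omega

theorem eval_recordE (h : D.Env ρ) {x j : ℕ} (hx : ρ x = j) :
    (recordE (var x)).eval A ρ = D.record j := by
  simp [recordE, h.records, h.k, hx, record]

theorem safe_recordE (x : ℕ) : (recordE (var x)).Safe b A ρ := by simp [recordE]

theorem triple_anchorCmd (hD : D.Valid) (hb : D.Fits b) {j : ℕ} (hj : j < D.m) (hρ : D.Env ρ)
    (h7 : ρ 7 = j) (hA : D.AnchorInv j A) :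
    Triple b anchorCmd ρ A 12 (D.AnchorInv (j + 1)) := by
  have hkb : D.k < b := by have := hb.steps; omega
  have h2k : 2 ^ D.k ≤ 2 ^ b := Nat.pow_le_pow_right (by norm_num) hkb.le
  have hm1 : ∑ s ∈ range D.k, D.inp (D.record j + 2 + s) * 2 ^ s = mask (D.S₁ j) :=
    sum_bits_eq_mask (f := fun s => D.inp (D.record j + 2 + s)) (hD.mem₁_le j hj)
  have hm2 : ∑ s ∈ range D.k, D.inp (D.record j + 2 + D.k + s) * 2 ^ s = mask (D.S₂ j) :=
    sum_bits_eq_mask (f := fun s => D.inp (D.record j + 2 + D.k + s)) (hD.mem₂_le j hj)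
  have hl1 := (mask_lt (S₁_subset (D := D) j)).trans_le h2k
  have hl2 := (mask_lt (S₂_subset (D := D) j)).trans_le h2k
  have hrec : ∀ A v, (recordE (var 7)).eval A (Function.update ρ 8 v) = D.record j := fun A v =>
    eval_recordE (hρ.update (by omega) v) (by simp [h7])
  have hrec' : ∀ A, (recordE (var 7)).eval A ρ = D.record j := fun A => eval_recordE hρ h7
  set A₁ := Function.update A 1 (Function.update (A 1) j (mask (D.S₁ j))) with hA₁
  have h10 : A₁ 0 = D.inp := by rw [hA₁, Function.update_of_ne (by omega), hA.inp]
  set A₂ := Function.update A₁ 2 (Function.update (A₁ 2) j (mask (D.S₂ j))) with hA₂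
  have h20 : A₂ 0 = A 0 := by
    rw [hA₂, Function.update_of_ne (by omega), hA₁, Function.update_of_ne (by omega)]
  have h21 : A₂ 1 = Function.update (A 1) j (mask (D.S₁ j)) := by
    rw [hA₂, Function.update_of_ne (by omega), hA₁, Function.update_self]
  have h22 : A₂ 2 = Function.update (A 2) j (mask (D.S₂ j)) := by
    rw [hA₂, Function.update_self, hA₁, Function.update_of_ne (by omega)]
  have h2a : ∀ a, 2 < a → A₂ a = A a := fun a ha => by
    rw [hA₂, Function.update_of_ne (by omega), hA₁, Function.update_of_ne (by omega)]
  clear_value A₁ A₂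
  refine (Triple.seq (m := 1) (n := 11) (Triple.put (j := j) (v := mask (D.S₁ j)) (by simp) ?_
    (by simp [h7]) ?_ hl1 (?_ : Triple b _ ρ (Function.update A 1 _) _ _))).mono (by omega)
    fun _ h => h
  · simp only [safe_sum, safe_var, eval_var, hρ.k, true_and, safe_mul, safe_arr, safe_add,
      safe_recordE, safe_ofNat, safe_pow, eval_ofNat, Function.update_self, eval_mul, eval_arr,
      eval_add, eval_pow, hrec, hA.inp, hm1]
    refine ⟨hkb.le, fun i hi => ⟨by omega, ?_⟩, hl1⟩
    exact Nat.pow_lt_pow_right (by norm_num) (by omega)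
  · simp only [eval_sum, eval_var, hρ.k, eval_ofNat, Function.update_self, eval_mul, eval_arr,
      eval_add, eval_pow, hrec, hA.inp, hm1]
  rw [← hA₁]
  have h08 : ∀ v, Function.update ρ 8 v 0 = D.k := fun v => by
    rw [Function.update_of_ne (by omega), hρ.k]
  refine Triple.seq (m := 1) (n := 10) (Triple.put (j := j) (v := mask (D.S₂ j)) (by simp) ?_
    (by simp [h7]) ?_ hl2 (?_ : Triple b _ ρ (Function.update A₁ 2 _) _ _))
  · simp only [safe_sum, safe_var, eval_var, hρ.k, true_and, safe_mul, safe_arr, safe_add,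
      safe_recordE, safe_ofNat, safe_pow, eval_ofNat, Function.update_self, eval_mul, eval_arr,
      eval_add, eval_pow, hrec, h10, hm2, h08]
    refine ⟨hkb.le, fun i hi => ⟨by omega, ?_⟩, hl2⟩
    exact Nat.pow_lt_pow_right (by norm_num) (by omega)
  · simp only [eval_sum, eval_var, hρ.k, eval_ofNat, Function.update_self, eval_mul, eval_arr,
      eval_add, eval_pow, hrec, h10, hm2, h08]
  rw [← hA₂]
  have hk1 := hD.kind_le j hj
  have hin : ∀ a X, (a = 1 ∨ a = 2) → A₂ a j = mask X → X ⊆ range D.k →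
      (inter 8 (var 0) (arr a (var 7)) (arr a (var 7))).Safe b A₂ ρ ∧
      (inter 8 (var 0) (arr a (var 7)) (arr a (var 7))).eval A₂ ρ = X.card := by
    intro a X ha hX hXk
    have hw : (arr a (var 7)).wf 8 = true := by rcases ha with rfl | rfl <;> decide
    have he : (arr a (var 7)).eval A₂ ρ = mask X := by simp [h7, hX]
    refine ⟨safe_inter (by simp [hρ.k]) hkb.le (by simp) (by simp) (by simp), ?_⟩
    rw [eval_inter hw hw (by simp [hρ.k]) he he hXk, inter_self]
  obtain ⟨s1, c1⟩ := hin 1 (D.S₁ j) (Or.inl rfl) (by rw [h21, Function.update_self])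
    (S₁_subset j)
  obtain ⟨s2, c2⟩ := hin 2 (D.S₂ j) (Or.inr rfl) (by rw [h22, Function.update_self])
    (S₂_subset j)
  by_cases hkind : D.kind j = 0
  swap
  · refine (Triple.ite_true (by simp [safe_recordE]) ?_ (Triple.skip ?_)).mono (m := 10)
      (by omega) fun _ h => h
    · simp only [eval_arr, hrec', h20, hA.inp]
      exact hkind
    · exact hA.succ_of_notMem h20 h21 h22 (fun i _ => by rw [h2a 3 (by omega)]) (h2a 4 (by omega))
        (h2a 5 (by omega)) (fun h => hkind (mem_filter.1 h).2.1) (fun h => absurd h hkind)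
        (fun h => absurd h hkind)
  refine Triple.ite_false (n := 9) (by simp [safe_recordE]) (by
    simp only [eval_arr, hrec', h20, hA.inp]
    exact hkind) ?_
  by_cases hc1 : (D.S₁ j).card = 1
  · refine (Triple.ite_true (by simp [s1]) (by simp [c1, hc1]) (Triple.put (j := j)
      (v := mask (D.S₁ j)) (by simp) (by simp) (by simp [h7]) (by simp [h7, h21]) hl1 ?_)).mono
      (by omega) fun _ h => h
    refine hA.succ_of_notMem ?_ ?_ ?_ ?_ ?_ ?_ (fun h => (mem_filter.1 h).2.2.1 hc1) ?_
      (fun _ h => absurd hc1 h)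
    · rw [Function.update_of_ne (by omega), h20]
    · rw [Function.update_of_ne (by omega), h21]
    · rw [Function.update_of_ne (by omega), h22]
    · intro i hi
      rw [Function.update_self, Function.update_of_ne (by omega), h2a 3 (by omega)]
    · rw [Function.update_of_ne (by omega), h2a 4 (by omega)]
    · rw [Function.update_of_ne (by omega), h2a 5 (by omega)]
    · intro _ _
      simp
  refine Triple.ite_false (n := 8) (by simp [s1]) (by simp [c1, hc1]) ?_
  by_cases hc2 : (D.S₂ j).card = 1
  · refine (Triple.ite_true (by simp [s2]) (by simp [c2, hc2]) (Triple.put (j := j)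
      (v := mask (D.S₂ j)) (by simp) (by simp) (by simp [h7]) (by simp [h7, h22]) hl2 ?_)).mono
      (by omega) fun _ h => h
    refine hA.succ_of_notMem ?_ ?_ ?_ ?_ ?_ ?_ (fun h => (mem_filter.1 h).2.2.2 hc2)
      (fun _ h => absurd h hc1) ?_
    · rw [Function.update_of_ne (by omega), h20]
    · rw [Function.update_of_ne (by omega), h21]
    · rw [Function.update_of_ne (by omega), h22]
    · intro i hi
      rw [Function.update_self, Function.update_of_ne (by omega), h2a 3 (by omega)]
    · rw [Function.update_of_ne (by omega), h2a 4 (by omega)]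
    · rw [Function.update_of_ne (by omega), h2a 5 (by omega)]
    · intro _ _ _
      simp
  refine Triple.ite_false (n := 7) (by simp [s2]) (by simp [c2, hc2]) ?_
  have hj3 : j ∈ D.sim3 := mem_filter.2 ⟨mem_range.2 hj, hkind, hc1, hc2⟩
  have hq : A₂ 5 0 = A 5 0 := by rw [h2a 5 (by omega)]
  have hqd := hA.le_dummies
  have hqb : A 5 0 < b := by have := hb.steps; omega
  have hbb : b < 2 ^ b := Nat.lt_two_pow_self
  have hkey : ∀ A', A' 1 = A₂ 1 → A' 2 = A₂ 2 → ∀ v, (keyE (var 7)).eval A' (Function.update ρ 8 v)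
      = D.key j := by
    intro A' e1 e2 v
    simp [keyE, h7, e1, e2, h21, h22, hρ.k, key]
  have hkeys : ∀ A' v, (keyE (var 7)).Safe b A' (Function.update ρ 8 v) := by
    intro A' v
    simp only [keyE, safe_add, safe_mul, safe_arr, safe_var, safe_pow, safe_ofNat, eval_var,
      eval_ofNat, h08, true_and, and_true]
    exact ⟨hkb.le, Nat.pow_lt_pow_right (by norm_num) hkb⟩
  have hspec := find_spec (c := D.key j) hA.inj
  set v := ∑ d ∈ range (A 5 0), (if A 4 d = D.key j then 1 else 0) * d +
    (1 - ∑ d ∈ range (A 5 0), (if A 4 d = D.key j then 1 else 0)) * A 5 0 with hv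
  have hvcase : v < A 5 0 ∧ A 4 v = D.key j ∨ v = A 5 0 ∧ ∀ d < A 5 0, A 4 d ≠ D.key j := by
    rcases hspec with ⟨d₀, hd, hc, e1, e2⟩ | ⟨hne, e1, e2⟩
    · left
      have : v = d₀ := by rw [hv, e1, e2]; simp
      rw [this]
      exact ⟨hd, hc⟩
    · right
      refine ⟨by rw [hv, e1, e2]; simp, hne⟩
  have hvq : v ≤ A 5 0 := by rcases hvcase with h | h <;> omega
  have hsum : ∑ d ∈ range (A 5 0), (if A 4 d = D.key j then 1 else 0) * d ≤ A 5 0 ∧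
      ∑ d ∈ range (A 5 0), (if A 4 d = D.key j then 1 else 0) ≤ 1 := by
    rcases hspec with ⟨d₀, hd, hc, e1, e2⟩ | ⟨hne, e1, e2⟩
    · rw [e1, e2]; omega
    · rw [e1, e2]; omega
  have h25 := h2a 5 (by omega)
  have h24 := h2a 4 (by omega)
  refine Triple.letc (v := v) (n := 6) ?_ ?_ (by omega) ?_
  · simp only [findE, safe_add, safe_mul, safe_sum, safe_arr, safe_var, safe_test, safe_ofNat,
      safe_sub, eval_arr, eval_ofNat, eval_mul, eval_test, eval_var, Function.update_self, hkeys,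
      hkey A₂ rfl rfl, h25, h24, true_and, and_true, implies_true]
    omega
  · simp only [findE, eval_add, eval_mul, eval_sum, eval_sub, eval_arr, eval_ofNat, eval_test,
      eval_var, Function.update_self, hkey A₂ rfl rfl, h25, h24, hv]
  -- The position `v` is at most the number of keys listed before, hence at most the bound for the
  -- dummy steps, even when it is the new one.
  have hkv : D.k + v < b := by have := hb.steps; omega
  have hkeyb : D.key j < 2 ^ b := (key_lt j).trans_le (le_trans
    (Nat.pow_le_pow_right (by norm_num) (Nat.le_add_right _ _)) hb.masks.le)
  refine (Triple.seq (m := 1) (n := 2) (Triple.put (j := v) (v := D.key j) (by simp)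
    (hkeys _ _) (by simp) (hkey A₂ rfl rfl _) hkeyb
    (Triple.seq (m := 1) (n := 1) (Triple.put (j := j) (v := 2 ^ (D.k + v)) (by simp) ?_ ?_ ?_
      (Nat.pow_lt_pow_right (by norm_num) hkv) (Triple.put (j := 0)
      (v := A 5 0 + if v = A 5 0 then 1 else 0) (by simp) (by simp) rfl ?_ ?_ ?_))))).mono
    (by omega) fun _ h => h
  · simp only [safe_pow, safe_ofNat, safe_add, safe_var, eval_add, eval_var, h08, eval_ofNat,
      Function.update_self, true_and]
    exact ⟨hkv.le, Nat.pow_lt_pow_right (by norm_num) hkv⟩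
  · simp [h7]
  · simp [hρ.k]
  · simp [h25]
  · split_ifs <;> omega
  · refine hA.succ_of_mem (v := v) ?_ ?_ ?_ ?_ ?_ ?_ hj3 hvcase
    all_goals simp [h20, h21, h22, h2a 3 (by omega), h24]

end Layout

end WSP

/-! ### Rows for single users, and merging of rows -/

namespace WSP

open Finset RAM RAM.Exp

variable {b : ℕ} {A : ℕ → ℕ → ℕ} {ρ : ℕ → ℕ}

/-- Cells of the table are addressed by row and mask. Recovering both from the address allows
invariants to be stated for arbitrary cells. -/
theorem eq_mul_add_iff {P r F c : ℕ} (hF : F < P) : c = r * P + F ↔ c / P = r ∧ c % P = F := by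
  constructor
  · rintro rfl
    rw [mul_comm, Nat.mul_add_div (by omega), Nat.div_eq_of_lt hF, Nat.mul_add_mod,
      Nat.mod_eq_of_lt hF]
    simp
  · rintro ⟨rfl, rfl⟩
    rw [mul_comm, Nat.div_add_mod]

theorem mul_add_div_eq {P r F : ℕ} (hF : F < P) : (r * P + F) / P = r :=
  ((eq_mul_add_iff hF).1 rfl).1

theorem mul_add_mod_eq {P r F : ℕ} (hF : F < P) : (r * P + F) % P = F :=
  ((eq_mul_add_iff hF).1 rfl).2

/-- Assigning the values `f F` to the cells of a row of array `6`. -/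
theorem triple_fill {x P r : ℕ} {e : Exp} {f : ℕ → ℕ} (hx : x < 14) (h8 : ρ 8 = P)
    (hr : ρ x = r) (hP0 : 0 < P) (hP : P < 2 ^ b) (he : ∀ F < P, ∀ A', (∀ a ∉ [6], A' a = A a) →
      e.Safe b A' (Function.update ρ 14 F) ∧ e.eval A' (Function.update ρ 14 F) = f F)
    (hf : ∀ F < P, f F < 2 ^ b) :
    Triple b (.loop 14 (var 8) (.put 6 (var x * var 8 + var 14) e)) ρ A (2 * P + 1) fun A' =>
      A' 6 = (fun c => if c / P = r then f (c % P) else A 6 c) ∧ ∀ a ∉ [6], A' a = A a := by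
  refine (Triple.loop (M := P) (fun _ => 1) (fun F A' => A' 6 = fun c =>
    if c / P = r ∧ c % P < F then f (c % P) else A 6 c) (by simp) (by simp [h8]) hP (by simp)
    ?_).mono (by simp; omega) ?_
  · intro F hF A' hA' hfr
    obtain ⟨hs, hv⟩ := he F hF A' hfr
    refine Triple.put (j := r * P + F) (v := f F) (by simp) hs ?_ hv (hf F hF) ?_
    · simp only [eval_add, eval_mul, eval_var, Function.update_self]
      rw [Function.update_of_ne (by omega), Function.update_of_ne (by omega), h8, hr]
    · rw [Function.update_self, hA']
      funext c
      simp only [Function.update_apply, eq_mul_add_iff hF]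
      by_cases h1 : c / P = r <;> by_cases h2 : c % P = F
      · simp [h1, h2]
      · have : c % P < F ↔ c % P < F + 1 := by omega
        simp [h1, h2, this]
      · simp [h1]
      · simp [h1]
  · rintro A' ⟨h6, hfr⟩
    refine ⟨?_, hfr⟩
    rw [h6]
    funext c
    simp [Nat.mod_lt c hP0]

namespace Layout

variable {D : Layout}

/-- The steps, the dummy steps and the conditions of the constraints. -/
def layered (D : Layout) (K : ℕ) (an : ℕ → Finset ℕ) : Layered where
  n := D.n
  K := K
  m := D.m
  au s u := s < D.k → D.auth s u = 1
  blk := D.block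
  lv := D.level
  ok j X := if D.kind j = 0 then
      (X ∩ an j).Nonempty → (X ∩ D.S₁ j).Nonempty ∧ (X ∩ D.S₂ j).Nonempty
    else (D.S₁ j).Nonempty ∧ (D.S₂ j).Nonempty ∧ ¬ (D.S₁ j ⊆ X ∧ D.S₂ j ⊆ X)

/-- A row of the table. -/
def row (K : ℕ) (A : ℕ → ℕ → ℕ) (r F : ℕ) : ℕ := A 6 (r * 2 ^ K + F)

/-- The entry for a single user. -/
def userEntry (D : Layout) (K u F : ℕ) : ℕ :=
  if ∑ s ∈ range D.k, F / 2 ^ s % 2 * (1 - D.auth s u) ≠ 0 then 0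
  else 1 + ∑ s ∈ range K, D.n ^ s * (F / 2 ^ s % 2 * u)

theorem sum_code {K u : ℕ} {X : Finset ℕ} (n : ℕ) (hX : X ⊆ range K) :
    ∑ s ∈ range K, n ^ s * (mask X / 2 ^ s % 2 * u) = code n X fun _ => u := by
  simp only [bit_mask, ite_mul, one_mul, zero_mul, mul_ite, mul_zero]
  rw [← sum_filter, filter_mem_eq_inter, inter_eq_right.2 hX, code]

/-- The first sum in `userEntry` counts the proper steps in the set for which `u` lacks
authorization. It leaves out the dummy steps, which are open to every user. -/
theorem represents_userEntry {K u : ℕ} (an : ℕ → Finset ℕ) (hD : D.Valid) (hu : u < D.n)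
    {R : ℕ → ℕ} (hR : ∀ F < 2 ^ K, R F = D.userEntry K u F) :
    (D.layered K an).Represents 0 {u} R := by
  have key : ∀ X, ∑ s ∈ range D.k, mask X / 2 ^ s % 2 * (1 - D.auth s u) = 0 ↔
      ∀ s ∈ X, s < D.k → D.auth s u = 1 := by
    intro X
    rw [sum_eq_zero_iff]
    simp only [mem_range, bit_mask]
    constructor
    · intro h s hs hk
      have := h s hk
      rw [if_pos hs, one_mul] at this
      have := hD.auth_le s hk u hu
      omega
    · intro h s hk
      split_ifs with hs
      · rw [h s hs hk, Nat.sub_self, mul_zero]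
      · rw [zero_mul]
  refine Layered.represents_singleton (fun X hX h0 => ?_) fun X hX h => ?_
  · rw [hR _ (mask_lt hX), userEntry] at h0
    by_contra hne
    exact h0 (if_pos fun h => hne ((key X).1 h))
  · rw [hR _ (mask_lt hX), userEntry, if_neg (not_not.2 ((key X).2 h)), sum_code (K := K) _ hX, add_comm]
    rfl

theorem userEntry_lt {K u F : ℕ} (hu : u < D.n) (hb : D.n ^ K < 2 ^ b) :
    ∑ s ∈ range K, D.n ^ s * (F / 2 ^ s % 2 * u) < D.n ^ K ∧
    1 + ∑ s ∈ range K, D.n ^ s * (F / 2 ^ s % 2 * u) < 2 ^ b := by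
  have : ∑ s ∈ range K, D.n ^ s * (F / 2 ^ s % 2 * u) < D.n ^ K := by
    refine sum_digits_lt fun i _ => ?_
    have := Nat.mod_lt (F / 2 ^ i) (by norm_num : 0 < 2)
    calc F / 2 ^ i % 2 * u ≤ 1 * u := Nat.mul_le_mul_right _ (by omega)
      _ < D.n := by omega
  omega

theorem triple_usersCmd {K : ℕ} (hD : D.Valid) (hb : D.Fits b) (hK : D.k ≤ K)
    (hKb : K ≤ D.k + D.dummies) (hρ : D.EnvK K ρ) (h0 : A 0 = D.inp) (h6 : ∀ c, A 6 c = 0) :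
    Triple b usersCmd ρ A (D.n * (3 * 2 ^ K + 2) + 1) fun A' =>
      ((∀ u < D.n, ∀ F < 2 ^ K, row K A' u F = D.userEntry K u F) ∧
        ∀ c, D.n ≤ c / 2 ^ K → A' 6 c = 0) ∧ ∀ a ∉ [6], A' a = A a := by
  have hbK : K < b := by have := hb.steps; omega
  have h2K : 2 ^ K < 2 ^ b := Nat.pow_lt_pow_right (by norm_num) hbK
  have hnK : D.n ^ K < 2 ^ b := (Nat.pow_le_pow_right hD.n_pos hKb).trans_lt hb.plans
  have hbb : b < 2 ^ b := Nat.lt_two_pow_self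
  refine (Triple.loop (M := D.n) (fun _ => 3 * 2 ^ K + 1) (fun u A' => ∀ c, A' 6 c =
    if c / 2 ^ K < u then D.userEntry K (c / 2 ^ K) (c % 2 ^ K) else 0) (by simp)
    (by simp [hρ.n]) hb.users (by simp [h6]) ?_).mono (by simp) ?_
  · intro u hu A' hA' hfr
    have hρ' := hρ.update (x := 10) le_rfl u
    -- Cells are completed in the lexicographic order of row and mask, and those to come are still
    -- zero.
    refine (Triple.loop (M := 2 ^ K) (fun _ => 2) (fun F A' => ∀ c, A' 6 c =
      if c / 2 ^ K < u ∨ c / 2 ^ K = u ∧ c % 2 ^ K < F then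
        D.userEntry K (c / 2 ^ K) (c % 2 ^ K) else 0) (by simp)
      (by simp [hρ.two]) h2K (by simpa using hA') ?_).mono (by simp; omega) ?_
    · intro F hF A'' hA'' hfr'
      have hρ'' := hρ'.update (x := 11) (by omega) F
      have hinp : A'' 0 = D.inp := by
        rw [hfr' 0 (by decide), hfr 0 (by decide), h0]
      have hind : ∀ c, (if c / 2 ^ K < u ∨ c / 2 ^ K = u ∧ c % 2 ^ K < F + 1 then
          D.userEntry K (c / 2 ^ K) (c % 2 ^ K) else 0) = if c = u * 2 ^ K + F then
          D.userEntry K u F else if c / 2 ^ K < u ∨ c / 2 ^ K = u ∧ c % 2 ^ K < F then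
          D.userEntry K (c / 2 ^ K) (c % 2 ^ K) else 0 := by
        intro c
        simp only [eq_mul_add_iff hF]
        by_cases h1 : c / 2 ^ K = u <;> by_cases h2 : c % 2 ^ K = F
        · simp [h1, h2]
        · have : c % 2 ^ K < F ↔ c % 2 ^ K < F + 1 := by omega
          simp [h1, h2, this]
        · simp [h1]
        · simp [h1]
      have hev : (sum 12 (var 0) (digit (var 11) (var 12) *
          (1 - arr 0 (var 4 + var 12 * var 1 + var 10)))).eval A''
          (Function.update (Function.update ρ 10 u) 11 F) =
          ∑ s ∈ range D.k, F / 2 ^ s % 2 * (1 - D.auth s u) := by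
        simp [hρ.k, hρ.n, hρ.auth, hinp, auth]
      have hle : ∑ s ∈ range D.k, F / 2 ^ s % 2 * (1 - D.auth s u) ≤ D.k := by
        calc _ ≤ ∑ s ∈ range D.k, 1 := sum_le_sum fun s _ => by
              have := Nat.mod_lt (F / 2 ^ s) (by norm_num : 0 < 2)
              calc F / 2 ^ s % 2 * (1 - D.auth s u) ≤ 1 * 1 :=
                    Nat.mul_le_mul (by omega) (by omega)
                _ = 1 := rfl
          _ = D.k := by simp
      have hsafe : (sum 12 (var 0) (digit (var 11) (var 12) *
          (1 - arr 0 (var 4 + var 12 * var 1 + var 10)))).Safe b A''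
          (Function.update (Function.update ρ 10 u) 11 F) := by
        refine (safe_sum _ _ _).2 ⟨by simp, by simp [hρ.k]; omega, fun s hs => ?_, ?_⟩
        · simp only [eval_var, hρ''.k] at hs
          simp [safe_digit]
          omega
        · rw [← eval_sum, hev]
          omega
      by_cases hz : ∑ s ∈ range D.k, F / 2 ^ s % 2 * (1 - D.auth s u) = 0
      · obtain ⟨hlt1, hlt2⟩ := userEntry_lt (K := K) (F := F) hu hnK
        refine Triple.ite_false hsafe (by rw [hev, hz]) (Triple.put (j := u * 2 ^ K + F)
          (v := D.userEntry K u F) (by simp) ?_ (by simp [hρ.two]) ?_ ?_ ?_)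
        · simp only [safe_add, safe_ofNat, safe_sum, safe_var, true_and, safe_mul, safe_pow,
            safe_digit, eval_var, eval_mul, eval_pow, eval_digit, Function.update_self, hρ''.steps]
          refine ⟨hbK.le, fun s hs => ?_, ?_⟩
          · refine ⟨⟨by omega, ?_⟩, ?_⟩
            · simp only [ne_eq, OfNat.one_ne_ofNat, not_false_eq_true, Function.update_of_ne,
                hρ.n]
              exact (Nat.pow_le_pow_right hD.n_pos (by omega)).trans_lt hnK
            · exact ⟨by omega, trivial⟩
          · simp [hρ.n]
            omega
        · simp [hρ.steps, hρ.n, userEntry, hz]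
        · rw [userEntry, if_neg (not_not.2 hz)]
          exact hlt2
        · intro c
          rw [hind c, Function.update_self, Function.update_apply, hA'']
      · refine (Triple.ite_true hsafe (by rw [hev]; exact hz) (Triple.skip ?_)).mono (by omega)
          fun _ h => h
        intro c
        rw [hind c, hA'']
        by_cases hc : c = u * 2 ^ K + F
        -- Nothing is written for a set that `u` may not perform: the cell is still zero, which is
        -- its correct entry.
        · rw [if_pos hc]
          have h1 := (eq_mul_add_iff hF).1 hc
          rw [if_neg (by omega), userEntry, if_pos hz]
        · rw [if_neg hc]
    · rintro A'' ⟨h, -⟩ c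
      rw [h c]
      have := Nat.mod_lt c (by positivity : 0 < 2 ^ K)
      have : (c / 2 ^ K < u ∨ c / 2 ^ K = u ∧ c % 2 ^ K < 2 ^ K) ↔ c / 2 ^ K < u + 1 := by omega
      simp only [this]
  · rintro A' ⟨h, hfr⟩
    refine ⟨⟨fun u hu F hF => ?_, fun c hc => ?_⟩, hfr⟩
    · rw [row, h, mul_add_div_eq hF, mul_add_mod_eq hF, if_pos hu]
    · rw [h, if_neg (by omega)]

end Layout

end WSP

/-! ### Merging rows -/

namespace WSP

open Finset RAM RAM.Exp

variable {b : ℕ} {A : ℕ → ℕ → ℕ} {ρ : ℕ → ℕ}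

/-- Positions of the ternary digit `c` of `t`. -/
def ternarySet (K t c : ℕ) : Finset ℕ := (range K).filter fun s => t / 3 ^ s % 3 = c

theorem ternarySet_subset (K t c : ℕ) : ternarySet K t c ⊆ range K := filter_subset _ _

theorem disjoint_ternarySet (K t : ℕ) : Disjoint (ternarySet K t 1) (ternarySet K t 2) :=
  disjoint_filter.2 fun s _ h => by omega

/-- The digit is `1` on the first set, `2` on the second one and `0` elsewhere. In this way one loop
of length `3 ^ K` runs through all ordered pairs of disjoint sets. -/
theorem exists_ternarySet_eq {K : ℕ} {X₁ X₂ : Finset ℕ} (h₁ : X₁ ⊆ range K) (h₂ : X₂ ⊆ range K)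
    (hd : Disjoint X₁ X₂) : ∃ t < 3 ^ K, ternarySet K t 1 = X₁ ∧ ternarySet K t 2 = X₂ := by
  have hf : ∀ i < K, (fun s => if s ∈ X₁ then 1 else if s ∈ X₂ then 2 else 0) i < 3 := by
    intro i _
    dsimp only
    split_ifs <;> omega
  refine ⟨_, sum_digits_lt hf, ?_, ?_⟩
  · ext s
    simp only [ternarySet, mem_filter, mem_range]
    constructor
    · rintro ⟨hs, h⟩
      rw [digit_sum hf hs] at h
      by_contra hne
      rw [if_neg hne] at h
      split_ifs at h; omega
    · intro hs
      have hsK := mem_range.1 (h₁ hs)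
      exact ⟨hsK, by rw [digit_sum hf hsK, if_pos hs]⟩
  · ext s
    simp only [ternarySet, mem_filter, mem_range]
    constructor
    · rintro ⟨hs, h⟩
      rw [digit_sum hf hs] at h
      by_contra hne
      rw [if_neg hne] at h
      split_ifs at h; omega
    · intro hs
      have hsK := mem_range.1 (h₂ hs)
      exact ⟨hsK, by rw [digit_sum hf hsK, if_neg (disjoint_right.1 hd hs), if_pos hs]⟩

theorem mask_ternarySet (K t c : ℕ) :
    ∑ s ∈ range K, 2 ^ s * (if t / 3 ^ s % 3 = c then 1 else 0) = mask (ternarySet K t c) := by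
  rw [mask, ternarySet, sum_filter]
  exact sum_congr rfl fun s _ => by split_ifs <;> simp

namespace Layout

variable {D : Layout}

theorem eval_ternaryE {K d t c : ℕ} (hρ : D.EnvK K ρ) (hd : 15 ≤ d) (h14 : ρ 14 = t) :
    (ternaryE d c).eval A ρ = mask (ternarySet K t c) := by
  rw [← mask_ternarySet]
  have : ∀ i, Function.update ρ d i 14 = t := fun i => by
    rw [Function.update_of_ne (by omega), h14]
  simp [ternaryE, hρ.steps, this]

theorem safe_ternaryE {K d t c : ℕ} (hb : D.Fits b) (hKb : K ≤ D.k + D.dummies)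
    (hρ : D.EnvK K ρ) (hd : 15 ≤ d) (h14 : ρ 14 = t) : (ternaryE d c).Safe b A ρ := by
  have hbK : K < b := by have := hb.steps; omega
  refine (safe_sum _ _ _).2 ⟨by simp, by simp [hρ.steps]; omega, fun s hs => ?_, ?_⟩
  · simp only [eval_var, hρ.steps] at hs
    simp only [safe_mul, safe_pow, safe_ofNat, safe_var, safe_test, safe_mod, safe_div, safe_lit,
      eval_var, eval_ofNat, Function.update_self, true_and, and_true]
    have h3 : 3 ^ s < 2 ^ b := by
      calc 3 ^ s ≤ 4 ^ s := Nat.pow_le_pow_left (by norm_num) _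
        _ ≤ 4 ^ (D.k + D.dummies) := Nat.pow_le_pow_right (by norm_num) (by omega)
        _ < 2 ^ b := hb.masks
    exact ⟨⟨by omega, Nat.pow_lt_pow_right (by norm_num) (by omega)⟩, by omega, h3⟩
  · rw [← eval_sum]
    have := eval_ternaryE (A := A) (c := c) hρ hd h14
    rw [ternaryE] at this
    rw [this]
    exact (mask_lt (ternarySet_subset K t c)).trans (Nat.pow_lt_pow_right (by norm_num) hbK)

/-- The row `R` results from merging `R₁` and `R₂`. -/
structure IsMerge (K : ℕ) (R₁ R₂ R : ℕ → ℕ) : Prop where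
  exists_eq : ∀ X ⊆ range K, R (mask X) ≠ 0 → ∃ X₁ X₂, Disjoint X₁ X₂ ∧ X₁ ∪ X₂ = X ∧
    R₁ (mask X₁) ≠ 0 ∧ R₂ (mask X₂) ≠ 0 ∧ R (mask X) = R₁ (mask X₁) + R₂ (mask X₂) - 1
  ne_zero : ∀ X₁ ⊆ range K, ∀ X₂ ⊆ range K, Disjoint X₁ X₂ → R₁ (mask X₁) ≠ 0 →
    R₂ (mask X₂) ≠ 0 → R (mask (X₁ ∪ X₂)) ≠ 0

/-- The result is collected in array `7`, because both rows are read until the end of the combining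
loop. Emptying the source row afterwards makes it harmless to merge the same block once more. -/
theorem triple_mergeCmd {K src dst : ℕ} (hb : D.Fits b) (hKb : K ≤ D.k + D.dummies)
    (hρ : D.EnvK K ρ) (h12 : ρ 12 = src) (h13 : ρ 13 = dst) (hne : src ≠ dst)
    (hbound : ∀ X₁ ⊆ range K, ∀ X₂ ⊆ range K, Disjoint X₁ X₂ → row K A dst (mask X₁) ≠ 0 →
      row K A src (mask X₂) ≠ 0 → row K A dst (mask X₁) + row K A src (mask X₂) - 1 < 2 ^ b) :
    Triple b mergeCmd ρ A (5 * 3 ^ K + 6 * 2 ^ K + 4) fun A' =>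
      ((∀ c, c / 2 ^ K ≠ src → c / 2 ^ K ≠ dst → A' 6 c = A 6 c) ∧
        (∀ F < 2 ^ K, row K A' src F = if F = 0 then 1 else 0) ∧
        IsMerge K (row K A dst) (row K A src) (row K A' dst)) ∧ ∀ a ∉ [6, 7], A' a = A a := by
  have hbK : K < b := by have := hb.steps; omega
  have h2K : 2 ^ K < 2 ^ b := Nat.pow_lt_pow_right (by norm_num) hbK
  have h3K : 3 ^ K < 2 ^ b := by
    calc 3 ^ K ≤ 4 ^ K := Nat.pow_le_pow_left (by norm_num) _
      _ ≤ 4 ^ (D.k + D.dummies) := Nat.pow_le_pow_right (by norm_num) (by omega)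
      _ < 2 ^ b := hb.masks
  have h2pos : 0 < 2 ^ K := by positivity
  -- clearing the auxiliary row
  have step₁ : Triple b (.loop 14 (var 8) (.put 7 (var 14) 0)) ρ A (2 * 2 ^ K + 1) fun A' =>
      (∀ F < 2 ^ K, A' 7 F = 0) ∧ ∀ a ∉ [7], A' a = A a := by
    refine (Triple.loop (M := 2 ^ K) (fun _ => 1) (fun F A' => ∀ c < F, A' 7 c = 0) (by simp)
      (by simp [hρ.two]) h2K (by simp) ?_).mono (by simp; omega) fun _ h => h
    intro F _ A' hA' _
    refine Triple.put (j := F) (v := 0) (by simp) (by simp) (by simp) (by simp) (by positivity) ?_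
    intro c hc
    rw [Function.update_self, Function.update_apply]
    split_ifs with h
    · rfl
    · exact hA' c (by omega)
  -- combining disjoint sets
  have step₂ : ∀ A₁, (∀ F < 2 ^ K, A₁ 7 F = 0) → (∀ a ∉ [7], A₁ a = A a) →
      Triple b (.loop 14 (var 9) (.letc 15 (ternaryE 15 1) (.letc 16 (ternaryE 16 2)
        (.ite (arr 6 (var 13 * var 8 + var 15) * arr 6 (var 12 * var 8 + var 16))
          (.put 7 (var 15 + var 16)
            (arr 6 (var 13 * var 8 + var 15) + arr 6 (var 12 * var 8 + var 16) - 1))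
          .skip)))) ρ A₁ (5 * 3 ^ K + 1) fun A' =>
        IsMerge K (row K A dst) (row K A src) (A' 7) ∧ (∀ F < 2 ^ K, A' 7 F < 2 ^ b) ∧
          ∀ a ∉ [7], A' a = A a := by
    intro A₁ h7 hfr₁
    -- Different splittings of the same set may overwrite each other's entries. Hence the invariant
    -- only says that each nonzero entry stems from some splitting, and that the splittings seen so
    -- far have left a nonzero entry.
    refine (Triple.loop (M := 3 ^ K) (fun _ => 4) (fun t A' =>
      (∀ X ⊆ range K, A' 7 (mask X) ≠ 0 → ∃ X₁ X₂, Disjoint X₁ X₂ ∧ X₁ ∪ X₂ = X ∧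
        row K A dst (mask X₁) ≠ 0 ∧ row K A src (mask X₂) ≠ 0 ∧
        A' 7 (mask X) = row K A dst (mask X₁) + row K A src (mask X₂) - 1) ∧
      ∀ t' < t, row K A dst (mask (ternarySet K t' 1)) ≠ 0 →
        row K A src (mask (ternarySet K t' 2)) ≠ 0 →
        A' 7 (mask (ternarySet K t' 1 ∪ ternarySet K t' 2)) ≠ 0) (by simp)
      (by simp [hρ.three]) h3K ⟨fun X hX h => absurd (h7 _ (mask_lt hX)) h, by simp⟩ ?_).mono
      (by simp; omega) ?_
    · rintro t ht A' ⟨hA'1, hA'2⟩ hfr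
      have hA'6 : A' 6 = A 6 := (hfr 6 (by decide)).trans (hfr₁ 6 (by decide))
      set X₁ := ternarySet K t 1 with hX₁
      set X₂ := ternarySet K t 2 with hX₂
      have s1 := ternarySet_subset K t 1
      have s2 := ternarySet_subset K t 2
      have hd := disjoint_ternarySet K t
      rw [← hX₁] at s1 hd
      rw [← hX₂] at s2 hd
      have hr := hρ.update (x := 14) (by omega) t
      have hr' := hr.update (x := 15) (by omega) (mask X₁)
      have l1 := (mask_lt s1).trans h2K
      have l2 := (mask_lt s2).trans h2K
      have l3 := (mask_lt (union_subset s1 s2)).trans h2K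
      refine (Triple.letc (v := mask X₁) (n := 3) (safe_ternaryE (t := t) hb hKb hr (by omega)
        (by simp)) (eval_ternaryE hr (by omega) (by simp)) l1
        (Triple.letc (v := mask X₂) (n := 2) (safe_ternaryE (t := t) hb hKb hr' (by omega)
        (by simp)) (eval_ternaryE hr' (by omega) (by simp)) l2 ?_))
      have hev1 : (arr 6 (var 13 * var 8 + var 15)).eval A' (Function.update (Function.update
          (Function.update ρ 14 t) 15 (mask X₁)) 16 (mask X₂)) = row K A dst (mask X₁) := by
        simp [hA'6, h13, hρ.two, row]
      have hev2 : (arr 6 (var 12 * var 8 + var 16)).eval A' (Function.update (Function.update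
          (Function.update ρ 14 t) 15 (mask X₁)) 16 (mask X₂)) = row K A src (mask X₂) := by
        simp [hA'6, h12, hρ.two, row]
      by_cases hz : row K A dst (mask X₁) * row K A src (mask X₂) = 0
      · refine Triple.ite_false (by simp) (by rw [eval_mul, hev1, hev2, hz]) (Triple.skip ?_)
        refine ⟨hA'1, fun t' ht' n1 n2 => ?_⟩
        rcases Nat.lt_succ_iff_lt_or_eq.1 ht' with h | rfl
        · exact hA'2 t' h n1 n2
        · exact absurd hz (mul_ne_zero n1 n2)
      · have hz' : row K A dst (mask X₁) ≠ 0 ∧ row K A src (mask X₂) ≠ 0 :=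
          ⟨left_ne_zero_of_mul hz, right_ne_zero_of_mul hz⟩
        refine Triple.ite_true (by simp) (by rw [eval_mul, hev1, hev2]; exact hz)
          (Triple.put (j := mask (X₁ ∪ X₂)) (v := row K A dst (mask X₁) + row K A src (mask X₂) - 1)
            (by simp) (by simp) (by simp [mask_union hd])
            (by rw [eval_sub, eval_add, hev1, hev2, eval_ofNat])
            (hbound X₁ s1 X₂ s2 hd hz'.1 hz'.2) ?_)
        rw [Function.update_self]
        constructor
        · intro X hX h0
          rw [Function.update_apply] at h0 ⊢
          split_ifs at h0 ⊢ with hXX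
          · exact ⟨X₁, X₂, hd, mask_injective hXX.symm, hz'.1, hz'.2, rfl⟩
          · exact hA'1 X hX h0
        · intro t' ht' n1 n2
          rw [Function.update_apply]
          split_ifs with h
          · omega
          · rcases Nat.lt_succ_iff_lt_or_eq.1 ht' with h' | rfl
            · exact hA'2 t' h' n1 n2
            · exact absurd rfl h
    · rintro A' ⟨⟨h1, h2⟩, hfr⟩
      refine ⟨⟨h1, ?_⟩, ?_, ?_⟩
      · intro X₁ hX₁ X₂ hX₂ hd n1 n2
        obtain ⟨t, ht, rfl, rfl⟩ := exists_ternarySet_eq hX₁ hX₂ hd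
        exact h2 t ht n1 n2
      · intro F hF
        obtain ⟨X, hX, rfl⟩ := exists_mask_eq hF
        by_cases h0 : A' 7 (mask X) = 0
        · rw [h0]; positivity
        · obtain ⟨X₁, X₂, hd, rfl, n1, n2, he⟩ := h1 X hX h0
          rw [he]
          exact hbound X₁ (subset_union_left.trans hX) X₂ (subset_union_right.trans hX) hd n1 n2
      · intro a ha
        exact (hfr a (by simpa [Cmd.writes] using ha)).trans (hfr₁ a ha)
  refine (Triple.seq (m := 2 * 2 ^ K + 1) (n := 5 * 3 ^ K + 1 + (2 * 2 ^ K + 1 + (2 * 2 ^ K + 1)))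
    (step₁.mono le_rfl ?_)).mono (by omega) fun _ h => h
  rintro A₁ ⟨h7, hfr₁⟩
  refine Triple.seq ((step₂ A₁ h7 hfr₁).mono le_rfl ?_)
  rintro A₂ ⟨hm, hlt, hfr₂⟩
  refine Triple.seq ((triple_fill (f := A₂ 7) (P := 2 ^ K) (r := dst) (by omega) hρ.two h13 h2pos
    h2K ?_ hlt).mono le_rfl ?_)
  · intro F _ A' hA'
    exact ⟨by simp, by simp [hA' 7 (by decide)]⟩
  rintro A₃ ⟨h6₃, hfr₃⟩
  refine (triple_fill (f := fun F => if F = 0 then 1 else 0) (P := 2 ^ K) (r := src) (by omega)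
    hρ.two h12 h2pos h2K ?_ ?_).mono le_rfl ?_
  · intro F _ A' _
    exact ⟨by simp, by simp⟩
  · intro F _
    split_ifs <;> omega
  rintro A₄ ⟨h6₄, hfr₄⟩
  refine ⟨⟨?_, ?_, ?_⟩, ?_⟩
  · intro c hc1 hc2
    rw [h6₄, h6₃]
    simp only [hc1, hc2, if_false]
    rw [hfr₂ 6 (by decide)]
  · intro F hF
    simp only [row, h6₄, mul_add_div_eq hF, mul_add_mod_eq hF, if_true]
  · have : ∀ X ⊆ range K, row K A₄ dst (mask X) = A₂ 7 (mask X) := by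
      intro X hX
      have hF := mask_lt hX
      simp only [row, h6₄, h6₃, mul_add_div_eq hF, mul_add_mod_eq hF, hne.symm, if_false, if_true]
    refine ⟨fun X hX => ?_, fun X₁ hX₁ X₂ hX₂ => ?_⟩
    · rw [this X hX]
      exact hm.1 X hX
    · rw [this _ (union_subset hX₁ hX₂)]
      exact hm.2 X₁ hX₁ X₂ hX₂
  · intro a ha
    simp only [List.mem_cons, List.not_mem_nil, or_false, not_or] at ha
    rw [hfr₄ a (by simp [ha.1]), hfr₃ a (by simp [ha.1]), hfr₂ a (by simp [ha.2])]

end Layout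

end WSP

/-! ### The levels of the hierarchy -/

namespace WSP

open Finset RAM RAM.Exp

variable {b : ℕ} {A : ℕ → ℕ → ℕ} {ρ : ℕ → ℕ}

/-- The sum of the two codes is the code of the plan glued from both, which is less than `n ^ K`.
Bounding the summands separately would lose a factor at each merge. -/
theorem Layered.Represents.add_sub_one_le {I : Layered} {i : ℕ} {Y₁ Y₂ X₁ X₂ : Finset ℕ}
    {R₁ R₂ : ℕ → ℕ} (h₁ : I.Represents i Y₁ R₁) (h₂ : I.Represents i Y₂ R₂) (hn : 0 < I.n)
    (hY₁ : Y₁ ⊆ range I.n) (hY₂ : Y₂ ⊆ range I.n) (hX₁ : X₁ ⊆ range I.K) (hX₂ : X₂ ⊆ range I.K)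
    (hd : Disjoint X₁ X₂) (n₁ : R₁ (mask X₁) ≠ 0) (n₂ : R₂ (mask X₂) ≠ 0) :
    R₁ (mask X₁) + R₂ (mask X₂) - 1 ≤ I.n ^ I.K := by
  obtain ⟨π₁, g₁, e₁⟩ := (h₁ X₁ hX₁).1 n₁
  obtain ⟨π₂, g₂, e₂⟩ := (h₂ X₂ hX₂).1 n₂
  have hlt : code I.n (X₁ ∪ X₂) (fun s => if s ∈ X₁ then π₁ s else π₂ s) < I.n ^ I.K := by
    refine code_lt hn (union_subset hX₁ hX₂) fun s hs => ?_
    split_ifs with h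
    · exact mem_range.1 (hY₁ (g₁.1 s h).1)
    · exact mem_range.1 (hY₂ (g₂.1 s ((mem_union.1 hs).resolve_left h)).1)
  have : code I.n (X₁ ∪ X₂) (fun s => if s ∈ X₁ then π₁ s else π₂ s) =
      code I.n X₁ π₁ + code I.n X₂ π₂ := by
    rw [code, sum_union hd]
    congr 1
    · exact sum_congr rfl fun s hs => by rw [if_pos hs]
    · exact sum_congr rfl fun s hs => by rw [if_neg (disjoint_right.1 hd hs)]
  omega

namespace Layout

variable {D : Layout}

/-- The masks of the constraints have been computed. -/
structure Prepared (D : Layout) (an : ℕ → Finset ℕ) (A : ℕ → ℕ → ℕ) : Prop where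
  inp : A 0 = D.inp
  mask₁ : ∀ j < D.m, A 1 j = mask (D.S₁ j)
  mask₂ : ∀ j < D.m, A 2 j = mask (D.S₂ j)
  anchor : ∀ j < D.m, D.kind j = 0 → A 3 j = mask (an j)

theorem Prepared.of_eq {an : ℕ → Finset ℕ} {A' : ℕ → ℕ → ℕ} (h : D.Prepared an A)
    (h' : ∀ a ∉ [6, 7], A' a = A a) : D.Prepared an A' := by
  have h0 := h' 0 (by decide)
  have h1 := h' 1 (by decide)
  have h2 := h' 2 (by decide)
  have h3 := h' 3 (by decide)
  constructor
  · rw [h0, h.inp]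
  · rw [h1]; exact h.mask₁
  · rw [h2]; exact h.mask₂
  · rw [h3]; exact h.anchor

/-- Inclusion is thus tested with the operation `inter` alone. -/
theorem card_inter_eq_iff {X S : Finset ℕ} : (S ∩ X).card = (S ∩ S).card ↔ S ⊆ X := by
  rw [inter_self]
  constructor
  · intro h
    exact inter_eq_left.1 (eq_of_subset_of_card_le inter_subset_left h.ge)
  · intro h
    rw [inter_eq_left.2 h]

/-- In `okE` sums act as disjunctions, products as conjunctions, and differences from `1` as
negations; the kind, which is `0` or `1`, selects the summand. For the kind `1` the contents of
array `3` are unknown, but they are multiplied by zero. -/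
theorem okE_spec {K j : ℕ} {an : ℕ → Finset ℕ} {X : Finset ℕ} (hD : D.Valid) (hK : D.k ≤ K)
    (hbK : K ≤ b) (hρ : D.EnvK K ρ) (hA : D.Prepared an A) (hj : j < D.m) (h11 : ρ 11 = j)
    (h13 : ρ 13 = mask X) (hX : X ⊆ range K) :
    okE.Safe b A ρ ∧ (okE.eval A ρ ≠ 0 ↔ (D.layered K an).ok j X) := by
  have hs : ∀ F G : Exp, (∀ v, F.Safe b A (Function.update ρ 14 v)) →
      (∀ v, G.Safe b A (Function.update ρ 14 v)) → (inter 14 (var 7) F G).Safe b A ρ :=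
    fun F G hF hG => safe_inter (by simp [hρ.steps]) hbK hF hG (by simp)
  have e13 : (var 13).eval A ρ = mask X := by simp [h13]
  have e1 : (arr 1 (var 11)).eval A ρ = mask (D.S₁ j) := by simp [h11, hA.mask₁ j hj]
  have e2 : (arr 2 (var 11)).eval A ρ = mask (D.S₂ j) := by simp [h11, hA.mask₂ j hj]
  have eK : (var 7).eval A ρ = K := by simp [hρ.steps]
  have s1 : D.S₁ j ⊆ range K := (S₁_subset j).trans (range_mono hK)
  have s2 : D.S₂ j ⊆ range K := (S₂_subset j).trans (range_mono hK)
  have hrec : (arr 0 (recordE (var 11))).eval A ρ = D.kind j := by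
    rw [eval_arr, eval_recordE hρ.toEnv h11, hA.inp]
    rfl
  refine ⟨?_, ?_⟩
  · simp [okE, safe_recordE, hs]
  · have i1 := eval_inter (d := 14) (by decide) (by decide) eK e13 e1 hX
    have i2 := eval_inter (d := 14) (by decide) (by decide) eK e13 e2 hX
    have i3 := eval_inter (d := 14) (by decide) (by decide) eK e1 e13 s1
    have i4 := eval_inter (d := 14) (by decide) (by decide) eK e2 e13 s2
    have i5 := eval_inter (d := 14) (by decide) (by decide) eK e1 e1 s1
    have i6 := eval_inter (d := 14) (by decide) (by decide) eK e2 e2 s2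
    simp only [okE, eval_add, eval_mul, eval_sub, eval_test, hrec, i1, i2, i3, i4, i5, i6,
      eval_ofNat, layered, card_inter_eq_iff, e1, e2]
    rcases Nat.le_one_iff_eq_zero_or_eq_one.1 (hD.kind_le j hj) with h0 | h0
    · have e3 : (arr 3 (var 11)).eval A ρ = mask (an j) := by simp [h11, hA.anchor j hj h0]
      have i7 := eval_inter (d := 14) (by decide) (by decide) eK e13 e3 hX
      simp only [h0, i7, if_true, zero_mul, one_mul, add_zero, nonempty_iff_ne_empty,
        card_eq_zero]
      by_cases c1 : X ∩ an j = ∅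
      · simp [c1]
      · simp [c1]
    · simp only [h0, one_ne_zero, if_false, zero_mul, one_mul, zero_add, nonempty_iff_ne_empty,
        ne_eq, mul_eq_zero, mask_eq_zero, not_or, and_assoc]
      refine and_congr_right fun _ => and_congr_right fun _ => ?_
      by_cases c1 : D.S₁ j ⊆ X <;> by_cases c2 : D.S₂ j ⊆ X <;> simp [c1, c2]

/-- Condition of constraint `j` for the set with mask `F`. -/
def okMask (D : Layout) (K : ℕ) (an : ℕ → Finset ℕ) (j F : ℕ) : Prop :=
  ∃ X ⊆ range K, mask X = F ∧ (D.layered K an).ok j X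

theorem okMask_mask {K j : ℕ} {an : ℕ → Finset ℕ} {X : Finset ℕ} (hX : X ⊆ range K) :
    D.okMask K an j (mask X) ↔ (D.layered K an).ok j X := by
  constructor
  · rintro ⟨X', -, h, h'⟩
    rwa [← mask_injective h]
  · exact fun h => ⟨X, hX, rfl, h⟩

/-- The distinction in the bound matters: at levels other than its own a constraint costs a
constant, so that over all levels it is charged for only one pass through `n` rows. -/
theorem triple_checkCmd {K i j : ℕ} {an : ℕ → Finset ℕ} (hD : D.Valid) (hb : D.Fits b)
    (hK : D.k ≤ K) (hKb : K ≤ D.k + D.dummies) (hρ : D.EnvK K ρ) (h10 : ρ 10 = i) (h11 : ρ 11 = j)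
    (hA : D.Prepared an A) (hj : j < D.m) :
    Triple b checkCmd ρ A (if D.level j = i then D.n * (3 * 2 ^ K + 2) + 2 else 2) fun A' =>
      (∀ c, ((D.level j = i ∧ (i + 1) * D.n ≤ c / 2 ^ K ∧ c / 2 ^ K < (i + 1) * D.n + D.n ∧
          ¬ D.okMask K an j (c % 2 ^ K)) → A' 6 c = 0) ∧
        (¬ (D.level j = i ∧ (i + 1) * D.n ≤ c / 2 ^ K ∧ c / 2 ^ K < (i + 1) * D.n + D.n ∧
          ¬ D.okMask K an j (c % 2 ^ K)) → A' 6 c = A 6 c)) ∧ ∀ a ∉ [6], A' a = A a := by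
  have hbK : K < b := by have := hb.steps; omega
  have h2K : 2 ^ K < 2 ^ b := Nat.pow_lt_pow_right (by norm_num) hbK
  have hsafe : (test (arr 0 (recordE (var 11) + 1)) (var 10)).Safe b A ρ := by
    simp [safe_recordE]
  have heval : (test (arr 0 (recordE (var 11) + 1)) (var 10)).eval A ρ =
      if D.level j = i then 1 else 0 := by
    rw [eval_test, eval_arr, eval_add, eval_recordE hρ.toEnv h11, hA.inp, eval_var, h10]
    rfl
  by_cases hl : D.level j = i
  swap
  · rw [if_neg hl] at heval ⊢
    exact Triple.ite_false hsafe heval (Triple.skip ⟨fun c => by simp [hl], fun _ _ => rfl⟩)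
  rw [if_pos hl] at heval ⊢
  simp only [hl, true_and]
  refine Triple.ite_true hsafe (by rw [heval]; exact one_ne_zero) ?_
  refine (Triple.loop (M := D.n) (fun _ => 3 * 2 ^ K + 1) (fun r A' => ∀ c,
      (((i + 1) * D.n ≤ c / 2 ^ K ∧ c / 2 ^ K < (i + 1) * D.n + r ∧
        ¬ D.okMask K an j (c % 2 ^ K)) → A' 6 c = 0) ∧
      (¬ ((i + 1) * D.n ≤ c / 2 ^ K ∧ c / 2 ^ K < (i + 1) * D.n + r ∧
        ¬ D.okMask K an j (c % 2 ^ K)) → A' 6 c = A 6 c)) (by simp) (by simp [hρ.n]) hb.users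
      ?_ ?_).mono (by simp) fun _ h => h
  · intro c
    exact ⟨fun h => by omega, fun _ => rfl⟩
  intro r _ A₁ hA₁ hfr₁
  have hρ₁ := hρ.update (x := 12) (by omega) r
  refine (Triple.loop (M := 2 ^ K) (fun _ => 2) (fun F A' => ∀ c,
      (((i + 1) * D.n ≤ c / 2 ^ K ∧ (c / 2 ^ K < (i + 1) * D.n + r ∨
          c / 2 ^ K = (i + 1) * D.n + r ∧ c % 2 ^ K < F) ∧
        ¬ D.okMask K an j (c % 2 ^ K)) → A' 6 c = 0) ∧
      (¬ ((i + 1) * D.n ≤ c / 2 ^ K ∧ (c / 2 ^ K < (i + 1) * D.n + r ∨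
          c / 2 ^ K = (i + 1) * D.n + r ∧ c % 2 ^ K < F) ∧
        ¬ D.okMask K an j (c % 2 ^ K)) → A' 6 c = A 6 c)) (by simp) (by simp [hρ.two]) h2K
      (by simpa using hA₁) ?_).mono (by simp; omega) ?_
  · intro F hF A₂ hA₂ hfr₂
    obtain ⟨X, hX, rfl⟩ := exists_mask_eq hF
    have hρ₂ := hρ₁.update (x := 13) (by omega) (mask X)
    have hfr : ∀ a ∉ [6], A₂ a = A a := fun a ha => by
      have ha' : a ≠ 6 := by simpa using ha
      exact (hfr₂ a (by simpa [Cmd.writes] using ha')).trans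
        (hfr₁ a (by simpa [Cmd.writes] using ha'))
    have hP₂ : D.Prepared an A₂ := hA.of_eq fun a ha => hfr a (by
      simp only [List.mem_cons, List.not_mem_nil, or_false, not_or] at ha ⊢
      exact ha.1)
    obtain ⟨hs, he⟩ := okE_spec hD hK hbK.le hρ₂ hP₂ hj (X := X) (by simp [h11]) (by simp) hX
    rw [← okMask_mask hX] at he
    by_cases hok : D.okMask K an j (mask X)
    · refine Triple.ite_true hs (he.2 hok) (Triple.skip ?_)
      intro c
      have hiff : ((i + 1) * D.n ≤ c / 2 ^ K ∧ (c / 2 ^ K < (i + 1) * D.n + r ∨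
          c / 2 ^ K = (i + 1) * D.n + r ∧ c % 2 ^ K < mask X + 1) ∧
          ¬ D.okMask K an j (c % 2 ^ K)) ↔ ((i + 1) * D.n ≤ c / 2 ^ K ∧
          (c / 2 ^ K < (i + 1) * D.n + r ∨
          c / 2 ^ K = (i + 1) * D.n + r ∧ c % 2 ^ K < mask X) ∧
          ¬ D.okMask K an j (c % 2 ^ K)) := by
        by_cases hc : c % 2 ^ K = mask X
        · simp [hc, hok]
        · have : c % 2 ^ K < mask X + 1 ↔ c % 2 ^ K < mask X := by omega
          rw [this]
      rw [hiff]
      exact hA₂ c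
    · refine Triple.ite_false hs (by_contra fun h => hok (he.1 h)) (Triple.put
        (j := ((i + 1) * D.n + r) * 2 ^ K + mask X) (v := 0) (by simp) (by simp)
        (by simp [h10, hρ.n, hρ.two]) (by simp) (by positivity) ?_)
      intro c
      rw [Function.update_self, Function.update_apply]
      simp only [eq_mul_add_iff hF]
      have hrow : (i + 1) * D.n ≤ (i + 1) * D.n + r := Nat.le_add_right _ _
      obtain ⟨g1, g2⟩ := hA₂ c
      by_cases hc : c / 2 ^ K = (i + 1) * D.n + r ∧ c % 2 ^ K = mask X
      · rw [if_pos hc]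
        refine ⟨fun _ => rfl, fun h => absurd ⟨?_, Or.inr ⟨hc.1, ?_⟩, ?_⟩ h⟩
        · rw [hc.1]; exact hrow
        · omega
        · rw [hc.2]; exact hok
      · rw [if_neg hc]
        refine ⟨fun h => g1 ⟨h.1, ?_, h.2.2⟩, fun h => g2 fun h' => h ⟨h'.1, ?_, h'.2.2⟩⟩
        · omega
        · omega
  · rintro A₂ ⟨h, -⟩ c
    have := Nat.mod_lt c (by positivity : 0 < 2 ^ K)
    have hiff : (c / 2 ^ K < (i + 1) * D.n + r ∨ c / 2 ^ K = (i + 1) * D.n + r ∧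
        c % 2 ^ K < 2 ^ K) ↔ c / 2 ^ K < (i + 1) * D.n + (r + 1) := by omega
    have h' := h c
    rw [hiff] at h'
    exact h'

end Layout

end WSP

/-! ### The passage from one level to the next, by running through the users. -/

namespace WSP

open Finset RAM RAM.Exp

variable {b : ℕ} {A : ℕ → ℕ → ℕ} {ρ : ℕ → ℕ}

namespace Layout

variable {D : Layout}

/-- Block number of a user at the level below `i`; below the first level, the user. -/
def prev (D : Layout) (i u : ℕ) : ℕ := if i = 0 then u else D.block (i - 1) u

theorem prev_lt (hD : D.Valid) {i u : ℕ} (hi : i ≤ D.l) (hu : u < D.n) : D.prev i u < D.n := by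
  rw [prev]
  split_ifs with h
  · exact hu
  · exact hD.block_lt _ (by omega) u hu

theorem block_eq_of_prev_eq (hD : D.Valid) {i u v : ℕ} (hi : i < D.l) (hu : u < D.n) (hv : v < D.n)
    (h : D.prev i u = D.prev i v) : D.block i u = D.block i v := by
  rw [prev, prev] at h
  split_ifs at h with h0
  · rw [h]
  · obtain ⟨i, rfl⟩ := Nat.exists_eq_succ_of_ne_zero h0
    exact hD.refines i hi u hu v hv h

theorem block_eq_of_le (hD : D.Valid) {i i' u v : ℕ} (hi : i < D.l) (hii : i' ≤ i) (hu : u < D.n)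
    (hv : v < D.n) (h : D.block i' u = D.block i' v) : D.block i u = D.block i v := by
  induction i, hii using Nat.le_induction with
  | base => exact h
  | succ i hii ih => exact hD.refines i hi u hu v hv (ih (by omega))

theorem prev_eq_of_block_eq (hD : D.Valid) {i i' u v : ℕ} (hi : i ≤ D.l) (hii : i' < i)
    (hu : u < D.n) (hv : v < D.n) (h : D.block i' u = D.block i' v) :
    D.prev i u = D.prev i v := by
  rw [prev, prev, if_neg (by omega), if_neg (by omega)]
  exact block_eq_of_le hD (by omega) (by omega) hu hv h

theorem eval_previousE {i u : ℕ} (hρ : D.Env ρ) (h10 : ρ 10 = i) (h11 : ρ 11 = u)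
    (h0 : A 0 = D.inp) : previousE.eval A ρ = D.prev i u := by
  simp only [previousE, eval_add, eval_mul, eval_test, eval_var, eval_sub, eval_ofNat, eval_arr,
    h10, h11, hρ.block, hρ.n, h0, prev, block]
  split_ifs <;> simp

/-- The users whose block below level `i` contains one of the users `0, …, u - 1`. -/
def Seen (D : Layout) (i u v : ℕ) : Prop := ∃ w < u, D.prev i w = D.prev i v

open Classical in
/-- The block of `v` below level `i`, if it contains none of the users `0, …, u - 1`. -/
noncomputable def pending (D : Layout) (i u v : ℕ) : Finset ℕ :=
  (range D.n).filter fun v' => D.prev i v' = D.prev i v ∧ ¬ D.Seen i u v'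

open Classical in
/-- The part of block `p` of level `i` that consists of the blocks below level `i` with one of the
users `0, …, u - 1`. -/
noncomputable def merged (D : Layout) (i u p : ℕ) : Finset ℕ :=
  (range D.n).filter fun v => D.block i v = p ∧ D.Seen i u v

theorem mem_pending {i u v x : ℕ} :
    x ∈ D.pending i u v ↔ x < D.n ∧ D.prev i x = D.prev i v ∧ ¬ D.Seen i u x := by
  simp [pending]

theorem mem_merged {i u p x : ℕ} :
    x ∈ D.merged i u p ↔ x < D.n ∧ D.block i x = p ∧ D.Seen i u x := by
  simp [merged]

theorem seen_succ {i u v : ℕ} : D.Seen i (u + 1) v ↔ D.Seen i u v ∨ D.prev i u = D.prev i v := by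
  constructor
  · rintro ⟨w, hw, h⟩
    rcases Nat.lt_succ_iff_lt_or_eq.1 hw with h' | rfl
    · exact Or.inl ⟨w, h', h⟩
    · exact Or.inr h
  · rintro (⟨w, hw, h⟩ | h)
    · exact ⟨w, by omega, h⟩
    · exact ⟨u, by omega, h⟩

theorem not_seen_zero {i v : ℕ} : ¬ D.Seen i 0 v := by
  rintro ⟨w, hw, -⟩
  omega

/-- State of the table before the users `u, u + 1, …` are considered at level `i`. -/
structure MergeInv (D : Layout) (K : ℕ) (an : ℕ → Finset ℕ) (i u : ℕ) (A : ℕ → ℕ → ℕ) : Prop where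
  prepared : D.Prepared an A
  pending : ∀ v < D.n, (D.layered K an).Represents i (D.pending i u v)
    (row K A (i * D.n + D.prev i v))
  merged : ∀ p < D.n, (D.layered K an).Represents i (D.merged i u p)
    (row K A ((i + 1) * D.n + p))
  zero : ∀ c, (i + 2) * D.n ≤ c / 2 ^ K → A 6 c = 0

/-- State of the table before level `i`. -/
structure LevelInv (D : Layout) (K : ℕ) (an : ℕ → Finset ℕ) (i : ℕ) (A : ℕ → ℕ → ℕ) : Prop where
  prepared : D.Prepared an A
  represents : ∀ v < D.n, (D.layered K an).Represents i
    ((range D.n).filter fun v' => D.prev i v' = D.prev i v) (row K A (i * D.n + D.prev i v))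
  zero : ∀ c, (i + 1) * D.n ≤ c / 2 ^ K → A 6 c = 0

/-- The loop runs through users, not through blocks, as representatives of the blocks are not given.
The first user of a block below level `i` moves its row to the larger block and leaves the row for
no users behind. For the other users of that block `pending` is empty, and merging changes neither
of the represented sets. -/
theorem triple_mergeUser {K i u : ℕ} {an : ℕ → Finset ℕ} (hD : D.Valid) (hb : D.Fits b)
    (hKb : K ≤ D.k + D.dummies) (hρ : D.EnvK K ρ) (h10 : ρ 10 = i)
    (h11 : ρ 11 = u) (hi : i < D.l) (hu : u < D.n) (hA : D.MergeInv K an i u A) :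
    Triple b (.letc 12 (var 10 * var 1 + previousE)
      (.letc 13 ((var 10 + 1) * var 1 + arr 0 (var 5 + var 10 * var 1 + var 11)) mergeCmd)) ρ A
      (5 * 3 ^ K + 6 * 2 ^ K + 6) (D.MergeInv K an i (u + 1)) := by
  have hp := prev_lt hD hi.le hu
  have hq := hD.block_lt i hi u hu
  have hrow : (i + 2) * D.n < 2 ^ b :=
    (Nat.mul_le_mul_right _ (by omega : i + 2 ≤ D.l + 1)).trans_lt hb.rows
  have e1 : (i + 1) * D.n = i * D.n + D.n := by ring
  have e2 : (i + 2) * D.n = i * D.n + D.n + D.n := by ring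
  have hnK : D.n ^ K < 2 ^ b := (Nat.pow_le_pow_right hD.n_pos hKb).trans_lt hb.plans
  have hpend : D.pending i u u ⊆ range D.n := fun x hx => mem_range.2 (mem_pending.1 hx).1
  have hmerg : D.merged i u (D.block i u) ⊆ range D.n := fun x hx =>
    mem_range.2 (mem_merged.1 hx).1
  refine Triple.letc (n := 5 * 3 ^ K + 6 * 2 ^ K + 5) (v := i * D.n + D.prev i u) ?_ ?_ (by omega)
    (Triple.letc (v := (i + 1) * D.n + D.block i u) ?_ ?_ (by omega) ?_)
  · simp [previousE]
  · simp only [eval_add, eval_mul, eval_var, eval_previousE hρ.toEnv h10 h11 hA.prepared.inp, h10,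
      hρ.n]
  · simp
  · simp only [eval_add, eval_mul, eval_var, eval_arr, eval_ofNat, hA.prepared.inp,
      Function.update_of_ne (show (10 : ℕ) ≠ 12 by decide),
      Function.update_of_ne (show (11 : ℕ) ≠ 12 by decide),
      Function.update_of_ne (show (5 : ℕ) ≠ 12 by decide),
      Function.update_of_ne (show (1 : ℕ) ≠ 12 by decide), h10, h11, hρ.n, hρ.block]
    rfl
  have hsrc := hA.pending u hu
  have hdst := hA.merged _ hq
  refine (triple_mergeCmd (src := i * D.n + D.prev i u) (dst := (i + 1) * D.n + D.block i u) hb hKb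
    ((hρ.update (by omega) _).update (by omega) _) (by simp) (by simp) (by omega) ?_).mono
    (by omega) ?_
  · intro X₁ hX₁ X₂ hX₂ hd n1 n2
    exact (hdst.add_sub_one_le hsrc hD.n_pos hmerg hpend hX₁ hX₂ hd n1 n2).trans_lt hnK
  rintro A' ⟨⟨hother, hempty, hmerge⟩, hfr⟩
  have hrest : ∀ r, r ≠ i * D.n + D.prev i u → r ≠ (i + 1) * D.n + D.block i u →
      ∀ X ⊆ range (D.layered K an).K, row K A' r (mask X) = row K A r (mask X) := by
    intro r h1 h2 X hX
    have hF := mask_lt hX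
    have hK : (D.layered K an).K = K := rfl
    rw [hK] at hF
    exact hother _ (by rwa [mul_add_div_eq hF]) (by rwa [mul_add_div_eq hF])
  refine ⟨hA.prepared.of_eq hfr, fun v hv => ?_, fun p hp' => ?_, fun c hc => ?_⟩
  · have hpv := prev_lt hD hi.le hv
    by_cases hvu : D.prev i v = D.prev i u
    · have : D.pending i (u + 1) v = ∅ := by
        ext x
        simp only [mem_pending, seen_succ, notMem_empty, iff_false, not_and]
        intro _ h2 h3
        exact h3 (Or.inr (by rw [h2, hvu]))
      rw [this, hvu]
      refine Layered.represents_empty fun X hX => ?_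
      rw [hempty _ (mask_lt hX)]
      simp only [mask_eq_zero]
    · have : D.pending i (u + 1) v = D.pending i u v := by
        ext x
        simp only [mem_pending, seen_succ]
        refine and_congr_right fun _ => and_congr_right fun h2 => ?_
        have : D.prev i u ≠ D.prev i x := fun h => hvu (by rw [h, h2])
        simp [this]
      rw [this]
      exact (hA.pending v hv).congr (hrest _ (by omega) (by omega))
  · by_cases hpu : p = D.block i u
    · subst hpu
      have : D.merged i (u + 1) (D.block i u) = D.merged i u (D.block i u) ∪ D.pending i u u := by
        ext x
        simp only [mem_merged, mem_pending, mem_union, seen_succ]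
        constructor
        · rintro ⟨h1, h2, h3⟩
          by_cases hs : D.Seen i u x
          · exact Or.inl ⟨h1, h2, hs⟩
          · exact Or.inr ⟨h1, (h3.resolve_left hs).symm, hs⟩
        · rintro (⟨h1, h2, h3⟩ | ⟨h1, h2, h3⟩)
          · exact ⟨h1, h2, Or.inl h3⟩
          · exact ⟨h1, block_eq_of_prev_eq hD hi h1 hu h2, Or.inr h2.symm⟩
      rw [this]
      refine hdst.merge hsrc ?_ ?_ hmerge.exists_eq hmerge.ne_zero
      · exact disjoint_left.2 fun x h1 h2 => (mem_pending.1 h2).2.2 (mem_merged.1 h1).2.2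
      -- If `x` and `y` shared a block of a level `i' < i`, they would share one just below level
      -- `i`. That block would then have been seen because of `x`, contrary to `y` being pending.
      · intro x hx y hy i' hi' h
        rw [mem_merged] at hx
        rw [mem_pending] at hy
        obtain ⟨w, hw, he⟩ := hx.2.2
        exact hy.2.2 ⟨w, hw, he.trans (prev_eq_of_block_eq hD hi.le hi' hx.1 hy.1 h)⟩
    · have : D.merged i (u + 1) p = D.merged i u p := by
        ext x
        simp only [mem_merged, seen_succ]
        refine and_congr_right fun h1 => and_congr_right fun h2 => ?_
        have : D.prev i u ≠ D.prev i x := fun h => hpu (by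
          rw [← h2, block_eq_of_prev_eq hD hi hu h1 h])
        simp [this]
      rw [this]
      exact (hA.merged p hp').congr (hrest _ (by omega) (by omega))
  · rw [hother c (by omega) (by omega)]
    exact hA.zero c hc

/-- The rows of the new level are still zero by the last clause of `LevelInv`, so writing their
first cell makes them represent no users. At each level there is one merge per user, and the sum in
the bound collects the checks. -/
theorem triple_levelCmd {K i : ℕ} {an : ℕ → Finset ℕ} (hD : D.Valid) (hb : D.Fits b)
    (hK : D.k ≤ K) (hKb : K ≤ D.k + D.dummies) (hρ : D.EnvK K ρ) (h10 : ρ 10 = i) (hi : i < D.l)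
    (hA : D.LevelInv K an i A) :
    Triple b levelCmd ρ A (D.n * (5 * 3 ^ K + 6 * 2 ^ K + 9) + 3 + ∑ j ∈ range D.m,
      (3 + if D.level j = i then D.n * (3 * 2 ^ K + 2) else 0)) (D.LevelInv K an (i + 1)) := by
  have hrow : (i + 2) * D.n < 2 ^ b :=
    (Nat.mul_le_mul_right _ (by omega : i + 2 ≤ D.l + 1)).trans_lt hb.rows
  have e1 : (i + 1) * D.n = i * D.n + D.n := by ring
  have e2 : (i + 2) * D.n = i * D.n + D.n + D.n := by ring
  have h2pos : 0 < 2 ^ K := by positivity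
  -- empty rows
  have step₁ : Triple b (.loop 11 (var 1) (.put 6 (((var 10 + 1) * var 1 + var 11) * var 8) 1)) ρ A
      (D.n * 2 + 1) (D.MergeInv K an i 0) := by
    refine (Triple.loop (M := D.n) (fun _ => 1) (fun x A' => ∀ c, A' 6 c =
      if c % 2 ^ K = 0 ∧ (i + 1) * D.n ≤ c / 2 ^ K ∧ c / 2 ^ K < (i + 1) * D.n + x then 1
      else A 6 c) (by simp) (by simp [hρ.n]) hb.users ?_ ?_).mono (by simp) ?_
    · intro c
      rw [if_neg (by omega)]
    · intro x hx A' hA' _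
      refine Triple.put (j := ((i + 1) * D.n + x) * 2 ^ K + 0) (v := 1) (by simp) (by simp)
        (by simp [h10, hρ.n, hρ.two]) (by simp) (by omega) ?_
      intro c
      rw [Function.update_self, Function.update_apply, hA']
      simp only [eq_mul_add_iff h2pos]
      by_cases h1 : c % 2 ^ K = 0
      · simp only [h1, and_true, true_and]
        split_ifs <;> first | rfl | omega
      · simp [h1]
    · rintro A' ⟨h6, hfr⟩
      have hfr' : ∀ a ∉ [6, 7], A' a = A a := fun a ha => hfr a (by
        simp only [List.mem_cons, List.not_mem_nil, or_false, not_or] at ha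
        simp [Cmd.writes, ha.1])
      refine ⟨hA.prepared.of_eq hfr', fun v hv => ?_, fun p hp => ?_, fun c hc => ?_⟩
      · have : D.pending i 0 v = (range D.n).filter fun v' => D.prev i v' = D.prev i v := by
          ext x
          simp [mem_pending, not_seen_zero]
        rw [this]
        refine (hA.represents v hv).congr fun X hX => ?_
        have := prev_lt hD hi.le hv
        have hF := mask_lt hX
        change mask X < 2 ^ K at hF
        rw [row, h6, if_neg, row]
        rw [mul_add_div_eq hF]
        omega
      · have : D.merged i 0 p = ∅ := by
          ext x
          simp [mem_merged, not_seen_zero]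
        rw [this]
        refine Layered.represents_empty fun X hX => ?_
        have hF := mask_lt hX
        change mask X < 2 ^ K at hF
        rw [row, h6, mul_add_div_eq hF, mul_add_mod_eq hF]
        simp only [mask_eq_zero]
        by_cases h0 : X = ∅
        · rw [if_pos h0, if_pos ⟨h0, by omega, by omega⟩]
        · rw [if_neg h0, if_neg fun h => h0 h.1]
          exact hA.zero _ (by rw [mul_add_div_eq hF]; omega)
      · rw [h6, if_neg (by omega)]
        exact hA.zero c (by omega)
  have step₂ : ∀ A₁, D.MergeInv K an i 0 A₁ → Triple b (.loop 11 (var 1)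
      (.letc 12 (var 10 * var 1 + previousE)
      (.letc 13 ((var 10 + 1) * var 1 + arr 0 (var 5 + var 10 * var 1 + var 11)) mergeCmd))) ρ A₁
      (D.n * (5 * 3 ^ K + 6 * 2 ^ K + 7) + 1) (D.MergeInv K an i D.n) := by
    intro A₁ hA₁
    refine (Triple.loop (M := D.n) (fun _ => 5 * 3 ^ K + 6 * 2 ^ K + 6)
      (fun u A' => D.MergeInv K an i u A') (by simp) (by simp [hρ.n]) hb.users hA₁ ?_).mono
      (by simp) fun _ h => h.1
    intro u hu A' hA' _
    exact triple_mergeUser hD hb hKb (hρ.update (by omega) u) (by simp [h10]) (by simp) hi hu hA'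
  have step₃ : ∀ A₂, D.MergeInv K an i D.n A₂ → Triple b (.loop 11 (var 3) checkCmd) ρ A₂
      (∑ j ∈ range D.m, (3 + if D.level j = i then D.n * (3 * 2 ^ K + 2) else 0) + 1)
      (D.LevelInv K an (i + 1)) := by
    intro A₂ hA₂
    -- Entries are erased but never restored, so the invariant asks whether some earlier constraint
    -- of this level rejects the set; otherwise the entry is the original one.
    refine (Triple.loop (M := D.m)
      (fun j => if D.level j = i then D.n * (3 * 2 ^ K + 2) + 2 else 2) (fun x A' => ∀ c,
      ((∃ j < x, D.level j = i ∧ (i + 1) * D.n ≤ c / 2 ^ K ∧ c / 2 ^ K < (i + 1) * D.n + D.n ∧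
        ¬ D.okMask K an j (c % 2 ^ K)) → A' 6 c = 0) ∧
      (¬ (∃ j < x, D.level j = i ∧ (i + 1) * D.n ≤ c / 2 ^ K ∧
        c / 2 ^ K < (i + 1) * D.n + D.n ∧ ¬ D.okMask K an j (c % 2 ^ K)) → A' 6 c = A₂ 6 c))
      (by simp) (by simp [hρ.m]) hb.count (by simp) ?_).mono ?_ ?_
    · intro j hj A' hA' hfr
      have hP : D.Prepared an A' := hA₂.prepared.of_eq fun a ha => hfr a (by
        simp only [List.mem_cons, List.not_mem_nil, or_false, not_or] at ha
        simp [Cmd.writes, checkCmd, ha.1])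
      refine (triple_checkCmd hD hb hK hKb (hρ.update (x := 11) (by omega) j) (by simp [h10])
        (by simp) hP hj).mono le_rfl ?_
      rintro A'' ⟨h, -⟩ c
      obtain ⟨g1, g2⟩ := h c
      obtain ⟨k1, k2⟩ := hA' c
      constructor
      · rintro ⟨j', hj', hc⟩
        by_cases hcj : D.level j = i ∧ (i + 1) * D.n ≤ c / 2 ^ K ∧
            c / 2 ^ K < (i + 1) * D.n + D.n ∧ ¬ D.okMask K an j (c % 2 ^ K)
        · exact g1 hcj
        · rw [g2 hcj]
          refine k1 ⟨j', ?_, hc⟩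
          rcases Nat.lt_succ_iff_lt_or_eq.1 hj' with h | rfl
          · exact h
          · exact absurd hc hcj
      · intro hne
        rw [g2 fun hc => hne ⟨j, by omega, hc⟩]
        exact k2 fun ⟨j', hj', hc⟩ => hne ⟨j', by omega, hc⟩
    · refine Nat.add_le_add_right (sum_le_sum fun j _ => ?_) 1
      split_ifs <;> omega
    · rintro A' ⟨h, hfr⟩
      refine ⟨hA₂.prepared.of_eq fun a ha => hfr a (by
        simp only [List.mem_cons, List.not_mem_nil, or_false, not_or] at ha
        simp [Cmd.writes, checkCmd, ha.1]), fun v hv => ?_, fun c hc => ?_⟩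
      · have hp := hD.block_lt i hi v hv
        have hprev : ∀ v, D.prev (i + 1) v = D.block i v := fun v => by simp [prev]
        simp only [hprev]
        -- When all users have been considered, each one has been seen through itself, and the
        -- merged part is the whole block.
        have hm : (range D.n).filter (fun v' => D.block i v' = D.block i v) =
            D.merged i D.n (D.block i v) := by
          ext x
          simp only [mem_filter, mem_range, mem_merged]
          exact and_congr_right fun hx => ⟨fun h => ⟨h, x, hx, rfl⟩, fun h => h.1⟩
        rw [hm]
        have key : ∀ X ⊆ range K, ∀ j, (D.level j = i ∧ (i + 1) * D.n ≤
            (((i + 1) * D.n + D.block i v) * 2 ^ K + mask X) / 2 ^ K ∧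
            (((i + 1) * D.n + D.block i v) * 2 ^ K + mask X) / 2 ^ K < (i + 1) * D.n + D.n ∧
            ¬ D.okMask K an j ((((i + 1) * D.n + D.block i v) * 2 ^ K + mask X) % 2 ^ K)) ↔
            D.level j = i ∧ ¬ (D.layered K an).ok j X := by
          intro X hX j
          have hF := mask_lt hX
          rw [mul_add_div_eq hF, mul_add_mod_eq hF, okMask_mask hX]
          refine and_congr_right fun _ => ?_
          constructor
          · exact fun h => h.2.2
          · exact fun h => ⟨by omega, by omega, h⟩
        refine (hA₂.merged _ hp).check ?_ ?_ ?_ ?_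
        · rw [← hm]
          exact ⟨v, by simp [hv]⟩
        · intro x hx y hy
          rw [mem_merged] at hx hy
          exact hx.2.1.trans hy.2.1.symm
        · intro X hX hall
          refine (h _).2 ?_
          rintro ⟨j, hj, hc⟩
          rw [key X hX] at hc
          exact hc.2 (hall j hj hc.1)
        · intro X hX j hj hji hne
          exact (h _).1 ⟨j, hj, (key X hX j).2 ⟨hji, hne⟩⟩
      · have e3 : (i + 1 + 1) * D.n = i * D.n + D.n + D.n := by ring
        rw [e3] at hc
        rw [(h c).2 fun ⟨j, hj, hc'⟩ => by omega]
        exact hA₂.zero c (by omega)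
  refine (Triple.seq (m := D.n * 2 + 1) (step₁.mono le_rfl fun A₁ hA₁ =>
    Triple.seq ((step₂ A₁ hA₁).mono le_rfl fun A₂ hA₂ => step₃ A₂ hA₂))).mono ?_ fun _ h => h
  ring_nf
  omega

end Layout

end WSP

/-! ### The complete algorithm -/

namespace WSP

open Finset RAM RAM.Exp

variable {b : ℕ} {A : ℕ → ℕ → ℕ} {ρ : ℕ → ℕ}

namespace Layout

variable {D : Layout}

/-- The last level has a single block, whose number is read off from user `0`. The entry for the set
of all steps is the last one of its row; the digits of the code are the plan, and those of the dummy
steps are ignored. -/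
theorem triple_answerCmd {K : ℕ} {an : ℕ → Finset ℕ} (hD : D.Valid) (hb : D.Fits b)
    (hK : D.k ≤ K) (hKb : K ≤ D.k + D.dummies) (hρ : D.EnvK K ρ) (hA : D.LevelInv K an D.l A) :
    Triple b answerCmd ρ A (2 * D.k + 3) fun A' =>
      (A' 8 0 = 0 ∧ ¬ ∃ π, (D.layered K an).Good D.l (range D.n) (range K) π) ∨
      (A' 8 0 = 1 ∧ ∃ π, (D.layered K an).Good D.l (range D.n) (range K) π ∧
        ∀ s < D.k, A' 8 (s + 1) = π s) := by
  have hbK : K < b := by have := hb.steps; omega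
  have hbb : b < 2 ^ b := Nat.lt_two_pow_self
  have hnK : D.n ^ K < 2 ^ b := (Nat.pow_le_pow_right hD.n_pos hKb).trans_lt hb.plans
  have hprev : ∀ v, D.prev D.l v = D.block (D.l - 1) v := fun v => by
    simp [prev, hD.l_pos.ne']
  have hrep := hA.represents 0 hD.n_pos
  have hall : (range D.n).filter (fun v => D.prev D.l v = D.prev D.l 0) = range D.n := by
    rw [filter_eq_self]
    intro v hv
    rw [hprev, hprev]
    exact hD.last v (mem_range.1 hv) 0 hD.n_pos
  rw [hall, hprev] at hrep
  set v := row K A (D.l * D.n + D.block (D.l - 1) 0) (mask (range K)) with hv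
  have hvb : v < 2 ^ b :=
    (hrep.le hD.n_pos (subset_refl _) (subset_refl _)).trans_lt hnK
  have h10 : Function.update ρ 10 v 10 = v := Function.update_self ..
  have hρ' := hρ.update (x := 10) le_rfl v
  refine (Triple.letc (v := v) (n := 2 * D.k + 2) (by simp) ?_ hvb ?_).mono (by omega)
    fun _ h => h
  · simp [hρ.l, hρ.n, hρ.block, hρ.two, hA.prepared.inp, hv, row, mask_range, block]
  refine (Triple.seq (m := 1) (n := 2 * D.k + 1) (Triple.put (j := 0)
    (v := 1 - if v = 0 then 1 else 0) (by simp) (by simp) (by simp) (by simp) ?_ ?_)).mono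
    (by omega) fun _ h => h
  · split_ifs
    · positivity
    · omega
  refine (Triple.loop (M := D.k) (fun _ => 1) (fun x A' =>
    A' 8 0 = (1 - if v = 0 then 1 else 0) ∧ ∀ s < x, A' 8 (s + 1) = (v - 1) / D.n ^ s % D.n)
    (by simp) (by simp [hρ.k]) (by omega) (by simp) ?_).mono (by simp; omega) ?_
  · rintro s hs A' ⟨h1, h2⟩ _
    refine Triple.put (j := s + 1) (v := (v - 1) / D.n ^ s % D.n) (by simp) ?_ (by simp)
      (by simp [hρ.n]) ?_ ⟨?_, fun s' hs' => ?_⟩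
    · simp only [safe_mod, safe_div, safe_sub, safe_var, safe_ofNat, safe_pow, eval_var, true_and,
        and_true, Function.update_self, (hρ'.update (x := 11) (by omega) s).n]
      exact ⟨by omega, (Nat.pow_le_pow_right hD.n_pos (by omega)).trans_lt hnK⟩
    · exact (Nat.mod_lt _ hD.n_pos).trans hb.users
    · rw [Function.update_self, Function.update_of_ne (by omega), h1]
    · rw [Function.update_self, Function.update_apply]
      split_ifs with h
      · rw [Nat.succ_inj.1 h]
      · exact h2 s' (by omega)
  · rintro A' ⟨⟨h1, h2⟩, -⟩
    obtain ⟨g1, g2⟩ := hrep (range K) (subset_refl _)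
    by_cases h0 : v = 0
    · exact Or.inl ⟨by simp [h1, h0], fun h => g2 h h0⟩
    · obtain ⟨π, hπ, he⟩ := g1 h0
      refine Or.inr ⟨by simp [h1, h0], π, hπ, fun s hs => ?_⟩
      have e : v - 1 = code D.n (range K) π := by
        rw [hv, he]
        rfl
      rw [h2 s hs, e]
      exact digit_sum (fun i hi => mem_range.1 (hπ.1 i (mem_range.2 hi)).1) (by omega)

/-- The dummy steps `0, …, q - 1` are distributed among the pairs of sets. -/
structure IsDummy (D : Layout) (q : ℕ) (dm : ℕ → ℕ) : Prop where
  lt : ∀ j ∈ D.sim3, dm j < q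
  eq : ∀ i ∈ D.sim3, ∀ j ∈ D.sim3, dm i = dm j → D.S₁ i = D.S₁ j ∧ D.S₂ i = D.S₂ j

/-- The anchors: a singleton for a constraint of Type 2, and a dummy step otherwise. -/
def anchor (D : Layout) (dm : ℕ → ℕ) (j : ℕ) : Finset ℕ :=
  if (D.S₁ j).card = 1 then D.S₁ j else if (D.S₂ j).card = 1 then D.S₂ j else {D.k + dm j}

/-- The dummy step of a constraint is the position of its key in the list. A position determines the
key, and the key determines the pair of sets. -/
theorem AnchorInv.exists_isDummy (h : D.AnchorInv D.m A) :
    ∃ dm, D.IsDummy (A 5 0) dm ∧ D.Prepared (D.anchor dm) A := by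
  have : ∀ j, ∃ d, j ∈ D.sim3 → d < A 5 0 ∧ A 4 d = D.key j ∧ A 3 j = 2 ^ (D.k + d) := by
    intro j
    by_cases hj : j ∈ D.sim3
    · obtain ⟨d, hd⟩ := h.dummy j (mem_range.1 (mem_filter.1 hj).1) hj
      exact ⟨d, fun _ => hd⟩
    · exact ⟨0, fun h => absurd h hj⟩
  choose dm hdm using this
  refine ⟨dm, ⟨fun j hj => (hdm j hj).1, fun i hi j hj hij => key_inj ?_⟩, h.inp, h.mask₁, h.mask₂,
    fun j hj hk => ?_⟩
  · rw [← (hdm i hi).2.1, hij, (hdm j hj).2.1]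
  · rw [anchor]
    split_ifs with h1 h2
    · exact h.single₁ j hj hk h1
    · exact h.single₂ j hj hk h1 h2
    · rw [mask_singleton]
      exact (hdm j (mem_filter.2 ⟨mem_range.2 hj, hk, h1, h2⟩)).2.2

/-- After exchanging the sums, each constraint contributes `c` for exactly one level. -/
theorem sum_level_le (hD : D.Valid) (c : ℕ) :
    ∑ i ∈ range D.l, ∑ j ∈ range D.m, (3 + if D.level j = i then c else 0) =
      3 * (D.l * D.m) + D.m * c := by
  rw [sum_comm]
  simp only [sum_add_distrib, sum_const, card_range, smul_eq_mul, sum_ite_eq, mem_range]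
  rw [sum_congr rfl fun j hj => if_pos (hD.level_lt j (mem_range.1 hj))]
  simp only [sum_const, card_range, smul_eq_mul]
  ring

/-- The dynamic program computes a good plan if there is one. -/
theorem triple_solveCmd (hD : D.Valid) (hb : D.Fits b) (hln : D.l ≤ D.n) (h0 : A 0 = D.inp)
    (hA : ∀ a ≠ 0, ∀ c, A a c = 0) :
    Triple b solveCmd (fun _ => 0) A (50 * (D.m * D.n * 2 ^ (D.k + D.dummies) +
      D.n ^ 2 * 3 ^ (D.k + D.dummies))) fun A' => ∃ q dm, D.IsDummy q dm ∧
      ((A' 8 0 = 0 ∧ ¬ ∃ π, (D.layered (D.k + q) (D.anchor dm)).Good D.l (range D.n)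
          (range (D.k + q)) π) ∨
        (A' 8 0 = 1 ∧ ∃ π, (D.layered (D.k + q) (D.anchor dm)).Good D.l (range D.n)
          (range (D.k + q)) π ∧ ∀ s < D.k, A' 8 (s + 1) = π s)) := by
  have hbb : b < 2 ^ b := Nat.lt_two_pow_self
  have hst := hb.steps
  have e4 : 4 + D.k * D.k = D.authAddr := rfl
  have e5 : D.authAddr + D.k * D.n = D.blockAddr := rfl
  have e6 : D.blockAddr + D.l * D.n = D.recordsAddr := rfl
  have haddr := hb.addr
  have hl : D.l < 2 ^ b := hln.trans_lt hb.users
  have hi0 : A 0 0 = D.k := by rw [h0, hD.k_eq]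
  have hi1 : A 0 1 = D.n := by rw [h0, hD.n_eq]
  have hi2 : A 0 2 = D.l := by rw [h0, hD.l_eq]
  have hi3 : A 0 3 = D.m := by rw [h0, hD.m_eq]
  set Q := D.k + D.dummies with hQ
  have p2 : 1 ≤ 2 ^ Q := Nat.one_le_two_pow
  have p3 : 2 ^ Q ≤ 3 ^ Q := Nat.pow_le_pow_left (by norm_num) _
  have pk : D.k ≤ 2 ^ Q := (by omega : D.k ≤ Q).trans Nat.lt_two_pow_self.le
  set T := D.n * (3 * 2 ^ Q + 2) + 1 +
    (D.l * (D.n * (5 * 3 ^ Q + 6 * 2 ^ Q + 9) + 4) + (3 * (D.l * D.m) +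
      D.m * (D.n * (3 * 2 ^ Q + 2))) + 1 + (2 * D.k + 3)) with hT
  -- Here `l ≤ n` turns the `l * n` merges into `n ^ 2`, and `2 ^ Q ≤ 3 ^ Q` absorbs the work on
  -- single rows.
  have hbound : D.m * 13 + 1 + (T + 3) + 7 ≤
      50 * (D.m * D.n * 2 ^ Q + D.n ^ 2 * 3 ^ Q) := by
    have n1 : 1 ≤ D.n := hD.n_pos
    -- With `x` and `y` as opaque names for the two terms, the inequality becomes linear in the
    -- monomials that occur.
    obtain ⟨x, hx⟩ : ∃ x, x = D.m * D.n * 2 ^ Q := ⟨_, rfl⟩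
    obtain ⟨y, hy⟩ : ∃ y, y = D.n ^ 2 * 3 ^ Q := ⟨_, rfl⟩
    have q1 : 1 ≤ D.n ^ 2 := Nat.one_le_pow _ _ n1
    have b1 : D.m * D.n ≤ x := hx ▸ Nat.le_mul_of_pos_right _ (by positivity)
    have b2 : D.m ≤ D.m * D.n := Nat.le_mul_of_pos_right _ n1
    have b3 : 3 ^ Q ≤ y := hy ▸ Nat.le_mul_of_pos_left _ (by positivity)
    have b4 : D.l * D.m ≤ D.m * D.n := by rw [mul_comm]; exact Nat.mul_le_mul_left _ hln
    have b5 : D.n * 3 ^ Q ≤ y := by rw [hy, sq, mul_assoc]; exact Nat.le_mul_of_pos_left _ n1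
    have b6 : D.l * (D.n * 3 ^ Q) ≤ y := by
      rw [hy, sq, mul_assoc]; exact Nat.mul_le_mul_right _ hln
    have b7 : D.n * 2 ^ Q ≤ D.n * 3 ^ Q := Nat.mul_le_mul_left _ p3
    have b8 : D.l * (D.n * 2 ^ Q) ≤ D.l * (D.n * 3 ^ Q) := Nat.mul_le_mul_left _ b7
    have b9 : D.n ≤ D.n * 2 ^ Q := Nat.le_mul_of_pos_right _ (by positivity)
    have b10 : D.l * D.n ≤ D.l * (D.n * 2 ^ Q) := Nat.mul_le_mul_left _ b9
    have b11 : D.l ≤ D.l * D.n := Nat.le_mul_of_pos_right _ n1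
    have e1 : T = 3 * (D.n * 2 ^ Q) + 2 * D.n + 5 + 5 * (D.l * (D.n * 3 ^ Q)) +
        6 * (D.l * (D.n * 2 ^ Q)) + 9 * (D.l * D.n) + 4 * D.l + 3 * (D.l * D.m) + 3 * x +
        2 * (D.m * D.n) + 2 * D.k := by
      rw [hT, hx]; ring
    rw [← hx, ← hy, e1]
    omega
  refine Triple.mono ?_ hbound fun _ h => h
  refine Triple.letc (n := D.m * 13 + 1 + (T + 3) + 6) (v := D.k) (by simp) (by simpa using hi0)
    (by omega) ?_
  refine Triple.letc (n := D.m * 13 + 1 + (T + 3) + 5) (v := D.n) (by simp) (by simpa using hi1)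
    hb.users ?_
  refine Triple.letc (n := D.m * 13 + 1 + (T + 3) + 4) (v := D.l) (by simp) (by simpa using hi2)
    hl ?_
  refine Triple.letc (n := D.m * 13 + 1 + (T + 3) + 3) (v := D.m) (by simp) (by simpa using hi3)
    hb.count ?_
  refine Triple.letc (n := D.m * 13 + 1 + (T + 3) + 2) (v := D.authAddr) (by simp)
    (by simp [e4]) (by omega) ?_
  refine Triple.letc (n := D.m * 13 + 1 + (T + 3) + 1) (v := D.blockAddr) (by simp)
    (by simp [e5]) (by omega) ?_
  refine Triple.letc (n := D.m * 13 + 1 + (T + 3)) (v := D.recordsAddr) (by simp)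
    (by simp [e6]) (by omega) ?_
  set ρ : ℕ → ℕ := Function.update (Function.update (Function.update (Function.update
    (Function.update (Function.update (Function.update (fun _ => 0) 0 D.k) 1 D.n) 2 D.l) 3 D.m) 4
    D.authAddr) 5 D.blockAddr) 6 D.recordsAddr with hρdef
  have hρ : D.Env ρ := by constructor <;> simp [hρdef]
  refine Triple.seq (m := D.m * 13 + 1) ((Triple.loop (M := D.m) (fun _ => 12)
    (fun j A' => D.AnchorInv j A' ∧ ∀ c, A' 6 c = 0) (by simp) (by simp [hρ.m]) hb.count ?_ ?_).mono
    (by simp) ?_)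
  · refine ⟨⟨h0, by simp, by simp, by simp, by simp, by simp, ?_, ?_, ?_⟩, hA 6 (by decide)⟩
    · simp [hA 5 (by decide)]
    · simp [hA 5 (by decide)]
    · simp [hA 5 (by decide)]
  · rintro j hj A' ⟨hA', h6⟩ _
    refine (triple_anchorCmd hD hb hj (hρ.update (by omega) j) (by simp) hA').frame.mono le_rfl ?_
    rintro A'' ⟨h, hfr⟩
    exact ⟨h, by rw [hfr 6 (by decide)]; exact h6⟩
  rintro A₁ ⟨⟨hA₁, h6⟩, -⟩
  have hq := hA₁.le_dummies
  obtain ⟨dm, hdm, hprep⟩ := hA₁.exists_isDummy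
  set q := A₁ 5 0 with hqdef
  have hKQ : D.k + q ≤ Q := by omega
  have m2 : 2 ^ (D.k + q) ≤ 2 ^ Q := Nat.pow_le_pow_right (by norm_num) hKQ
  have m3 : 3 ^ (D.k + q) ≤ 3 ^ Q := Nat.pow_le_pow_right (by norm_num) hKQ
  have m4 : 3 ^ Q ≤ 4 ^ Q := Nat.pow_le_pow_left (by norm_num) _
  have hm4 : 4 ^ Q < 2 ^ b := hb.masks
  refine Triple.letc (n := T + 2) (v := D.k + q) (by simp) (by simp [hρ.k]; rfl) (by omega) ?_
  refine Triple.letc (n := T + 1) (v := 2 ^ (D.k + q)) ?_ (by simp) (by omega) ?_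
  · simp only [safe_pow, safe_ofNat, safe_var, true_and, eval_var, Function.update_self, eval_ofNat]
    exact ⟨by omega, by omega⟩
  refine Triple.letc (n := T) (v := 3 ^ (D.k + q)) ?_ (by simp) (by omega) ?_
  · simp only [safe_pow, safe_ofNat, safe_var, true_and, eval_var, eval_ofNat,
      Function.update_of_ne (show (7 : ℕ) ≠ 8 by decide), Function.update_self]
    exact ⟨by omega, by omega⟩
  set ρ' := Function.update (Function.update (Function.update ρ 7 (D.k + q)) 8 (2 ^ (D.k + q))) 9
    (3 ^ (D.k + q)) with hρ'def
  have hρ' : D.EnvK (D.k + q) ρ' :=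
    ⟨((hρ.update (by omega) _).update (by omega) _).update (by omega) _, by simp [hρ'def],
      by simp [hρ'def], by simp [hρ'def]⟩
  have hK : D.k ≤ D.k + q := Nat.le_add_right _ _
  refine Triple.seq ((triple_usersCmd hD hb hK hKQ hρ' hprep.inp h6).mono ?_ ?_)
  · gcongr
  rintro A₂ ⟨⟨hu, hz⟩, hfr⟩
  -- Below the first level each user is a block by itself, numbered by the user; so the rows for
  -- single users are the initial state.
  have hinv : D.LevelInv (D.k + q) (D.anchor dm) 0 A₂ := by
    refine ⟨hprep.of_eq fun a ha => hfr a ?_, fun v hv => ?_, fun c hc => hz c (by omega)⟩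
    · simp only [List.mem_cons, List.not_mem_nil, or_false, not_or] at ha ⊢
      exact ha.1
    · have e : (range D.n).filter (fun v' => D.prev 0 v' = D.prev 0 v) = {v} := by
        ext x
        simp only [prev, if_true, mem_filter, mem_range, mem_singleton]
        exact ⟨fun h => h.2, fun h => ⟨h ▸ hv, h⟩⟩
      have e' : 0 * D.n + D.prev 0 v = v := by simp [prev]
      rw [e, e']
      exact represents_userEntry _ hD hv (hu v hv)
  refine Triple.seq ((Triple.loop (M := D.l) (fun i => D.n * (5 * 3 ^ Q + 6 * 2 ^ Q + 9) + 3 +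
    ∑ j ∈ range D.m, (3 + if D.level j = i then D.n * (3 * 2 ^ Q + 2) else 0))
    (fun i A' => D.LevelInv (D.k + q) (D.anchor dm) i A') (by simp) (by simp [hρ'.l]) hl hinv
    ?_).mono ?_ ?_)
  · intro i hi A' hA' _
    refine (triple_levelCmd hD hb hK hKQ (hρ'.update (by omega) i) (by simp) hi hA').mono ?_
      fun _ h => h
    gcongr
    split_ifs
    · gcongr
    · exact le_rfl
  · have := sum_level_le hD (D.n * (3 * 2 ^ Q + 2))
    rw [← this]
    simp only [sum_add_distrib, sum_const, card_range, smul_eq_mul]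
    ring_nf
    omega
  rintro A₃ ⟨hA₃, -⟩
  exact (triple_answerCmd hD hb hK hKQ hρ' hA₃).mono le_rfl fun A' h => ⟨q, dm, hdm, h⟩

end Layout

end WSP

/-! ### Good plans with dummy steps, and valid plans -/

namespace WSP

open Finset

namespace Layout

variable {D : Layout}

/-- Valid plans, in terms of the input. -/
structure ValidPlan (D : Layout) (π : ℕ → ℕ) : Prop where
  lt : ∀ s < D.k, π s < D.n
  auth : ∀ s < D.k, D.auth s (π s) = 1
  same : ∀ j < D.m, D.kind j = 0 → ∃ s₁ ∈ D.S₁ j, ∃ s₂ ∈ D.S₂ j,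
    D.block (D.level j) (π s₁) = D.block (D.level j) (π s₂)
  differ : ∀ j < D.m, D.kind j ≠ 0 → ∃ s₁ ∈ D.S₁ j, ∃ s₂ ∈ D.S₂ j,
    D.block (D.level j) (π s₁) ≠ D.block (D.level j) (π s₂)

theorem lt_of_mem_S₁ {j s : ℕ} (h : s ∈ D.S₁ j) : s < D.k := mem_range.1 (S₁_subset j h)
theorem lt_of_mem_S₂ {j s : ℕ} (h : s ∈ D.S₂ j) : s < D.k := mem_range.1 (S₂_subset j h)

theorem anchor_nonempty {dm : ℕ → ℕ} (j : ℕ) : (D.anchor dm j).Nonempty := by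
  rw [anchor]
  split_ifs with h1 h2
  · exact card_pos.1 (by omega)
  · exact card_pos.1 (by omega)
  · exact singleton_nonempty _

theorem anchor_subset {q j : ℕ} {dm : ℕ → ℕ} (h : D.IsDummy q dm) (hj : j < D.m)
    (hk : D.kind j = 0) : D.anchor dm j ⊆ range (D.k + q) := by
  rw [anchor]
  split_ifs with h1 h2
  · exact (S₁_subset j).trans (range_mono (by omega))
  · exact (S₂_subset j).trans (range_mono (by omega))
  · rw [singleton_subset_iff, mem_range]
    have := h.lt j (mem_filter.2 ⟨mem_range.2 hj, hk, h1, h2⟩)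
    omega

/-- For `∼`, the block of the user assigned to an anchor step receives a step from each set, and
these two steps are the witnesses. For `≁`, if all pairs were in the same block, the block of one
step from the first set would receive both sets, which is forbidden. -/
theorem validPlan_of_good {q : ℕ} {dm : ℕ → ℕ} {π : ℕ → ℕ} (hD : D.Valid) (h : D.IsDummy q dm)
    (hπ : (D.layered (D.k + q) (D.anchor dm)).Good D.l (range D.n) (range (D.k + q)) π) :
    D.ValidPlan π := by
  obtain ⟨h1, h2⟩ := hπ
  have hmem : ∀ s < D.k + q, π s ∈ range D.n := fun s hs => (h1 s (mem_range.2 hs)).1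
  refine ⟨fun s hs => mem_range.1 (hmem s (by omega)),
    fun s hs => (h1 s (mem_range.2 (by omega))).2 hs, fun j hj hk => ?_, fun j hj hk => ?_⟩
  · obtain ⟨a, ha⟩ := anchor_nonempty (D := D) (dm := dm) j
    have haK := anchor_subset h hj hk ha
    have hok := h2 j hj (hD.level_lt j hj) (π a) (hmem a (mem_range.1 haK))
    simp only [layered, hk, if_true] at hok
    obtain ⟨⟨s₁, hs₁⟩, s₂, hs₂⟩ := hok ⟨a, mem_inter.2 ⟨mem_filter.2 ⟨haK, rfl⟩, ha⟩⟩
    obtain ⟨f₁, hs₁⟩ := mem_inter.1 hs₁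
    obtain ⟨f₂, hs₂⟩ := mem_inter.1 hs₂
    exact ⟨s₁, hs₁, s₂, hs₂, (mem_filter.1 f₁).2.trans (mem_filter.1 f₂).2.symm⟩
  · have hok := h2 j hj (hD.level_lt j hj)
    simp only [layered, hk, if_false] at hok
    -- That the two sets are nonempty is part of the condition on any block, so an arbitrary user
    -- will do.
    obtain ⟨⟨s₁, hs₁⟩, ⟨s₂, hs₂⟩, -⟩ := hok 0 (mem_range.2 hD.n_pos)
    have l₁ := lt_of_mem_S₁ hs₁
    obtain ⟨-, -, hne⟩ := hok (π s₁) (hmem s₁ (by omega))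
    by_contra hcon
    push Not at hcon
    refine hne ⟨fun s hs => ?_, fun s hs => ?_⟩
    · have := lt_of_mem_S₁ hs
      exact mem_filter.2 ⟨mem_range.2 (by omega),
        (hcon s hs s₂ hs₂).trans (hcon s₁ hs₁ s₂ hs₂).symm⟩
    · have := lt_of_mem_S₂ hs
      exact mem_filter.2 ⟨mem_range.2 (by omega), (hcon s₁ hs₁ s hs).symm⟩

/-- A dummy step is assigned to the users of a block that satisfies all its constraints: the blocks
that witness the constraint with the lowest level are contained in blocks of the higher levels. -/
theorem ValidPlan.exists_user {q : ℕ} {dm : ℕ → ℕ} {π : ℕ → ℕ} (hD : D.Valid) (h : D.IsDummy q dm)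
    (hπ : D.ValidPlan π) (d : ℕ) : ∃ u < D.n, ∀ j ∈ D.sim3, dm j = d →
      ∃ s₁ ∈ D.S₁ j, ∃ s₂ ∈ D.S₂ j, D.block (D.level j) (π s₁) = D.block (D.level j) u ∧
        D.block (D.level j) (π s₂) = D.block (D.level j) u := by
  by_cases hne : (D.sim3.filter fun j => dm j = d).Nonempty
  · obtain ⟨j, hjf, hmin⟩ := exists_min_image _ D.level hne
    obtain ⟨hj, rfl⟩ := mem_filter.1 hjf
    have hj' := hj
    simp only [sim3, mem_filter, mem_range] at hj'
    obtain ⟨s₁, hs₁, s₂, hs₂, he⟩ := hπ.same j hj'.1 hj'.2.1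
    have u₁ := hπ.lt s₁ (lt_of_mem_S₁ hs₁)
    have u₂ := hπ.lt s₂ (lt_of_mem_S₂ hs₂)
    refine ⟨π s₁, u₁, fun i hi hij => ?_⟩
    obtain ⟨e₁, e₂⟩ := h.eq i hi j hj hij
    refine ⟨s₁, e₁ ▸ hs₁, s₂, e₂ ▸ hs₂, rfl, ?_⟩
    exact (block_eq_of_le hD (hD.level_lt i (mem_range.1 (mem_filter.1 hi).1))
      (hmin i (mem_filter.2 ⟨hi, hij⟩)) u₁ u₂ he).symm
  · refine ⟨0, hD.n_pos, fun j hj hjd => absurd ⟨j, mem_filter.2 ⟨hj, hjd⟩⟩ hne⟩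

/-- The plan is extended to the dummy steps by `ValidPlan.exists_user`. If one set is a singleton,
each pair of witnesses contains its step, so the block with the anchor has the other witness as
well. -/
theorem ValidPlan.exists_good {q : ℕ} {dm : ℕ → ℕ} {π : ℕ → ℕ} (hD : D.Valid) (h : D.IsDummy q dm)
    (hπ : D.ValidPlan π) :
    ∃ π', (D.layered (D.k + q) (D.anchor dm)).Good D.l (range D.n) (range (D.k + q)) π' := by
  choose f hf hfj using hπ.exists_user hD h
  have key : ∀ s < D.k, (if s < D.k then π s else f (s - D.k)) = π s := fun s hs => if_pos hs
  refine ⟨fun s => if s < D.k then π s else f (s - D.k), fun s hs => ⟨?_, fun hk => ?_⟩,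
    fun j hj _ u _ => ?_⟩
  · dsimp only
    split_ifs with hk
    · exact mem_range.2 (hπ.lt s hk)
    · exact mem_range.2 (hf _)
  · dsimp only
    rw [key s hk]
    exact hπ.auth s hk
  · simp only [layered]
    split_ifs with hk
    · rintro ⟨a, ha⟩
      obtain ⟨ha, han⟩ := mem_inter.1 ha
      obtain ⟨haK, hau⟩ := mem_filter.1 ha
      have mem : ∀ s < D.k, D.block (D.level j) (π s) = D.block (D.level j) u →
          s ∈ (range (D.k + q)).filter fun s => D.block (D.level j)
            (if s < D.k then π s else f (s - D.k)) = D.block (D.level j) u := by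
        intro s hs he
        rw [mem_filter, mem_range, key s hs]
        exact ⟨by omega, he⟩
      rw [anchor] at han
      split_ifs at han with h1 h2
      · obtain ⟨t, ht⟩ := card_eq_one.1 h1
        obtain ⟨s₁, hs₁, s₂, hs₂, he⟩ := hπ.same j hj hk
        obtain rfl : a = t := mem_singleton.1 (ht ▸ han)
        obtain rfl : s₁ = a := mem_singleton.1 (ht ▸ hs₁)
        rw [key _ (lt_of_mem_S₁ hs₁)] at hau
        exact ⟨⟨s₁, mem_inter.2 ⟨ha, han⟩⟩,
          s₂, mem_inter.2 ⟨mem s₂ (lt_of_mem_S₂ hs₂) (he.symm.trans hau), hs₂⟩⟩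
      · obtain ⟨t, ht⟩ := card_eq_one.1 h2
        obtain ⟨s₁, hs₁, s₂, hs₂, he⟩ := hπ.same j hj hk
        obtain rfl : a = t := mem_singleton.1 (ht ▸ han)
        obtain rfl : s₂ = a := mem_singleton.1 (ht ▸ hs₂)
        rw [key _ (lt_of_mem_S₂ hs₂)] at hau
        exact ⟨⟨s₁, mem_inter.2 ⟨mem s₁ (lt_of_mem_S₁ hs₁) (he.trans hau), hs₁⟩⟩,
          s₂, mem_inter.2 ⟨ha, han⟩⟩
      · obtain rfl := mem_singleton.1 han
        rw [if_neg (by omega), Nat.add_sub_cancel_left] at hau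
        obtain ⟨s₁, hs₁, s₂, hs₂, he₁, he₂⟩ := hfj (dm j) j
          (mem_filter.2 ⟨mem_range.2 hj, hk, h1, h2⟩) rfl
        exact ⟨⟨s₁, mem_inter.2 ⟨mem s₁ (lt_of_mem_S₁ hs₁) (he₁.trans hau), hs₁⟩⟩,
          s₂, mem_inter.2 ⟨mem s₂ (lt_of_mem_S₂ hs₂) (he₂.trans hau), hs₂⟩⟩
    · obtain ⟨s₁, hs₁, s₂, hs₂, hne⟩ := hπ.differ j hj hk
      refine ⟨⟨s₁, hs₁⟩, ⟨s₂, hs₂⟩, fun ⟨h1, h2⟩ => hne ?_⟩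
      have e1 := (mem_filter.1 (h1 hs₁)).2
      have e2 := (mem_filter.1 (h2 hs₂)).2
      rw [key _ (lt_of_mem_S₁ hs₁)] at e1
      rw [key _ (lt_of_mem_S₂ hs₂)] at e2
      exact e1.trans e2.symm

/-- A correct output, in terms of the input. -/
def IsOutput (D : Layout) (g : ℕ → ℕ) : Prop :=
  (g 0 = 0 ∧ ∀ π, ¬ D.ValidPlan π) ∨ (g 0 = 1 ∧ ∃ π, D.ValidPlan π ∧ ∀ s < D.k, g (s + 1) = π s)

theorem triple_isOutput {b : ℕ} {A : ℕ → ℕ → ℕ} (hD : D.Valid) (hb : D.Fits b) (hln : D.l ≤ D.n)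
    (h0 : A 0 = D.inp) (hA : ∀ a ≠ 0, ∀ c, A a c = 0) :
    RAM.Triple b solveCmd (fun _ => 0) A (50 * (D.m * D.n * 2 ^ (D.k + D.dummies) +
      D.n ^ 2 * 3 ^ (D.k + D.dummies))) fun A' => D.IsOutput (A' 8) := by
  refine (triple_solveCmd hD hb hln h0 hA).mono le_rfl ?_
  rintro A' ⟨q, dm, hdm, ⟨h, hne⟩ | ⟨h, π, hπ, he⟩⟩
  · exact Or.inl ⟨h, fun π hπ => hne (hπ.exists_good hD hdm)⟩
  · exact Or.inr ⟨h, π, validPlan_of_good hD hdm hπ, he⟩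

end Layout

end WSP

/-! ### Encodings of workflows -/

theorem List.length_flatMap_of_forall {α β : Type*} {c : ℕ} {f : α → List β} {l : List α}
    (h : ∀ a ∈ l, (f a).length = c) : (l.flatMap f).length = l.length * c := by
  induction l with
  | nil => simp
  | cons a l ih =>
    rw [List.flatMap_cons, List.length_append, h a (by simp),
      ih fun x hx => h x (List.mem_cons_of_mem _ hx), List.length_cons]
    ring

theorem List.getD_flatMap_of_forall {α β : Type*} {c : ℕ} {f : α → List β} {l : List α}
    (h : ∀ a ∈ l, (f a).length = c) {i j : ℕ} (hi : i < l.length) (hj : j < c) (d : β) :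
    (l.flatMap f).getD (i * c + j) d = (f l[i]).getD j d := by
  induction l generalizing i with
  | nil => simp at hi
  | cons a l ih =>
    have ha := h a (by simp)
    rw [List.flatMap_cons]
    cases i with
    | zero => rw [List.getD_append _ _ _ _ (by omega)]; simp
    | succ i =>
      rw [List.getD_append_right _ _ _ _ (by rw [ha]; nlinarith), ha,
        show (i + 1) * c + j - c = i * c + j by
          rw [Nat.succ_mul]
          omega,
        ih (fun x hx => h x (List.mem_cons_of_mem _ hx)) (by simpa using hi)]
      simp

theorem List.getD_map_finRange {β : Type*} {k : ℕ} (f : Fin k → β) (s : Fin k) (d : β) :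
    ((List.finRange k).map f).getD s d = f s := by
  rw [List.getD_eq_getElem _ _ (by simp)]
  simp

namespace WSP

open Finset RAM

theorem bit_eq_one {p : Prop} : bit p = 1 ↔ p := by simp [bit]
theorem bit_eq_zero {p : Prop} : bit p = 0 ↔ ¬ p := by simp [bit]
theorem bit_le_one (p : Prop) : bit p ≤ 1 := by
  rw [bit]
  split_ifs <;> omega

namespace Constraint

variable {k ℓ : ℕ} (γ : Constraint k ℓ)

theorem length_encode : γ.encode.length = 2 + 2 * k := by
  simp [encode]
  omega

theorem getD_encode_mem₁ (s : Fin k) : γ.encode.getD (2 + s) 0 = bit (s ∈ γ.S₁) := by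
  rw [encode, List.getD_append _ _ _ _ (by simp; omega), List.getD_append_right _ _ _ _ (by simp),
    ← List.getD_map_finRange (fun s => bit (s ∈ γ.S₁)) s 0]
  simp

theorem getD_encode_mem₂ (s : Fin k) : γ.encode.getD (2 + k + s) 0 = bit (s ∈ γ.S₂) := by
  rw [encode, List.getD_append_right _ _ _ _ (by simp; omega),
    ← List.getD_map_finRange (fun s => bit (s ∈ γ.S₂)) s 0]
  congr 1
  simp
  omega

end Constraint

namespace Workflow

variable {W : Workflow} {w : List ℕ}

/-- The parts of an input that encodes a workflow with `m` constraints. -/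
def layout (W : Workflow) (w : List ℕ) (m : ℕ) : Layout := ⟨fun i => w.getD i 0, W.k, W.n, W.ℓ, m⟩

/-- The entries of an encoding. -/
structure Encoded (W : Workflow) (w : List ℕ) (block : Fin W.ℓ → Fin W.n → Fin W.n)
    (L : List (Constraint W.k W.ℓ)) : Prop where
  block_iff : ∀ i u v, block i u = block i v ↔ W.hier i u v
  nodup : L.Nodup
  mem_iff : ∀ γ, γ ∈ L ↔ γ ∈ W.constraints
  length : w.length = 4 + W.k * W.k + W.k * W.n + W.ℓ * W.n + L.length * (2 + 2 * W.k)
  k_eq : w.getD 0 0 = W.k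
  n_eq : w.getD 1 0 = W.n
  l_eq : w.getD 2 0 = W.ℓ
  m_eq : w.getD 3 0 = L.length
  auth : ∀ (s : Fin W.k) (u : Fin W.n), (W.layout w L.length).auth s u = bit (W.auth s u)
  block : ∀ (i : Fin W.ℓ) (u : Fin W.n), (W.layout w L.length).block i u = block i u
  record : ∀ j (hj : j < L.length), ∀ t < 2 + 2 * W.k,
    w.getD ((W.layout w L.length).record j + t) 0 = (L[j].encode).getD t 0
  mem_le : ∀ x ∈ w, x ≤ 1 ∨ x ≤ W.k ∨ x ≤ W.n ∨ x ≤ W.ℓ ∨ x ≤ L.length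

/-- Each part of the input is a concatenation of pieces of equal length, so positions can be
computed from `k`, `n`, `ℓ` and the number of constraints. -/
theorem IsEncoding.exists_encoded (h : W.IsEncoding w) : ∃ block L, W.Encoded w block L := by
  obtain ⟨block, L, h1, h2, h3, rfl⟩ := h
  have l1 : ((List.finRange W.k).flatMap fun s =>
      (List.finRange W.k).map fun s' => bit (W.stepOrder.le s s')).length = W.k * W.k := by
    rw [List.length_flatMap_of_forall (c := W.k) (by simp)]; simp
  have l2' : ∀ s ∈ List.finRange W.k,
      ((List.finRange W.n).map fun u => bit (W.auth s u)).length = W.n := by simp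
  have l2 : ((List.finRange W.k).flatMap fun s =>
      (List.finRange W.n).map fun u => bit (W.auth s u)).length = W.k * W.n := by
    rw [List.length_flatMap_of_forall l2']; simp
  have l3' : ∀ i ∈ List.finRange W.ℓ,
      ((List.finRange W.n).map fun u => (block i u : ℕ)).length = W.n := by simp
  have l3 : ((List.finRange W.ℓ).flatMap fun i =>
      (List.finRange W.n).map fun u => (block i u : ℕ)).length = W.ℓ * W.n := by
    rw [List.length_flatMap_of_forall l3']; simp
  have l4' : ∀ γ ∈ L, γ.encode.length = 2 + 2 * W.k := fun γ _ => γ.length_encode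
  have l4 := List.length_flatMap_of_forall l4'
  refine ⟨block, L, h1, h2, h3, ?_, rfl, rfl, rfl, rfl, fun s u => ?_, fun i u => ?_,
    fun j hj t ht => ?_, fun x hx => ?_⟩
  · simp only [List.length_append, l1, l2, l3, l4, List.length_cons, List.length_nil]
  · have hlt : (s : ℕ) * W.n + u < W.k * W.n := by
      have : ((s : ℕ) + 1) * W.n ≤ W.k * W.n := Nat.mul_le_mul_right _ s.2
      rw [Nat.succ_mul] at this
      omega
    simp only [Layout.auth, Layout.authAddr, layout]
    rw [List.getD_append _ _ _ _ (by simp only [List.length_append, l1, l2, l3,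
      List.length_cons, List.length_nil]; omega), List.getD_append _ _ _ _ (by
      simp only [List.length_append, l1, l2, List.length_cons, List.length_nil]; omega),
      List.getD_append_right _ _ _ _ (by
      simp only [List.length_append, l1, List.length_cons, List.length_nil]; omega)]
    rw [← List.getD_map_finRange (fun u => bit (W.auth s u)) u 0]
    convert List.getD_flatMap_of_forall l2' (i := s) (by simp) u.2 0 using 2
    · simp only [List.length_append, l1, List.length_cons, List.length_nil]; omega
    · simp
  · have hlt : (i : ℕ) * W.n + u < W.ℓ * W.n := by
      have : ((i : ℕ) + 1) * W.n ≤ W.ℓ * W.n := Nat.mul_le_mul_right _ i.2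
      rw [Nat.succ_mul] at this
      omega
    simp only [Layout.block, Layout.blockAddr, Layout.authAddr, layout]
    rw [List.getD_append _ _ _ _ (by simp only [List.length_append, l1, l2, l3,
      List.length_cons, List.length_nil]; omega), List.getD_append_right _ _ _ _ (by
      simp only [List.length_append, l1, l2, List.length_cons, List.length_nil]; omega)]
    rw [← List.getD_map_finRange (fun u => (block i u : ℕ)) u 0]
    convert List.getD_flatMap_of_forall l3' (i := i) (by simp) u.2 0 using 2
    · simp only [List.length_append, l1, l2, List.length_cons, List.length_nil]; omega
    · simp
  · simp only [Layout.record, Layout.recordsAddr, Layout.blockAddr, Layout.authAddr, layout]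
    rw [List.getD_append_right _ _ _ _ (by
      simp only [List.length_append, l1, l2, l3, List.length_cons, List.length_nil]; omega)]
    convert List.getD_flatMap_of_forall l4' hj ht 0 using 2
    simp only [List.length_append, l1, l2, l3, List.length_cons, List.length_nil]; omega
  · simp only [List.mem_append, List.mem_cons, List.not_mem_nil, or_false, List.mem_flatMap,
      List.mem_map, List.mem_finRange, true_and, Constraint.encode] at hx
    rcases hx with ((((rfl | rfl | rfl | rfl) | ⟨s, s', rfl⟩) | ⟨s, u, rfl⟩) | ⟨i, u, rfl⟩) |
      ⟨γ, -, ((rfl | rfl) | ⟨s, rfl⟩) | ⟨s, rfl⟩⟩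
    · simp
    · simp
    · simp
    · simp
    · exact Or.inl (bit_le_one _)
    · exact Or.inl (bit_le_one _)
    · exact Or.inr (Or.inr (Or.inl (block i u).2.le))
    · exact Or.inl (bit_le_one _)
    · exact Or.inr (Or.inr (Or.inr (Or.inl γ.level.2.le)))
    · exact Or.inl (bit_le_one _)
    · exact Or.inl (bit_le_one _)

namespace Encoded

variable {block : Fin W.ℓ → Fin W.n → Fin W.n} {L : List (Constraint W.k W.ℓ)}

theorem kind (h : W.Encoded w block L) {j : ℕ} (hj : j < L.length) :
    (W.layout w L.length).kind j = bit (L[j].same = false) := h.record j hj 0 (by omega)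

theorem level (h : W.Encoded w block L) {j : ℕ} (hj : j < L.length) :
    (W.layout w L.length).level j = L[j].level := h.record j hj 1 (by omega)

theorem mem₁ (h : W.Encoded w block L) {j : ℕ} (hj : j < L.length) (s : Fin W.k) :
    w.getD ((W.layout w L.length).record j + 2 + s) 0 = bit (s ∈ L[j].S₁) := by
  rw [add_assoc, h.record j hj _ (by omega), Constraint.getD_encode_mem₁]

theorem mem₂ (h : W.Encoded w block L) {j : ℕ} (hj : j < L.length) (s : Fin W.k) :
    w.getD ((W.layout w L.length).record j + 2 + W.k + s) 0 = bit (s ∈ L[j].S₂) := by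
  rw [show (W.layout w L.length).record j + 2 + W.k + s =
    (W.layout w L.length).record j + (2 + W.k + s) by omega, h.record j hj _ (by omega),
    Constraint.getD_encode_mem₂]

theorem S₁ (h : W.Encoded w block L) {j : ℕ} (hj : j < L.length) :
    (W.layout w L.length).S₁ j = L[j].S₁.map Fin.valEmbedding := by
  ext s
  simp only [Layout.S₁, mem_filter, mem_range, mem_map, Fin.valEmbedding_apply]
  constructor
  · rintro ⟨hs, he⟩
    exact ⟨⟨s, hs⟩, bit_eq_one.1 ((h.mem₁ hj ⟨s, hs⟩).symm.trans he), rfl⟩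
  · rintro ⟨s, hs, rfl⟩
    exact ⟨s.2, (h.mem₁ hj s).trans (bit_eq_one.2 hs)⟩

theorem S₂ (h : W.Encoded w block L) {j : ℕ} (hj : j < L.length) :
    (W.layout w L.length).S₂ j = L[j].S₂.map Fin.valEmbedding := by
  ext s
  simp only [Layout.S₂, mem_filter, mem_range, mem_map, Fin.valEmbedding_apply]
  constructor
  · rintro ⟨hs, he⟩
    exact ⟨⟨s, hs⟩, bit_eq_one.1 ((h.mem₂ hj ⟨s, hs⟩).symm.trans he), rfl⟩
  · rintro ⟨s, hs, rfl⟩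
    exact ⟨s.2, (h.mem₂ hj s).trans (bit_eq_one.2 hs)⟩

theorem valid (h : W.Encoded w block L) (hW : W.IsCanonical) : (W.layout w L.length).Valid where
  k_eq := h.k_eq
  n_eq := h.n_eq
  l_eq := h.l_eq
  m_eq := h.m_eq
  n_pos := W.n_pos
  l_pos := hW.ℓ_pos
  auth_le s hs u hu := (h.auth ⟨s, hs⟩ ⟨u, hu⟩).trans_le (bit_le_one _)
  block_lt i hi u hu := (h.block ⟨i, hi⟩ ⟨u, hu⟩).trans_lt (block ⟨i, hi⟩ ⟨u, hu⟩).2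
  kind_le j hj := (h.kind hj).trans_le (bit_le_one _)
  level_lt j hj := (h.level hj).trans_lt L[j].level.2
  mem₁_le j hj s hs := (h.mem₁ hj ⟨s, hs⟩).trans_le (bit_le_one _)
  mem₂_le j hj s hs := (h.mem₂ hj ⟨s, hs⟩).trans_le (bit_le_one _)
  refines i hi u hu v hv he := by
    have hi' : i < W.ℓ := Nat.lt_of_succ_lt hi
    have h1 := h.block ⟨i, hi'⟩ ⟨u, hu⟩
    have h2 := h.block ⟨i, hi'⟩ ⟨v, hv⟩
    have h3 := h.block ⟨i + 1, hi⟩ ⟨u, hu⟩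
    have h4 := h.block ⟨i + 1, hi⟩ ⟨v, hv⟩
    simp only at h1 h2 h3 h4
    rw [h1, h2, Fin.val_inj, h.block_iff] at he
    rw [h3, h4, Fin.val_inj, h.block_iff]
    exact W.hier_refines ⟨i, hi'⟩ ⟨i + 1, hi⟩ rfl he
  last u hu v hv := by
    have hl : W.ℓ - 1 < W.ℓ := Nat.sub_lt hW.ℓ_pos one_pos
    have h1 := h.block ⟨W.ℓ - 1, hl⟩ ⟨u, hu⟩
    have h2 := h.block ⟨W.ℓ - 1, hl⟩ ⟨v, hv⟩
    refine h1.trans (Eq.trans ?_ h2.symm)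
    rw [Fin.val_inj, h.block_iff, hW.last ⟨W.ℓ - 1, hl⟩ (Nat.sub_add_cancel hW.ℓ_pos)]
    trivial

theorem block_eq_iff (h : W.Encoded w block L) {j : ℕ} (hj : j < L.length) (u v : Fin W.n) :
    (W.layout w L.length).block ((W.layout w L.length).level j) u =
      (W.layout w L.length).block ((W.layout w L.length).level j) v ↔ W.hier L[j].level u v := by
  rw [h.level hj, h.block, h.block, Fin.val_inj, h.block_iff]

theorem validPlan_iff (h : W.Encoded w block L) (f : ℕ → ℕ) (π : Fin W.k → Fin W.n)
    (hf : ∀ s : Fin W.k, f s = π s) : (W.layout w L.length).ValidPlan f ↔ W.IsValid π := by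
  have hkind : ∀ j (hj : j < L.length), (W.layout w L.length).kind j = 0 ↔ L[j].same = true := by
    intro j hj
    rw [h.kind hj, bit_eq_zero, Bool.not_eq_false]
  constructor
  · intro hp
    refine ⟨fun s => ?_, fun γ hγ => ?_⟩
    · have := hp.auth s s.2
      rwa [hf, h.auth, bit_eq_one] at this
    · obtain ⟨j, hj, rfl⟩ := List.getElem_of_mem ((h.mem_iff γ).2 hγ)
      rw [Constraint.Sat]
      cases hs : L[j].same
      · obtain ⟨s₁, hs₁, s₂, hs₂, he⟩ := hp.differ j hj (fun h0 => by
          rw [(hkind j hj).1 h0] at hs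
          exact absurd hs (by simp))
        rw [h.S₁ hj, mem_map] at hs₁
        rw [h.S₂ hj, mem_map] at hs₂
        obtain ⟨s₁, hs₁, rfl⟩ := hs₁
        obtain ⟨s₂, hs₂, rfl⟩ := hs₂
        simp only [Fin.valEmbedding_apply, hf] at he
        exact ⟨s₁, hs₁, s₂, hs₂, fun h' => he ((h.block_eq_iff hj _ _).2 h')⟩
      · obtain ⟨s₁, hs₁, s₂, hs₂, he⟩ := hp.same j hj ((hkind j hj).2 hs)
        rw [h.S₁ hj, mem_map] at hs₁
        rw [h.S₂ hj, mem_map] at hs₂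
        obtain ⟨s₁, hs₁, rfl⟩ := hs₁
        obtain ⟨s₂, hs₂, rfl⟩ := hs₂
        simp only [Fin.valEmbedding_apply, hf] at he
        exact ⟨s₁, hs₁, s₂, hs₂, (h.block_eq_iff hj _ _).1 he⟩
  · rintro ⟨h1, h2⟩
    have hsat : ∀ j (hj : j < L.length), L[j].Sat W.hier π := fun j hj =>
      h2 _ ((h.mem_iff _).1 (List.getElem_mem hj))
    refine ⟨fun s hs => (hf ⟨s, hs⟩).trans_lt (π ⟨s, hs⟩).2, fun s hs => ?_, fun j hj hk => ?_,
      fun j hj hk => ?_⟩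
    · have := h.auth ⟨s, hs⟩ (π ⟨s, hs⟩)
      rw [← hf] at this
      exact this.trans (bit_eq_one.2 (h1 _))
    · have hs := hsat j hj
      rw [Constraint.Sat, (hkind j hj).1 hk] at hs
      obtain ⟨s₁, hs₁, s₂, hs₂, he⟩ := hs
      refine ⟨s₁, ?_, s₂, ?_, ?_⟩
      · rw [h.S₁ hj]; exact mem_map_of_mem _ hs₁
      · rw [h.S₂ hj]; exact mem_map_of_mem _ hs₂
      · rw [hf, hf]; exact (h.block_eq_iff hj _ _).2 he
    · have hs := hsat j hj
      have hk' : L[j].same = false := by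
        rw [← Bool.not_eq_true]
        exact fun h' => hk ((hkind j hj).2 h')
      rw [Constraint.Sat, hk'] at hs
      obtain ⟨s₁, hs₁, s₂, hs₂, he⟩ := hs
      refine ⟨s₁, ?_, s₂, ?_, ?_⟩
      · rw [h.S₁ hj]; exact mem_map_of_mem _ hs₁
      · rw [h.S₂ hj]; exact mem_map_of_mem _ hs₂
      · rw [hf, hf]; exact fun h' => he ((h.block_eq_iff hj _ _).1 h')

theorem isAnswer (h : W.Encoded w block L) {g : ℕ → ℕ} (hg : (W.layout w L.length).IsOutput g)
    {τ : State} (hτ : ∀ s ≤ W.k, τ.mem s = g s) : W.IsAnswer τ := by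
  rcases hg with ⟨h0, hno⟩ | ⟨h1, f, hf, hfg⟩
  · refine Or.inl ⟨(hτ 0 (Nat.zero_le _)).trans h0, fun π hπ =>
      hno (fun s => if hs : s < W.k then π ⟨s, hs⟩ else 0) ((h.validPlan_iff _ π ?_).2 hπ)⟩
    intro s
    rw [dif_pos s.2]
  · refine Or.inr ⟨(hτ 0 (Nat.zero_le _)).trans h1, fun s => ⟨f s, hf.lt s s.2⟩,
      (h.validPlan_iff f _ fun _ => rfl).1 hf, fun s => ?_⟩
    exact (hτ _ s.2).trans (hfg s s.2)

theorem length_eq (h : W.Encoded w block L) : L.length = W.numOther + W.numSim3 := by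
  classical
  have : L.toFinset = W.constraints := by
    ext γ
    rw [List.mem_toFinset, h.mem_iff]
  rw [← List.toFinset_card_of_nodup h.nodup, this, numOther, numSim3, add_comm,
    card_filter_add_card_filter_not]

theorem card_sim3 (h : W.Encoded w block L) : (W.layout w L.length).sim3.card = W.numSim3 := by
  have hm : ∀ j (hj : j < L.length),
      j ∈ (W.layout w L.length).sim3 ↔ L[j].IsSim3 := by
    intro j hj
    rw [Layout.sim3, mem_filter, h.kind hj, h.S₁ hj, h.S₂ hj, card_map, card_map, bit_eq_zero,
      Bool.not_eq_false, mem_range, Constraint.IsSim3, Constraint.IsType2, not_or]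
    exact and_iff_right hj
  have hlt : ∀ j ∈ (W.layout w L.length).sim3, j < L.length := fun j hj =>
    mem_range.1 (mem_filter.1 hj).1
  refine card_bij (fun j hj => L[j]'(hlt j hj)) (fun j hj => ?_) (fun i hi j hj hij => ?_)
    fun γ hγ => ?_
  · exact mem_filter.2 ⟨(h.mem_iff _).1 (List.getElem_mem _), (hm j (hlt j hj)).1 hj⟩
  · exact (h.nodup.getElem_inj_iff).1 hij
  · obtain ⟨hγ, hs⟩ := mem_filter.1 hγ
    obtain ⟨j, hj, rfl⟩ := List.getElem_of_mem ((h.mem_iff γ).2 hγ)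
    exact ⟨j, (hm j hj).2 hs, rfl⟩

end Encoded

/-- A canonical hierarchy has at most as many levels as there are users. -/
theorem IsCanonical.ℓ_le (hW : W.IsCanonical) : W.ℓ ≤ W.n := by
  -- A coarser relation has a quotient onto which the finer quotient maps. If the numbers of classes
  -- agreed, this surjection would be injective and the relations equal.
  have hlt : ∀ r s : Setoid (Fin W.n), r ≤ s → r ≠ s →
      Nat.card (Quotient s) < Nat.card (Quotient r) := by
    intro r s hrs hne
    have hsurj : Function.Surjective (Quotient.map' (s₁ := r) (s₂ := s) id fun _ _ h => hrs h) := by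
      intro q
      induction q using Quotient.inductionOn' with
      | h a => exact ⟨Quotient.mk'' a, rfl⟩
    refine lt_of_not_ge fun hle => hne (le_antisymm hrs fun {a c} hac => ?_)
    have := (hsurj.bijective_of_nat_card_le hle).1 (a₁ := Quotient.mk'' a) (a₂ := Quotient.mk'' c)
      (Quotient.sound' hac)
    exact Quotient.exact' this
  -- At least one class is lost at each level, and at the last level there is still one.
  have key : ∀ i (hi : i < W.ℓ), Nat.card (Quotient (W.hier ⟨i, hi⟩)) + i ≤ W.n := by
    intro i
    induction i with
    | zero =>
      intro hi
      have := Nat.card_le_card_of_surjective (Quotient.mk (W.hier ⟨0, hi⟩)) Quotient.mk_surjective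
      rw [Nat.card_fin] at this
      exact this
    | succ i ih =>
      intro hi
      have h1 := ih (by omega)
      have h2 := hlt _ _ (W.hier_refines ⟨i, by omega⟩ ⟨i + 1, hi⟩ rfl)
        (hW.ne_succ ⟨i, by omega⟩ ⟨i + 1, hi⟩ rfl)
      omega
  have hl := hW.ℓ_pos
  have h1 := key (W.ℓ - 1) (by omega)
  have h2 : 0 < Nat.card (Quotient (W.hier ⟨W.ℓ - 1, by omega⟩)) := by
    have : Nonempty (Quotient (W.hier ⟨W.ℓ - 1, by omega⟩)) := ⟨Quotient.mk'' ⟨0, W.n_pos⟩⟩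
    exact Nat.card_pos
  omega

end Workflow

end WSP

/-! ### Running time -/

namespace WSP

open Finset RAM

/-- The cell `i` of the memory. -/
def cellE (i : ℕ) : Expr := .load (.lit i)

/-- The length of an input. -/
def lengthE : Expr :=
  .add (.add (.add (.add (.lit 4) (.mul (cellE 0) (cellE 0))) (.mul (cellE 0) (cellE 1)))
    (.mul (cellE 2) (cellE 1))) (.mul (cellE 3) (.add (.lit 2) (.mul (.lit 2) (cellE 0))))

/-- The partial sums and the main products are bounded by the final value, hence have at most `b`
bits. Only the five products are charged quadratically. -/
theorem cost_lengthE_le {σ : State} {b : ℕ} (hb : 2 ≤ b) (h : lengthE.eval σ < 2 ^ b)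
    (h0 : σ.mem 0 < 2 ^ b) (h1 : σ.mem 1 < 2 ^ b) (h2 : σ.mem 2 < 2 ^ b) (h3 : σ.mem 3 < 2 ^ b)
    (h4 : 2 + 2 * σ.mem 0 < 2 ^ b) : lengthE.cost σ ≤ 40 * (b + 2) ^ 2 := by
  simp only [lengthE, cellE, Expr.eval] at h
  have s0 := Nat.size_le.2 h0
  have s1 := Nat.size_le.2 h1
  have s2 := Nat.size_le.2 h2
  have s3 := Nat.size_le.2 h3
  have s4 := Nat.size_le.2 h4
  have s5 : (2 * σ.mem 0).size ≤ b := Nat.size_le.2 (by omega)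
  have z0 : (0 : ℕ).size ≤ 2 := Nat.size_le.2 (by norm_num)
  have z1 : (1 : ℕ).size ≤ 2 := Nat.size_le.2 (by norm_num)
  have z2 : (2 : ℕ).size ≤ 2 := Nat.size_le.2 (by norm_num)
  have z3 : (3 : ℕ).size ≤ 2 := Nat.size_le.2 (by norm_num)
  have z4 : (4 : ℕ).size ≤ 3 := Nat.size_le.2 (by norm_num)
  have t1 : (σ.mem 0 * σ.mem 0).size ≤ b := Nat.size_le.2 (by omega)
  have t2 : (σ.mem 0 * σ.mem 1).size ≤ b := Nat.size_le.2 (by omega)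
  have t3 : (σ.mem 2 * σ.mem 1).size ≤ b := Nat.size_le.2 (by omega)
  have t4 : (σ.mem 3 * (2 + 2 * σ.mem 0)).size ≤ b := Nat.size_le.2 (by omega)
  have t5 : (4 + σ.mem 0 * σ.mem 0).size ≤ b := Nat.size_le.2 (by omega)
  have t6 : (4 + σ.mem 0 * σ.mem 0 + σ.mem 0 * σ.mem 1).size ≤ b := Nat.size_le.2 (by omega)
  have t7 : (4 + σ.mem 0 * σ.mem 0 + σ.mem 0 * σ.mem 1 + σ.mem 2 * σ.mem 1).size ≤ b :=
    Nat.size_le.2 (by omega)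
  have p : ∀ x y, x ≤ b → y ≤ b → (x + 1) * (y + 1) ≤ (b + 1) * (b + 1) := fun x y hx hy =>
    Nat.mul_le_mul (by omega) (by omega)
  have p1 := p _ _ s0 s0
  have p2 := p _ _ s0 s1
  have p3 := p _ _ s2 s1
  have p4 := p _ _ s3 s4
  have p5 := p _ _ (z2.trans hb) s0
  have e : 40 * (b + 2) ^ 2 = 40 * ((b + 1) * (b + 1)) + 80 * b + 120 := by ring
  rw [e]
  simp only [lengthE, cellE, Expr.cost, Expr.eval]
  have : b ≤ (b + 1) * (b + 1) := (Nat.le_succ b).trans (Nat.le_mul_of_pos_right _ b.succ_pos)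
  omega

theorem quadratic_le_three_pow (k : ℕ) : k * k + k + 1 ≤ 3 ^ k := by
  induction k with
  | zero => simp
  | succ k ih =>
    rw [pow_succ]
    nlinarith

namespace Workflow

variable {W : Workflow} {w : List ℕ} {block : Fin W.ℓ → Fin W.n → Fin W.n}
  {L : List (Constraint W.k W.ℓ)}

/-- Bound for the number of steps of the dynamic program with at most `q` dummy steps. -/
def work (W : Workflow) (q : ℕ) : ℕ :=
  (W.numOther + W.numSim3) * W.n * 2 ^ (W.k + q) + W.n ^ 2 * 3 ^ (W.k + q)

/-- Number of bits that suffice for all values. -/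
def bits (W : Workflow) (q : ℕ) : ℕ :=
  (2 * (W.k + q) + 8) * (W.n.size + (W.numOther + W.numSim3).size + 4)

theorem work_mono {q q' : ℕ} (h : q ≤ q') : W.work q ≤ W.work q' := by
  rw [work, work]
  gcongr <;> norm_num

namespace Encoded

theorem length_lt (h : W.Encoded w block L) (hW : W.IsCanonical) (q : ℕ) :
    w.length < 2 ^ W.bits q := by
  have hn := Nat.lt_size_self W.n
  have hm := Nat.lt_size_self (W.numOther + W.numSim3)
  have hk : W.k + 1 ≤ 2 ^ W.k := Nat.lt_two_pow_self
  have hl := hW.ℓ_le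
  rw [← h.length_eq] at hm
  rw [h.length]
  set P := 2 ^ W.n.size
  set M := 2 ^ L.length.size
  set G := 2 ^ W.k
  have hP : 1 ≤ P := Nat.one_le_two_pow
  have hM : 1 ≤ M := Nat.one_le_two_pow
  have hG : 1 ≤ G := Nat.one_le_two_pow
  -- The parts of the input add up to at most nine times the monomial `G * G * P * P * M`; the
  -- factor `16` leaves room for strictness.
  have big : G * G * P * P * M * 16 ≤ 2 ^ W.bits q := by
    have : G * G * P * P * M * 16 =
        2 ^ (W.k + W.k + W.n.size + W.n.size + L.length.size + 4) := by
      simp only [pow_add, G, P, M]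
      norm_num
    rw [this]
    refine Nat.pow_le_pow_right (by norm_num) ?_
    rw [bits, h.length_eq, show ∀ x s t, (2 * x + 8) * (s + t + 4) =
      2 * x * s + 2 * x * t + 8 * x + 8 * s + 8 * t + 32 from fun x s t => by ring]
    omega
  have b1 : W.k * W.k ≤ G * G := Nat.mul_le_mul (by omega) (by omega)
  have b2 : W.k * W.n ≤ G * P := Nat.mul_le_mul (by omega) (by omega)
  have b3 : W.ℓ * W.n ≤ P * P := Nat.mul_le_mul (by omega) (by omega)
  have b4 : L.length * (2 + 2 * W.k) ≤ M * (2 * G) := Nat.mul_le_mul (by omega) (by omega)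
  have c1 : 1 ≤ G * G * P * P * M := by
    calc 1 = 1 * 1 * 1 * 1 * 1 := by norm_num
      _ ≤ _ := by gcongr
  have c2 : G * G ≤ G * G * P * P * M := by
    calc G * G = G * G * 1 * 1 * 1 := by ring
      _ ≤ _ := by gcongr
  have c3 : G * P ≤ G * G * P * P * M := by
    calc G * P = G * 1 * P * 1 * 1 := by ring
      _ ≤ _ := by gcongr
  have c4 : P * P ≤ G * G * P * P * M := by
    calc P * P = 1 * 1 * P * P * 1 := by ring
      _ ≤ _ := by gcongr
  have c5 : M * G ≤ G * G * P * P * M := by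
    calc M * G = G * 1 * 1 * 1 * M := by ring
      _ ≤ _ := by gcongr
  have c6 : M * (2 * G) = 2 * (M * G) := by ring
  omega

theorem fits (h : W.Encoded w block L) (hW : W.IsCanonical) :
    (W.layout w L.length).Fits (W.bits (W.layout w L.length).dummies) := by
  set q := (W.layout w L.length).dummies
  set s := W.n.size with hs
  set t := (W.numOther + W.numSim3).size with ht
  have hb : W.bits q = 2 * (W.k + q) * s + 2 * (W.k + q) * t + 8 * (W.k + q) + 8 * s + 8 * t + 32 := by
    rw [bits]; ring
  have hn : W.n < 2 ^ s := Nat.lt_size_self W.n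
  have hm : W.numOther + W.numSim3 < 2 ^ t := Nat.lt_size_self _
  have hle : ∀ e, e ≤ W.bits q → 2 ^ e ≤ 2 ^ W.bits q := fun e he =>
    Nat.pow_le_pow_right (by norm_num) he
  have hlen := h.length_lt hW q
  rw [h.length] at hlen
  have x1 : (W.k + q) * s ≤ 2 * (W.k + q) * s := Nat.mul_le_mul_right _ (by omega)
  refine ⟨?_, hn.trans_le (hle _ (by omega)), ?_, ?_, ?_, ?_, ?_⟩
  · change W.k + q + 1 ≤ W.bits q
    omega
  -- Codes of plans need about `(k + q) * s` bits; this is why `bits` is a product and not a sum of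
  -- logarithms.
  · change W.n ^ (W.k + q) < _
    refine lt_of_lt_of_le ?_ (hle ((W.k + q) * s + 1) (by omega))
    calc W.n ^ (W.k + q) ≤ (2 ^ s) ^ (W.k + q) := Nat.pow_le_pow_left hn.le _
      _ = 2 ^ ((W.k + q) * s) := by rw [← pow_mul, mul_comm]
      _ < 2 ^ ((W.k + q) * s + 1) := Nat.pow_lt_pow_right (by norm_num) (by omega)
  · rw [← h.length_eq] at hm
    exact hm.trans_le (hle _ (by omega))
  · change 4 ^ (W.k + q) < _
    rw [show 4 = 2 ^ 2 from rfl, ← pow_mul]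
    exact Nat.pow_lt_pow_right (by norm_num) (by omega)
  · change (W.ℓ + 1) * W.n < _
    refine lt_of_lt_of_le ?_ (hle (s + s) (by omega))
    have := hW.ℓ_le
    have := W.n_pos
    rw [pow_add]
    calc (W.ℓ + 1) * W.n ≤ 2 ^ s * W.n := Nat.mul_le_mul_right _ (by omega)
      _ < 2 ^ s * 2 ^ s := Nat.mul_lt_mul_of_pos_left hn (by positivity)
  · refine lt_of_le_of_lt ?_ hlen
    simp only [Layout.recordsAddr, Layout.blockAddr, Layout.authAddr, layout]
    omega

theorem word_lt (h : W.Encoded w block L) (hW : W.IsCanonical) (q i : ℕ) :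
    w.getD i 0 < 2 ^ W.bits q := by
  have hlen := h.length_lt hW q
  have h1 := h.length
  have hn := W.n_pos
  have hl := hW.ℓ_pos
  have hk : W.k ≤ W.k * W.n := Nat.le_mul_of_pos_right _ hn
  have hn' : W.n ≤ W.ℓ * W.n := Nat.le_mul_of_pos_left _ hl
  have hl' : W.ℓ ≤ W.ℓ * W.n := Nat.le_mul_of_pos_right _ hn
  have hm : L.length ≤ L.length * (2 + 2 * W.k) := Nat.le_mul_of_pos_right _ (by omega)
  by_cases hi : i < w.length
  · rw [List.getD_eq_getElem _ _ hi]
    have := h.mem_le _ (List.getElem_mem hi)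
    omega
  · rw [List.getD_eq_default _ _ (by omega)]
    positivity

/-- Reading the input is no more expensive than the dynamic program: polynomials in `k` are
dominated by `2 ^ k` and `3 ^ k`, and the table of blocks has at most `n ^ 2` entries. -/
theorem length_le_work (h : W.Encoded w block L) (hW : W.IsCanonical) (q : ℕ) :
    w.length + 1 ≤ 8 * W.work q := by
  have hn := W.n_pos
  have h3 : W.k * W.k + W.k + 1 ≤ 3 ^ (W.k + q) :=
    (quadratic_le_three_pow W.k).trans (Nat.pow_le_pow_right (by norm_num) (by omega))
  have h2 : W.k + 1 ≤ 2 ^ (W.k + q) :=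
    (Nat.lt_two_pow_self).trans_le (Nat.pow_le_pow_right (by norm_num) (by omega))
  have b1 : W.n ^ 2 * (W.k * W.k + W.k + 1) ≤ W.n ^ 2 * 3 ^ (W.k + q) := Nat.mul_le_mul_left _ h3
  have b2 : L.length * W.n * (W.k + 1) ≤ L.length * W.n * 2 ^ (W.k + q) := Nat.mul_le_mul_left _ h2
  have b3 : L.length * (W.k + 1) ≤ L.length * W.n * (W.k + 1) :=
    Nat.mul_le_mul_right _ (Nat.le_mul_of_pos_right _ hn)
  have b4 : W.k * W.k + W.k + 1 ≤ W.n ^ 2 * (W.k * W.k + W.k + 1) :=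
    Nat.le_mul_of_pos_left _ (by positivity)
  have b5 : W.k * W.n ≤ W.n ^ 2 * W.k := by
    rw [mul_comm]; exact Nat.mul_le_mul_right _ (Nat.le_self_pow (by norm_num) _)
  have b6 : W.ℓ * W.n ≤ W.n ^ 2 := by rw [sq]; exact Nat.mul_le_mul_right _ hW.ℓ_le
  have e1 : W.n ^ 2 * (W.k * W.k + W.k + 1) = W.n ^ 2 * (W.k * W.k) + W.n ^ 2 * W.k + W.n ^ 2 := by
    ring
  have e2 : L.length * (2 + 2 * W.k) = 2 * (L.length * (W.k + 1)) := by ring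
  rw [h.length, work, ← h.length_eq, e2]
  omega

/-- The minimum is kept in the bound, since the running time uses one of its arguments and
fixed-parameter tractability the other. -/
theorem exists_exec (h : W.Encoded w block L) (hW : W.IsCanonical) :
    ∃ τ t, Exec (machine lengthE solveCmd) (init w) τ t ∧ W.IsAnswer τ ∧
      t ≤ W.work (min W.numSim3 (4 ^ W.k)) * (1300 *
        (W.bits (min W.numSim3 (4 ^ W.k)) + 2) ^ (solveCmd.weight + 2)) := by
  have hq : (W.layout w L.length).dummies = min W.numSim3 (4 ^ W.k) := by
    rw [Layout.dummies, h.card_sim3]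
    rfl
  have hfits := h.fits hW
  rw [hq] at hfits
  set q := min W.numSim3 (4 ^ W.k)
  set b := W.bits q with hbdef
  have hlen : w.length < 2 ^ b := h.length_lt hW q
  have hword : ∀ i, w.getD i 0 < 2 ^ b := h.word_lt hW q
  have hE : lengthE.eval (init w) = w.length := by
    simp only [lengthE, cellE, Expr.eval, init, h.k_eq, h.n_eq, h.l_eq, h.m_eq]
    exact h.length.symm
  have hb2 : 2 ≤ b := by
    rw [hbdef, bits]
    exact Nat.mul_le_mul (by omega : 2 ≤ _) (by omega : 1 ≤ _)
  have hkl : 2 + 2 * W.k ≤ w.length := by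
    rw [h.length]
    have := two_mul_le_add_sq W.k 1
    rw [sq, one_pow, mul_one] at this
    omega
  have hcost : lengthE.cost (init w) ≤ 40 * (b + 2) ^ 2 := by
    refine cost_lengthE_le hb2 (by rw [hE]; exact hlen) (hword 0) (hword 1) (hword 2) (hword 3) ?_
    change 2 + 2 * w.getD 0 0 < 2 ^ b
    rw [h.k_eq]
    omega
  obtain ⟨τ, t, A, hexec, ht, hA, hτ⟩ := exec_machine wf_solveCmd zero_notMem_writes_solveCmd hE
    hcost hlen hword h.k_eq (by omega)
    (Layout.triple_isOutput (h.valid hW) hfits hW.ℓ_le (A := inputArrays w)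
      (by funext i; simp [inputArrays, layout]) (by intro a ha c; simp [inputArrays, ha]))
  refine ⟨τ, t, hexec, h.isAnswer hA hτ, ht.trans ?_⟩
  have hwork : (W.layout w L.length).m * (W.layout w L.length).n *
      2 ^ ((W.layout w L.length).k + (W.layout w L.length).dummies) + (W.layout w L.length).n ^ 2 *
      3 ^ ((W.layout w L.length).k + (W.layout w L.length).dummies) = W.work q := by
    rw [hq, work, ← h.length_eq]
    rfl
  rw [hwork]
  have hlw := h.length_le_work hW q
  have hX : 1 ≤ W.work q := by omega
  set X := W.work q
  set B := b + 2 with hB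
  have hB1 : 1 ≤ B := by omega
  have e1 : B ^ 2 ≤ B ^ (solveCmd.weight + 2) := Nat.pow_le_pow_right hB1 (by omega)
  have e2 : B ^ solveCmd.weight ≤ B ^ (solveCmd.weight + 2) := Nat.pow_le_pow_right hB1 (by omega)
  have e3 : B ≤ B ^ (solveCmd.weight + 2) := Nat.le_self_pow (by omega) _
  set Y := B ^ (solveCmd.weight + 2)
  -- The three terms come from computing the input length, from the dynamic program, and from
  -- copying; `40 + 50 + 8 * 140 = 1210`.
  calc 40 * B ^ 2 + 50 * X * B ^ solveCmd.weight + (w.length + 1) * (140 * B)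
      ≤ 40 * (X * Y) + 50 * X * Y + 8 * X * (140 * Y) := by
        gcongr
        exact e1.trans (Nat.le_mul_of_pos_left _ hX)
    _ ≤ X * (1300 * Y) := by
        calc 40 * (X * Y) + 50 * X * Y + 8 * X * (140 * Y) = X * (1210 * Y) := by ring
          _ ≤ X * (1300 * Y) := by gcongr; norm_num

end Encoded

theorem exists_solvedBy : ∃ (p : Prog) (d : ℕ), 1 ≤ d ∧
    wsp3.SolvedBy p fun W _ => W.1.work (min W.1.numSim3 (4 ^ W.1.k)) *
      (1300 * (W.1.bits (min W.1.numSim3 (4 ^ W.1.k)) + 2) ^ d) := by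
  refine ⟨machine lengthE solveCmd, solveCmd.weight + 2, by omega, fun W w hw => ?_⟩
  obtain ⟨block, L, h⟩ := IsEncoding.exists_encoded hw
  exact h.exists_exec W.2

/-- The time bound `T` dominates `2 ^ (k + q)`, `n` and the number of constraints. Hence `k + q` and
the lengths of the other two are `O(log T)`, and the number of bits is `O(log² T)`; this is why the
exponent of the logarithm is `2 * d`. -/
theorem solvableInSoftO : wsp3.SolvableInSoftO fun W => W.1.timeBound := by
  obtain ⟨p, d, -, hp⟩ := exists_solvedBy
  refine ⟨p, 1300 * 82 ^ d, 2 * d, fun W w hw => ?_⟩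
  obtain ⟨τ, t, h1, h2, h3⟩ := hp W w hw
  refine ⟨τ, t, h1, h2, h3.trans ?_⟩
  obtain ⟨W, hW⟩ := W
  simp only
  set q := min W.numSim3 (4 ^ W.k)
  set T := W.timeBound with hT
  set g := Nat.log 2 (T + 2) with hg
  have hq : q ≤ W.numSim3 := min_le_left _ _
  have hwork : W.work q ≤ T := by
    refine (work_mono hq).trans ?_
    rw [work, hT, timeBound]
    gcongr
    omega
  have hlt : T + 2 < 2 ^ (g + 1) := Nat.lt_pow_succ_log_self (by norm_num) _
  have hn := W.n_pos
  have hg1 : 1 ≤ g := (Nat.le_log_iff_pow_le (by norm_num) (by omega)).2 (by omega)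
  have hT1 : W.n ^ 2 * 3 ^ (W.k + W.numSim3) ≤ T := Nat.le_add_left _ _
  have hT2 : (W.numOther + 2 * W.numSim3) * W.n * 2 ^ (W.k + W.numSim3) ≤ T := Nat.le_add_right _ _
  have hkg : W.k + q ≤ g := by
    refine (Nat.le_log_iff_pow_le (by norm_num) (by omega)).2 ?_
    calc 2 ^ (W.k + q) ≤ 3 ^ (W.k + W.numSim3) :=
          (Nat.pow_le_pow_left (by norm_num) _).trans (Nat.pow_le_pow_right (by norm_num) (by omega))
      _ ≤ W.n ^ 2 * 3 ^ (W.k + W.numSim3) := Nat.le_mul_of_pos_left _ (by positivity)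
      _ ≤ T + 2 := by omega
  have hng : W.n.size ≤ g + 1 := by
    refine Nat.size_le.2 (lt_of_le_of_lt ?_ hlt)
    calc W.n ≤ W.n ^ 2 := Nat.le_self_pow (by norm_num) _
      _ ≤ W.n ^ 2 * 3 ^ (W.k + W.numSim3) := Nat.le_mul_of_pos_right _ (by positivity)
      _ ≤ T + 2 := by omega
  have hmg : (W.numOther + W.numSim3).size ≤ g + 1 := by
    refine Nat.size_le.2 (lt_of_le_of_lt ?_ hlt)
    calc W.numOther + W.numSim3 ≤ W.numOther + 2 * W.numSim3 := by omega
      _ ≤ (W.numOther + 2 * W.numSim3) * W.n := Nat.le_mul_of_pos_right _ hn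
      _ ≤ (W.numOther + 2 * W.numSim3) * W.n * 2 ^ (W.k + W.numSim3) :=
          Nat.le_mul_of_pos_right _ (by positivity)
      _ ≤ T + 2 := by omega
  -- As `k + q ≤ g`, both lengths are at most `g + 1`, and `1 ≤ g`, the two factors of `bits` are at
  -- most `10 g` and `8 g`.
  have hbits : W.bits q + 2 ≤ 82 * g ^ 2 := by
    calc W.bits q + 2 ≤ (10 * g) * (8 * g) + 2 * g ^ 2 := by
          rw [bits]
          gcongr
          · omega
          · omega
          · nlinarith
      _ = 82 * g ^ 2 := by ring
  calc W.work q * (1300 * (W.bits q + 2) ^ d) ≤ T * (1300 * (82 * g ^ 2) ^ d) := by gcongr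
    _ = 1300 * 82 ^ d * (T * g ^ (2 * d)) := by rw [mul_pow, pow_mul]; ring

theorem computable_bound (c d : ℕ) : Computable fun k : ℕ =>
    c * 3 ^ (k + 4 ^ k) * (6 * (2 * (k + 4 ^ k) + 9)) ^ d := by
  have hpow : Primrec₂ fun a b : ℕ => a ^ b := Primrec₂.unpaired'.1 Nat.Primrec.pow
  have hadd : Primrec₂ fun a b : ℕ => a + b := Primrec.nat_add
  have hmul : Primrec₂ fun a b : ℕ => a * b := Primrec.nat_mul
  have h1 : Primrec fun k : ℕ => k + 4 ^ k :=
    hadd.comp Primrec.id (hpow.comp (Primrec.const 4) Primrec.id)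
  have h2 : Primrec fun k : ℕ => 6 * (2 * (k + 4 ^ k) + 9) :=
    hmul.comp (Primrec.const 6) (hadd.comp (hmul.comp (Primrec.const 2) h1) (Primrec.const 9))
  exact (hmul.comp (hmul.comp (Primrec.const c) (hpow.comp (Primrec.const 3) h1))
    (hpow.comp h2 (Primrec.const d))).to_comp

theorem length_le_bitSize (w : List ℕ) : w.length ≤ bitSize w := by
  induction w with
  | nil => simp
  | cons a w ih =>
    simp only [bitSize, List.map_cons, List.sum_cons, List.length_cons] at ih ⊢
    omega

/-- With at most `4 ^ k` dummy steps, the exponentials depend on `k` alone. The rest is at most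
quadratic in the input size `N`, and bit lengths may be estimated crudely by `N`. -/
theorem fpt : wsp3.FPT fun W => W.1.k := by
  obtain ⟨p, d, -, hp⟩ := exists_solvedBy
  refine ⟨p, fun k => 2600 * 3 ^ (k + 4 ^ k) * (6 * (2 * (k + 4 ^ k) + 9)) ^ d, d + 2,
    computable_bound _ _, fun W w hw => ?_⟩
  obtain ⟨τ, t, h1, h2, h3⟩ := hp W w hw
  refine ⟨τ, t, h1, h2, h3.trans ?_⟩
  obtain ⟨block, L, h⟩ := IsEncoding.exists_encoded hw
  obtain ⟨W, hW⟩ := W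
  simp only at h ⊢
  have hlen := h.length
  have hlN := length_le_bitSize w
  set N := bitSize w
  set e := W.k + 4 ^ W.k with he
  have hq : min W.numSim3 (4 ^ W.k) ≤ 4 ^ W.k := min_le_right _ _
  set q := min W.numSim3 (4 ^ W.k)
  have hn : W.n ≤ N := by
    have : W.n ≤ W.ℓ * W.n := Nat.le_mul_of_pos_left _ hW.ℓ_pos
    omega
  have hm : W.numOther + W.numSim3 ≤ N := by
    rw [← h.length_eq]
    have : L.length ≤ L.length * (2 + 2 * W.k) := Nat.le_mul_of_pos_right _ (by omega)
    omega
  have hN : 1 ≤ N := by omega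
  have hwork : W.work q ≤ 2 * 3 ^ e * N ^ 2 := by
    calc W.work q ≤ N * N * 3 ^ e + N ^ 2 * 3 ^ e := by
          refine (work_mono hq).trans ?_
          rw [work]
          gcongr
          norm_num
      _ = 2 * 3 ^ e * N ^ 2 := by ring
  have hbits : W.bits q + 2 ≤ 6 * (2 * e + 9) * N := by
    have s1 := (size_le_self W.n).trans hn
    have s2 := (size_le_self (W.numOther + W.numSim3)).trans hm
    calc W.bits q + 2 ≤ (2 * e + 8) * (6 * N) + 6 * N := by
          rw [bits]
          gcongr <;> omega
      _ = 6 * (2 * e + 9) * N := by ring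
  calc W.work q * (1300 * (W.bits q + 2) ^ d)
      ≤ 2 * 3 ^ e * N ^ 2 * (1300 * (6 * (2 * e + 9) * N) ^ d) := by gcongr
    _ = 2600 * 3 ^ e * (6 * (2 * e + 9)) ^ d * N ^ (d + 2) := by rw [mul_pow, pow_add]; ring

end Workflow

end WSP

/-! ### Redundant constraints -/

namespace WSP.Workflow

open Finset

variable {W : Workflow}

theorem hier_mono (W : Workflow) {i j : Fin W.ℓ} (h : i ≤ j) : W.hier i ≤ W.hier j := by
  obtain ⟨j, hj⟩ := j
  have h' : (i : ℕ) ≤ j := h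
  clear h
  induction j, h' using Nat.le_induction with
  | base => exact le_rfl
  | succ j _ ih =>
    exact (ih (by omega)).trans (W.hier_refines ⟨j, by omega⟩ ⟨j + 1, hj⟩ rfl)

/-- A disjoint pair of sets is encoded as a function on the steps with three values. Disjointness
makes the pair recoverable, and the pair determines the constraint. -/
theorem IsReduced.numSim3_le (h : W.IsReduced) : W.numSim3 ≤ 3 ^ W.k := by
  have hcard : (univ : Finset (Fin W.k → Fin 3)).card = 3 ^ W.k := by simp
  rw [← hcard]
  refine card_le_card_of_injOn
    (fun γ s => if s ∈ γ.S₁ then 1 else if s ∈ γ.S₂ then 2 else 0) (fun _ _ => mem_coe.2 (mem_univ _))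
    fun γ hγ γ' hγ' he => ?_
  obtain ⟨m, t⟩ := mem_filter.1 (mem_coe.1 hγ)
  obtain ⟨m', t'⟩ := mem_filter.1 (mem_coe.1 hγ')
  have d := disjoint_left.1 (h.1 γ m t)
  have d' := disjoint_left.1 (h.1 γ' m' t')
  have hs : ∀ s, (s ∈ γ.S₁ ↔ s ∈ γ'.S₁) ∧ (s ∈ γ.S₂ ↔ s ∈ γ'.S₂) := by
    intro s
    have := congrFun he s
    have := @d s
    have := @d' s
    by_cases h1 : s ∈ γ.S₁ <;> by_cases h2 : s ∈ γ.S₂ <;> by_cases h3 : s ∈ γ'.S₁ <;>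
      by_cases h4 : s ∈ γ'.S₂ <;> simp_all
  exact h.2 γ m γ' m' t t' (ext fun s => (hs s).1) (ext fun s => (hs s).2)

/-- A constraint is kept if it is not in `C_∼`, or if its sets are disjoint and no other constraint
in `C_∼` with the same sets concerns a lower level. -/
def IsKept (W : Workflow) (γ : Constraint W.k W.ℓ) : Prop :=
  γ.IsSim3 → Disjoint γ.S₁ γ.S₂ ∧ ∀ γ' ∈ W.constraints, γ'.IsSim3 → γ'.S₁ = γ.S₁ → γ'.S₂ = γ.S₂ →
    γ.level ≤ γ'.level

/-- Among the constraints of `C_∼` with the same sets, the one of lowest level implies the others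
because the relations increase. If the two sets have a common step, the constraint holds by
reflexivity and can be dropped. -/
theorem exists_reduced (W : Workflow) : ∃ D ⊆ W.constraints, (W.withConstraints D).IsReduced ∧
    ∀ π : Fin W.k → Fin W.n, (W.withConstraints D).IsValid π ↔ W.IsValid π := by
  classical
  refine ⟨W.constraints.filter W.IsKept, filter_subset _ _, ⟨fun γ hγ h3 => ?_,
    fun γ hγ γ' hγ' h3 h3' e₁ e₂ => ?_⟩, fun π => ⟨fun h => ⟨h.1, fun γ hγ => ?_⟩,
    fun h => ⟨h.1, fun γ hγ => h.2 γ (mem_filter.1 hγ).1⟩⟩⟩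
  · exact ((mem_filter.1 hγ).2 h3).1
  · obtain ⟨m, c⟩ := mem_filter.1 hγ
    obtain ⟨m', c'⟩ := mem_filter.1 hγ'
    have hl := le_antisymm ((c h3).2 γ' m' h3' e₁.symm e₂.symm) ((c' h3').2 γ m h3 e₁ e₂)
    have hs := h3.1.trans h3'.1.symm
    cases γ
    cases γ'
    simp_all
  · by_cases h3 : γ.IsSim3
    swap
    · exact h.2 γ (mem_filter.2 ⟨hγ, fun h' => absurd h' h3⟩)
    by_cases hd : Disjoint γ.S₁ γ.S₂
    · obtain ⟨γ', hγ', hmin⟩ := exists_min_image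
        (W.constraints.filter fun γ' => γ'.IsSim3 ∧ γ'.S₁ = γ.S₁ ∧ γ'.S₂ = γ.S₂)
        (fun γ' => γ'.level) ⟨γ, mem_filter.2 ⟨hγ, h3, rfl, rfl⟩⟩
      obtain ⟨m', h3', e₁, e₂⟩ := mem_filter.1 hγ'
      have hsat := h.2 γ' (mem_filter.2 ⟨m', fun _ => ⟨by rw [e₁, e₂]; exact hd,
        fun δ hδ t f₁ f₂ => hmin δ (mem_filter.2 ⟨hδ, t, f₁.trans e₁, f₂.trans e₂⟩)⟩⟩)
      rw [Constraint.Sat, h3'.1] at hsat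
      rw [Constraint.Sat, h3.1]
      obtain ⟨s₁, hs₁, s₂, hs₂, he⟩ := hsat
      exact ⟨s₁, e₁ ▸ hs₁, s₂, e₂ ▸ hs₂,
        W.hier_mono (hmin γ (mem_filter.2 ⟨hγ, h3, rfl, rfl⟩)) he⟩
    · obtain ⟨s, hs₁, hs₂⟩ := not_disjoint_iff.1 hd
      rw [Constraint.Sat, h3.1]
      exact ⟨s, hs₁, s, hs₂, (W.hier γ.level).refl _⟩

end WSP.Workflow

theorem theorem8 :
    -- the running time
    WSP.wsp3.SolvableInSoftO (fun W => W.1.timeBound) ∧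
    -- one may assume without loss of generality that `C_∼` is reduced, and then `c' ≤ 3 ^ k`
    (∀ W : WSP.Workflow, W.IsCanonical →
      (W.IsReduced → W.numSim3 ≤ 3 ^ W.k) ∧
      ∃ D ⊆ W.constraints, (W.withConstraints D).IsReduced ∧
        ∀ π : Fin W.k → Fin W.n, (W.withConstraints D).IsValid π ↔ W.IsValid π) ∧
    -- fixed-parameter tractability, with the number of steps as the parameter
    WSP.wsp3.FPT (fun W => W.1.k) :=
  ⟨WSP.Workflow.solvableInSoftO,
    fun W _ => ⟨WSP.Workflow.IsReduced.numSim3_le, W.exists_reduced⟩, WSP.Workflow.fpt⟩
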